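/- Let $R=(R,*)$ be a rack: every map $\bullet * a$ is a bijection of $R$, and $(a*b)*c=(a*c)*(b*c)$. Its kink map $\iota:R\to R$ is characterized by $\iota(a)*a=a$. Let $D$ be a diagram of an oriented $S^2$-knot, i.e. the image of a smoothly embedded oriented $2$-sphere in $\mathbb R^4$ under the projection $\mathbb R^4\to\mathbb R^3$ forgetting the fourth coordinate, this projection being generic on the sphere (only transverse double point curves, isolated triple points and isolated branch points, the latter being Whitney umbrellas), together with the information, at each double point, which sheet is higher with respect to the fourth coordinate. Cutting the sphere along the lower preimages of the double point curves gives the sheets of $D$. Let $L$ be a finite set of oriented immersed closed curves on the sphere, which intersects itself transversely and only in double points, is transverse to the preimages of the double point curves of $D$, and misses the preimages of the triple points and the branch points. Cutting the sheets of $D$ further along $L$ gives the sheets of $(D,L)$. Normal directions $\vec n$ are chosen so that $(\vec v_1,\vec v_2,\vec n)$ matches the orientation of $\mathbb R^3$ for an oriented basis $(\vec v_1,\vec v_2)$ of a sheet, and so that $(\vec v,\vec n)$ matches the orientation of the sphere for the velocity $\vec v$ of a curve of $L$. A rack coloring of $D$ is a map $c$ from the set of sheets of $D$ to $R$ such that along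 each double point curve, $c(x_k)=c(x_i)*c(x_j)$, where $x_j$ is the over-sheet and $x_i,x_k$ are the under-sheets, the normal direction of $x_j$ pointing from $x_i$ to $x_k$. A rack coloring of $(D,L)$ is a map $c$ from the set of sheets of $(D,L)$ to $R$ which satisfies the same relation along the double point curves of $D$, and $c(x_j)=\iota(c(x_i))$ whenever $x_i,x_j$ are the two sheets along an arc of $L$ whose normal direction points from $x_i$ to $x_j$. Let $\mathrm{Col}_R(D)$ and $\mathrm{Col}_R(D,L)$ be the sets of these colorings. Then for every $S^2$-knot diagram $D$ and every such $L$ there is a bijection between $\mathrm{Col}_R(D,L)$ and $\mathrm{Col}_R(D)$. -/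

import Mathlib

open Set Filter Topology Manifold
open scoped ContDiff

noncomputable section

namespace SurfaceKnot

/-! ### Racks

Mathlib's `Rack` acts from the left; the right operation `a * b` of a rack is `Shelf.act b a`. -/

/-- The rack operation `a * b`, for which every map `• ↦ • * a` is bijective and
`(a * b) * c = (a * c) * (b * c)`. -/
def op {R : Type*} [Rack R] (a b : R) : R := Shelf.act b a

/-- The (negative) kink map `ι` of a rack. -/
def kink {R : Type*} [Rack R] (a : R) : R := Rack.invAct a a

/-- `kink a` is the unique element with `ι(a) * a = a`. -/
theorem op_eq_self_iff_eq_kink {R : Type*} [Rack R] (a b : R) : op b a = a ↔ b = kink a := by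
  unfold op kink
  constructor
  · intro h
    have := Rack.left_inv a b
    rw [h] at this
    exact this.symm
  · rintro rfl
    exact Rack.right_inv a a

theorem op_bijective {R : Type*} [Rack R] (a : R) : Function.Bijective (fun b : R => op b a) :=
  (Rack.act' a).bijective

theorem op_op {R : Type*} [Rack R] (a b c : R) : op (op a b) c = op (op a c) (op b c) :=
  Shelf.self_distrib

/-! ### The sphere, its orientation, and generic maps to 3-space -/

/-- Euclidean 3-space. -/
abbrev E3 : Type := EuclideanSpace ℝ (Fin 3)

/-- Euclidean 4-space. -/
abbrev E4 : Type := EuclideanSpace ℝ (Fin 4)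

/-- The unit sphere `S²`, with Mathlib's smooth structure. -/
abbrev S2 : Type := Metric.sphere (0 : EuclideanSpace ℝ (Fin (2 + 1))) 1

/-- The determinant of three vectors of `ℝ³`; a triple is positively oriented iff it is positive. -/
def det3 (a b c : E3) : ℝ :=
  Matrix.det !![a 0, a 1, a 2; b 0, b 1, b 2; c 0, c 1, c 2]

/-- The inclusion `S² → ℝ³`. -/
def incl (x : S2) : E3 := (x : E3)

/-- The standard orientation of `S²` (as the boundary of the ball): a pair of vectors `u, v`,
tangent to `S²` at `x` and regarded as vectors of `ℝ³`, is positive iff `(x, u, v)` is. -/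
def PosPair (x : S2) (u v : E3) : Prop := 0 < det3 (incl x) u v

/-- A smooth path on `S²`. -/
def SmoothPath (δ : ℝ → S2) : Prop := ContMDiff 𝓘(ℝ, ℝ) (𝓡 2) ∞ δ

/-- The velocity of a path on `S²`, as a vector of `ℝ³`. -/
def velocity (δ : ℝ → S2) (t : ℝ) : E3 := deriv (fun s => incl (δ s)) t

/-- The differential of `g : S² → ℝ³` at `x`. -/
abbrev dmap (g : S2 → E3) (x : S2) : TangentSpace (𝓡 2) x →L[ℝ] E3 := mvfderiv (𝓡 2) g x

/-- `x` is a branch point of `g` : in suitable smooth local coordinates around `x` and `g x`,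
the map is the Whitney umbrella `(u, v) ↦ (u², uv, v)`. -/
def IsBranchPoint (g : S2 → E3) (x : S2) : Prop :=
  ∃ φ ∈ IsManifold.maximalAtlas (𝓡 2) ∞ S2, ∃ ψ ∈ IsManifold.maximalAtlas 𝓘(ℝ, E3) ∞ E3,
    x ∈ φ.source ∧ φ x = 0 ∧ g x ∈ ψ.source ∧ ψ (g x) = 0 ∧
    ∀ z ∈ φ.source, g z ∈ ψ.source ∧ ψ (g z) = !₂[(φ z 0) ^ 2, φ z 0 * φ z 1, φ z 1]

/-- A smooth map `g : S² → ℝ³` is generic: near every point it is either an immersion or a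
Whitney umbrella, two sheets cross transversely along double point curves, three sheets cross in
general position at triple points, there are no further multiple points, and no other sheet passes
through the image of a branch point. -/
structure IsGeneric (g : S2 → E3) : Prop where
  immersion_or_branch : ∀ x, Function.Injective (dmap g x) ∨ IsBranchPoint g x
  branch_simple : ∀ x y, IsBranchPoint g x → g y = g x → y = x
  double_transverse : ∀ x y, x ≠ y → g x = g y → (dmap g x).range ⊔ (dmap g y).range = ⊤
  triple_transverse : ∀ x y z, x ≠ y → x ≠ z → y ≠ z → g x = g y → g x = g z →
    (dmap g x).range ⊓ (dmap g y).range ⊓ (dmap g z).range = ⊥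
  no_quadruple : ∀ p, (g ⁻¹' {p}).encard ≤ 3

/-! ### Diagrams and sheets -/

/-- A diagram of an oriented `S²`-knot: the knot is parametrized by a smooth embedding of the
standard oriented sphere in `ℝ⁴`, and the projection forgetting the fourth coordinate is generic
on it. The crossing information is the fourth coordinate. -/
structure Diagram where
  knot : S2 → E4
  isSmoothEmbedding : IsSmoothEmbedding (𝓡 2) 𝓘(ℝ, E4) ∞ knot
  isGeneric : IsGeneric (fun x => !₂[knot x 0, knot x 1, knot x 2])

namespace Diagram

variable (D : Diagram)

/-- The projection of the knot to `ℝ³`. -/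
def proj (x : S2) : E3 := !₂[D.knot x 0, D.knot x 1, D.knot x 2]

/-- The height of a point of the knot. -/
def height (x : S2) : ℝ := D.knot x 3

/-- `x` and `y` form a double point of the projection (not a triple point), `x` lying on the
over-sheet and `y` on the under-sheet. -/
def IsCrossing (x y : S2) : Prop :=
  D.proj x = D.proj y ∧ D.height y < D.height x ∧
    ∀ z, D.proj z = D.proj x → z = x ∨ z = y

/-- The points which lie below another point of the knot. -/
def lower : Set S2 := {y | ∃ x, D.proj x = D.proj y ∧ D.height y < D.height x}

/-- What is left of the surface when it is cut along the under-arcs of the double point curves,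
and along a further set `C`. -/
def region (C : Set S2) : Set S2 := (closure D.lower ∪ C)ᶜ

/-- The sheets of the diagram, when it is moreover cut along `C`. -/
def Sheet (C : Set S2) : Type := ConnectedComponents (D.region C)

variable {D}

/-- The point `p` lies on the sheet `A`. -/
def OnSheet {C : Set S2} (A : D.Sheet C) (p : S2) : Prop :=
  ∃ h : p ∈ D.region C, (ConnectedComponents.mk (⟨p, h⟩ : D.region C)) = A

/-- The path `δ` passes at time `0` from the sheet `A` to the sheet `B`. -/
def Passes {C : Set S2} (δ : ℝ → S2) (A B : D.Sheet C) : Prop :=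
  (∀ᶠ s in 𝓝[<] (0 : ℝ), OnSheet A (δ s)) ∧ (∀ᶠ s in 𝓝[>] (0 : ℝ), OnSheet B (δ s))

variable (D)

/-- The vector `n` points to the side of the sheet of the diagram through `x` which is given by
its normal direction: `(v₁, v₂, n)` is positive in `ℝ³` if `(v₁, v₂)` is a positive basis of the
tangent plane. -/
def PositiveSide (x : S2) (n : E3) : Prop :=
  ∃ v₁ v₂ : TangentSpace (𝓡 2) x, PosPair x (dmap incl x v₁) (dmap incl x v₂) ∧
    0 < det3 (dmap D.proj x v₁) (dmap D.proj x v₂) n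

/-- The coloring relation along the double point curves: if, at a double point, a path `δ` on the
surface passes under the over-sheet `B` in its normal direction, from the under-sheet `A` to the
under-sheet `A'`, then `c(A') = c(A) * c(B)`. The isolated points of the double point curves at
which a sheet is cut by `C` are left out. -/
def DoubleRelation {R : Type*} [Rack R] {C : Set S2} (c : D.Sheet C → R) : Prop :=
  ∀ (x : S2) (δ : ℝ → S2) (A A' B : D.Sheet C), SmoothPath δ → D.IsCrossing x (δ 0) →
    x ∉ C → δ 0 ∉ C → D.PositiveSide x (deriv (fun s => D.proj (δ s)) 0) →
    OnSheet B x → Passes δ A A' → c A' = op (c A) (c B)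

/-- `Col_R(D)`: the rack colorings of `D` by `R`. -/
def Coloring (R : Type*) [Rack R] : Type _ :=
  {c : D.Sheet ∅ → R // D.DoubleRelation c}

/-- The parameters `(i, s)` and `(j, t)` are the same point of a disjoint union of circles
`ℝ / ℤ`. -/
def SameParam {m : ℕ} (i : Fin m) (s : ℝ) (j : Fin m) (t : ℝ) : Prop :=
  i = j ∧ ∃ k : ℤ, s = t + k

/-- A (finite) set of oriented immersed closed curves on a diagram, parametrized by `ℝ / ℤ`, with
transverse self-intersections that are double points, transverse to the double point curves of the
diagram, and missing its triple points and branch points. -/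
structure ImmersedCurves where
  card : ℕ
  curve : Fin card → ℝ → S2
  smooth : ∀ i, SmoothPath (curve i)
  periodic : ∀ i, Function.Periodic (curve i) 1
  immersed : ∀ i t, velocity (curve i) t ≠ 0
  self_transverse : ∀ i s j t, ¬ SameParam i s j t → curve i s = curve j t →
    LinearIndependent ℝ ![velocity (curve i) s, velocity (curve j) t]
  no_triple : ∀ i s j t k u, curve i s = curve j t → curve i s = curve k u →
    SameParam i s j t ∨ SameParam i s k u ∨ SameParam j t k u
  double_transverse : ∀ i t y, y ≠ curve i t → D.proj y = D.proj (curve i t) →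
    deriv (fun s => D.proj (curve i s)) t ∉ (dmap D.proj y).range
  misses_triple : ∀ i t y z, D.proj y = D.proj (curve i t) → D.proj z = D.proj (curve i t) →
    y = curve i t ∨ z = curve i t ∨ y = z
  misses_branch : ∀ i t, ¬ IsBranchPoint D.proj (curve i t)

variable {D}

/-- The union of the curves. -/
def ImmersedCurves.support (L : D.ImmersedCurves) : Set S2 := ⋃ i, range (L.curve i)

/-- The coloring relation along the immersed curves: if, at a simple point of the curves off the
under-arcs of the double point curves, a path `δ` crosses the curve in its normal direction, from
the sheet `A` to the sheet `A'`, then `c(A') = ι(c(A))`. The normal direction `n` of a curve with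
velocity `v` is such that `(v, n)` is positive. -/
def ImmersedCurves.CurveRelation {R : Type*} [Rack R] (L : D.ImmersedCurves)
    (c : D.Sheet L.support → R) : Prop :=
  ∀ (i : Fin L.card) (t : ℝ) (δ : ℝ → S2) (A A' : D.Sheet L.support), SmoothPath δ →
    δ 0 = L.curve i t → (∀ j s, L.curve j s = L.curve i t → SameParam j s i t) →
    δ 0 ∉ closure D.lower → PosPair (δ 0) (velocity (L.curve i) t) (velocity δ 0) →
    Passes δ A A' → c A' = kink (c A)

/-- `Col_R(D, L)`: the rack colorings of `D` with the immersed curves `L` by `R`. -/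
def ColoringWith (R : Type*) [Rack R] (L : D.ImmersedCurves) : Type _ :=
  {c : D.Sheet L.support → R // D.DoubleRelation c ∧ L.CurveRelation c}

end Diagram

end SurfaceKnot

end

noncomputable section

namespace SurfaceKnot

/-! ### Determinants in 3-space -/

/-! The kink map ι is a permutation of the rack which commutes with every right translation, ι(a *
b) = ι(a) * b, and which is invisible in the acting variable, a * ι(b) = a * b. Hence, if n is an
integer-valued function on the complement of the curves, locally constant there and increasing by
one whenever a curve is crossed in its normal direction, then a coloring c of D gives a coloring of
(D, L) by taking ι^n c on each piece of a sheet (`twist`). The two under-sheets at a crossing off L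
have the same index, so the double point relation survives (`doubleRelation_twist`), while the jump
of n produces the factor ι along L (`curveRelation_twist`).

Conversely, multiplying a coloring of (D, L) by ι^(-n) removes the jumps at simple points of L. The
result extends over the curves, because their multiple points are isolated and punctured discs are
connected (`exists_extension`), and descends to the sheets of D (`exists_twist_eq`). A crossing of D
lying on L carries no relation in (D, L). By transversality it can be moved along the double point
curve to a nearby crossing off L with the same three sheets (`exists_crossing_notMem`).

The function n is an Alexander numbering, which exists because closed curves on a sphere are
null-homologous. It is built analytically: `windingIntegral` is locally constant off a curve, since
the derivative of its integrand in the base point is exact along the curve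
(`windingIntegral_eq_of_segment`), and it jumps by 2π at a simple point (`windingIntegral_jump`).
The sum over all curves, divided by 2π, jumps by one. Its fractional part therefore extends to a
constant on the connected sphere, and its floor is n (`exists_index`).

Calculus on the sphere is reduced to calculus in space by precomposing maps with the radial
projection. -/

theorem det3_expand (a b c : E3) : det3 a b c =
    a 0 * b 1 * c 2 - a 0 * b 2 * c 1 - a 1 * b 0 * c 2 + a 1 * b 2 * c 0
      + a 2 * b 0 * c 1 - a 2 * b 1 * c 0 := by
  simp [det3, Matrix.det_fin_three]

theorem inner_expand (a b : E3) : inner ℝ a b = a 0 * b 0 + a 1 * b 1 + a 2 * b 2 := by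
  rw [PiLp.inner_apply, Fin.sum_univ_three]
  simp [mul_comm]

theorem tendsto_det3 {α : Type*} {l : Filter α} {f g h : α → E3} {a b c : E3}
    (hf : Tendsto f l (𝓝 a)) (hg : Tendsto g l (𝓝 b)) (hh : Tendsto h l (𝓝 c)) :
    Tendsto (fun x => det3 (f x) (g x) (h x)) l (𝓝 (det3 a b c)) := by
  have key : ∀ {k : α → E3} {d : E3}, Tendsto k l (𝓝 d) → ∀ i,
      Tendsto (fun x => k x i) l (𝓝 (d i)) := by
    intro k d hk i
    exact ((EuclideanSpace.proj (𝕜 := ℝ) i).continuous.tendsto d).comp hk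
  have f0 := key hf 0
  have f1 := key hf 1
  have f2 := key hf 2
  have g0 := key hg 0
  have g1 := key hg 1
  have g2 := key hg 2
  have h0 := key hh 0
  have h1 := key hh 1
  have h2 := key hh 2
  simp only [det3_expand]
  exact ((((((f0.mul g1).mul h2).sub ((f0.mul g2).mul h1)).sub ((f1.mul g0).mul h2)).add
    ((f1.mul g2).mul h0)).add ((f2.mul g0).mul h1)).sub ((f2.mul g1).mul h0)

theorem continuous_det3 {α : Type*} [TopologicalSpace α] {f g h : α → E3} (hf : Continuous f)
    (hg : Continuous g) (hh : Continuous h) : Continuous (fun x => det3 (f x) (g x) (h x)) :=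
  continuous_iff_continuousAt.2 fun x =>
    tendsto_det3 (hf.tendsto x) (hg.tendsto x) (hh.tendsto x)

/-- Cramer's rule: weighting the three coordinate equations by cofactors leaves one coefficient
times the determinant. This is how the derivatives of the various local coordinate maps below are
shown to be injective. -/
theorem det3_linearIndependent {a b c : E3} (h : det3 a b c ≠ 0) {p q r : ℝ}
    (hz : p • a + q • b + r • c = 0) : p = 0 ∧ q = 0 ∧ r = 0 := by
  have e : ∀ i, p * a i + q * b i + r * c i = 0 := fun i => by
    have := congrArg (fun z : E3 => z i) hz
    simpa using this
  have e0 := e 0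
  have e1 := e 1
  have e2 := e 2
  rw [det3_expand] at h
  refine ⟨?_, ?_, ?_⟩
  · have : p * (a 0 * b 1 * c 2 - a 0 * b 2 * c 1 - a 1 * b 0 * c 2 + a 1 * b 2 * c 0
      + a 2 * b 0 * c 1 - a 2 * b 1 * c 0) = 0 := by
      linear_combination (b 1 * c 2 - b 2 * c 1) * e0 + (b 2 * c 0 - b 0 * c 2) * e1
        + (b 0 * c 1 - b 1 * c 0) * e2
    exact (mul_eq_zero.1 this).resolve_right h
  · have : q * (a 0 * b 1 * c 2 - a 0 * b 2 * c 1 - a 1 * b 0 * c 2 + a 1 * b 2 * c 0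
      + a 2 * b 0 * c 1 - a 2 * b 1 * c 0) = 0 := by
      linear_combination (c 1 * a 2 - c 2 * a 1) * e0 + (c 2 * a 0 - c 0 * a 2) * e1
        + (c 0 * a 1 - c 1 * a 0) * e2
    exact (mul_eq_zero.1 this).resolve_right h
  · have : r * (a 0 * b 1 * c 2 - a 0 * b 2 * c 1 - a 1 * b 0 * c 2 + a 1 * b 2 * c 0
      + a 2 * b 0 * c 1 - a 2 * b 1 * c 0) = 0 := by
      linear_combination (a 1 * b 2 - a 2 * b 1) * e0 + (a 2 * b 0 - a 0 * b 2) * e1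
        + (a 0 * b 1 - a 1 * b 0) * e2
    exact (mul_eq_zero.1 this).resolve_right h

/-- The cross product of two vectors of `ℝ³`. -/
def cross (a b : E3) : E3 :=
  !₂[a 1 * b 2 - a 2 * b 1, a 2 * b 0 - a 0 * b 2, a 0 * b 1 - a 1 * b 0]

theorem inner_cross_left (a b : E3) : inner ℝ a (cross a b) = 0 := by
  rw [inner_expand]; simp [cross]; ring

theorem det3_cross (a b : E3) :
    det3 a b (cross a b) = inner ℝ a a * inner ℝ b b - (inner ℝ a b) ^ 2 := by
  rw [det3_expand, inner_expand, inner_expand, inner_expand]; simp [cross]; ring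

/-- The square of a determinant is the determinant of the Gram matrix. -/
theorem det3_sq_gram (a b c : E3) : det3 a b c ^ 2 =
    inner ℝ a a * (inner ℝ b b * inner ℝ c c - (inner ℝ b c) ^ 2)
      - inner ℝ a b * (inner ℝ a b * inner ℝ c c - inner ℝ a c * inner ℝ b c)
      + inner ℝ a c * (inner ℝ a b * inner ℝ b c - inner ℝ a c * inner ℝ b b) := by
  simp only [inner_expand, det3_expand]
  ring

theorem det3_sq (a b c : E3) (ha : inner ℝ a a = 1) (hb : inner ℝ a b = 0)
    (hc : inner ℝ a c = 0) :
    det3 a b c ^ 2 = inner ℝ b b * inner ℝ c c - (inner ℝ b c) ^ 2 := by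
  rw [det3_sq_gram, ha, hb, hc]; ring

/-- This is the expansion of a 4 × 4 determinant with columns (⟨a, z⟩, z) for z = w, u, g, v; its
first row is a combination of the others. Applied with `a = w` and `a = g`, it yields the exactness
behind the invariance of the winding integral. -/
theorem det3_inner_identity (a w u g v : E3) :
    inner ℝ a w * det3 u g v - inner ℝ a u * det3 w g v + inner ℝ a g * det3 w u v
      - inner ℝ a v * det3 w u g = 0 := by
  simp only [inner_expand, det3_expand]
  ring

theorem det3_smul₁ (r : ℝ) (a b c : E3) : det3 (r • a) b c = r * det3 a b c := by
  simp only [det3_expand, PiLp.smul_apply, smul_eq_mul]; ring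

theorem det3_smul₃ (r : ℝ) (a b c : E3) : det3 a b (r • c) = r * det3 a b c := by
  simp only [det3_expand, PiLp.smul_apply, smul_eq_mul]; ring

theorem det3_add₃ (a b c c' : E3) : det3 a b (c + c') = det3 a b c + det3 a b c' := by
  simp only [det3_expand, PiLp.add_apply]; ring

theorem det3_sub₁ (a a' b c : E3) : det3 (a - a') b c = det3 a b c - det3 a' b c := by
  simp only [det3_expand, PiLp.sub_apply]; ring

theorem det3_sub₂ (a b b' c : E3) : det3 a (b - b') c = det3 a b c - det3 a b' c := by
  simp only [det3_expand, PiLp.sub_apply]; ring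

theorem det3_self₁₂ (a c : E3) : det3 a a c = 0 := by
  simp only [det3_expand]; ring

theorem det3_self₁₃ (a b : E3) : det3 a b a = 0 := by
  simp only [det3_expand]; ring

theorem det3_self₂₃ (a b : E3) : det3 a b b = 0 := by
  simp only [det3_expand]; ring

theorem det3_rotate (a b c : E3) : det3 a b c = det3 c a b := by
  simp only [det3_expand]; ring

/-! ### Radial projection to the sphere -/

theorem norm_incl (x : S2) : ‖incl x‖ = 1 := by
  simp [incl]

theorem incl_ne_zero (x : S2) : incl x ≠ 0 := fun h => by
  have := norm_incl x
  rw [h, norm_zero] at this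
  exact zero_ne_one this

theorem inner_incl_self (x : S2) : inner ℝ (incl x) (incl x) = 1 := by
  rw [real_inner_self_eq_norm_sq, norm_incl]; norm_num

theorem incl_injective : Function.Injective incl := Subtype.coe_injective

theorem continuous_incl : Continuous incl := continuous_subtype_val

/-- The radial projection `ℝ³ ∖ {0} → S²` (with an arbitrary value at the origin). -/
def radial (z : E3) : S2 :=
  if h : z = 0 then ⟨EuclideanSpace.single 0 1, by simp⟩
  else ⟨‖z‖⁻¹ • z, by simp [norm_smul, h]⟩

theorem incl_radial {z : E3} (h : z ≠ 0) : incl (radial z) = ‖z‖⁻¹ • z := by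
  simp [incl, radial, h]

theorem smul_incl_radial {z : E3} (h : z ≠ 0) : ‖z‖ • incl (radial z) = z := by
  rw [incl_radial h, smul_smul, mul_inv_cancel₀ (norm_ne_zero_iff.2 h), one_smul]

theorem radial_incl (x : S2) : radial (incl x) = x :=
  incl_injective (by rw [incl_radial (incl_ne_zero x), norm_incl]; simp)

theorem radial_smul {r : ℝ} (hr : 0 < r) (z : E3) : radial (r • z) = radial z := by
  by_cases hz : z = 0
  · simp [hz]
  · apply incl_injective
    rw [incl_radial hz, incl_radial (smul_ne_zero hr.ne' hz), norm_smul, smul_smul,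
      Real.norm_of_nonneg hr.le, mul_inv, mul_comm r⁻¹, mul_assoc, inv_mul_cancel₀ hr.ne', mul_one]

theorem contMDiffOn_radial : ContMDiffOn 𝓘(ℝ, E3) (𝓡 2) ∞ radial {0}ᶜ := by
  let U : TopologicalSpace.Opens E3 := ⟨{0}ᶜ, isOpen_compl_singleton⟩
  have h0 : ∀ z : U, (z : E3) ≠ 0 := fun z => z.2
  have h1 : ContMDiff 𝓘(ℝ, E3) 𝓘(ℝ, E3) ∞ (fun z : U => ‖(z : E3)‖⁻¹ • (z : E3)) := by
    intro z
    have : ContDiffAt ℝ ∞ (fun z : E3 => ‖z‖⁻¹ • z) (z : E3) :=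
      ((contDiffAt_norm ℝ (h0 z)).inv (norm_ne_zero_iff.2 (h0 z))).smul contDiffAt_id
    exact this.contMDiffAt.comp z contMDiff_subtype_val.contMDiffAt
  have : Fact (Module.finrank ℝ E3 = 2 + 1) := ⟨by simp⟩
  have h2 := h1.codRestrict_sphere (n := 2) (fun z => by simp [norm_smul, h0 z])
  intro z hz
  have h3 := h2 ⟨z, hz⟩
  have h4 : (Set.codRestrict (fun z : U => ‖(z : E3)‖⁻¹ • (z : E3)) (Metric.sphere (0 : E3) 1)
      (fun z => by simp [norm_smul, h0 z])) = (fun z : U => radial z) := by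
    ext1 w
    apply incl_injective
    rw [incl_radial (h0 w)]
    rfl
  rw [h4] at h3
  exact (contMDiffAt_subtype_iff.1 h3).contMDiffWithinAt

theorem contMDiffAt_radial {z : E3} (hz : z ≠ 0) : ContMDiffAt 𝓘(ℝ, E3) (𝓡 2) ∞ radial z :=
  contMDiffOn_radial.contMDiffAt (isOpen_compl_singleton.mem_nhds hz)

theorem continuousAt_radial {z : E3} (hz : z ≠ 0) : ContinuousAt radial z :=
  (contMDiffAt_radial hz).continuousAt

/-- The neighbourhoods of a point of the sphere are the radial projections of its neighbourhoods
in space. -/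
theorem map_radial_nhds (x : S2) : map radial (𝓝 (incl x)) = 𝓝 x := by
  apply le_antisymm
  · have := (continuousAt_radial (incl_ne_zero x))
    rwa [ContinuousAt, radial_incl] at this
  · have h : map radial (map incl (𝓝 x)) = 𝓝 x := by
      rw [Filter.map_map]
      convert Filter.map_id
      ext1 y; exact radial_incl y
    conv_lhs => rw [← h]
    exact Filter.map_mono continuous_incl.continuousAt

/-! ### Smooth paths -/

theorem contMDiff_incl : ContMDiff (𝓡 2) 𝓘(ℝ, E3) ∞ incl :=
  have : Fact (Module.finrank ℝ E3 = 2 + 1) := ⟨by simp⟩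
  contMDiff_coe_sphere (n := 2)

theorem SmoothPath.contDiff {δ : ℝ → S2} (h : SmoothPath δ) :
    ContDiff ℝ ∞ (fun s => incl (δ s)) := by
  have : ContMDiff 𝓘(ℝ, ℝ) 𝓘(ℝ, E3) ∞ (fun s => incl (δ s)) :=
    contMDiff_incl.comp h
  exact this.contDiff

theorem SmoothPath.continuous {δ : ℝ → S2} (h : SmoothPath δ) : Continuous δ :=
  ContMDiff.continuous h

theorem SmoothPath.radial {f : ℝ → E3} (h : ContDiff ℝ ∞ f) (h0 : ∀ s, f s ≠ 0) :
    SmoothPath (fun s => radial (f s)) := fun s =>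
  (contMDiffAt_radial (h0 s)).comp s h.contMDiff.contMDiffAt

theorem SmoothPath.hasStrictDerivAt {δ : ℝ → S2} (h : SmoothPath δ) (t : ℝ) :
    HasStrictDerivAt (fun s => incl (δ s)) (velocity δ t) t :=
  h.contDiff.contDiffAt.hasStrictDerivAt (by simp)

theorem SmoothPath.hasDerivAt {δ : ℝ → S2} (h : SmoothPath δ) (t : ℝ) :
    HasDerivAt (fun s => incl (δ s)) (velocity δ t) t :=
  (h.hasStrictDerivAt t).hasDerivAt

theorem SmoothPath.inner_velocity {δ : ℝ → S2} (h : SmoothPath δ) (t : ℝ) :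
    inner ℝ (incl (δ t)) (velocity δ t) = 0 := by
  have h1 := (h.hasDerivAt t).inner ℝ (h.hasDerivAt t)
  have h2 : HasDerivAt (fun s => inner ℝ (incl (δ s)) (incl (δ s))) 0 t := by
    simp only [inner_incl_self]
    exact hasDerivAt_const _ _
  have := h1.unique h2
  rw [real_inner_comm] at this
  linarith [this, real_inner_comm (incl (δ t)) (velocity δ t)]

theorem SmoothPath.contDiff_velocity {δ : ℝ → S2} (h : SmoothPath δ) :
    ContDiff ℝ ∞ (velocity δ) := by
  have := h.contDiff
  exact (contDiff_infty_iff_deriv.1 this).2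

/-! ### The differential of a map on the sphere, computed in space -/

theorem contDiffAt_comp_radial {g : S2 → E3} (hg : ContMDiff (𝓡 2) 𝓘(ℝ, E3) ∞ g) {z : E3}
    (hz : z ≠ 0) : ContDiffAt ℝ ∞ (fun z => g (radial z)) z :=
  (hg.contMDiffAt.comp z (contMDiffAt_radial hz)).contDiffAt

/-- The chain rule for the factorization of `g` as `g ∘ radial` after `incl`. It trades the manifold
derivative for an ordinary Fréchet derivative on `E3`, where the base point can vary without
changing the domain. -/
theorem dmap_apply {g : S2 → E3} (hg : ContMDiff (𝓡 2) 𝓘(ℝ, E3) ∞ g) (x : S2)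
    (v : TangentSpace (𝓡 2) x) :
    dmap g x v = fderiv ℝ (fun z => g (radial z)) (incl x) (dmap incl x v) := by
  have h1 : MDifferentiableAt 𝓘(ℝ, E3) 𝓘(ℝ, E3) (fun z => g (radial z)) (incl x) :=
    ((contDiffAt_comp_radial hg (incl_ne_zero x)).differentiableAt (by simp)).mdifferentiableAt
  have h2 : MDifferentiableAt (𝓡 2) 𝓘(ℝ, E3) incl x :=
    contMDiff_incl.contMDiffAt.mdifferentiableAt (by simp)
  have h3 : g = (fun z => g (radial z)) ∘ incl := by
    ext1 y; simp [radial_incl]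
  have h4 : mfderiv (𝓡 2) 𝓘(ℝ, E3) g x = (mfderiv 𝓘(ℝ, E3) 𝓘(ℝ, E3) (fun z => g (radial z))
      (incl x)).comp (mfderiv (𝓡 2) 𝓘(ℝ, E3) incl x) := by
    conv_lhs => rw [h3]
    exact mfderiv_comp x h1 h2
  have h5 : dmap g x v = mfderiv (𝓡 2) 𝓘(ℝ, E3) g x v := rfl
  rw [h5, h4, mfderiv_eq_fderiv]
  rfl

theorem range_dmap_incl (x : S2) : (dmap incl x).range = (ℝ ∙ incl x)ᗮ :=
  have : Fact (Module.finrank ℝ E3 = 2 + 1) := ⟨by simp⟩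
  range_mvfderiv_subtypeVal (n := 2) x

theorem exists_dmap_incl {x : S2} {u : E3} (hu : inner ℝ (incl x) u = 0) :
    ∃ v, dmap incl x v = u := by
  have : u ∈ (dmap incl x).range := by
    rw [range_dmap_incl, Submodule.mem_orthogonal_singleton_iff_inner_right]
    exact hu
  exact this

/-- The composite with `radial` is constant along rays. -/
theorem fderiv_comp_radial_self {g : S2 → E3} (hg : ContMDiff (𝓡 2) 𝓘(ℝ, E3) ∞ g) (x : S2) :
    fderiv ℝ (fun z => g (radial z)) (incl x) (incl x) = 0 := by
  have h1 : HasFDerivAt (fun z => g (radial z)) (fderiv ℝ (fun z => g (radial z)) (incl x))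
      ((1 : ℝ) • incl x) := by
    rw [one_smul]
    exact ((contDiffAt_comp_radial hg (incl_ne_zero x)).differentiableAt (by simp)).hasFDerivAt
  have h2 : HasDerivAt (fun r : ℝ => r • incl x) (incl x) 1 := by
    simpa using (hasDerivAt_id (1 : ℝ)).smul_const (incl x)
  have h3 := h1.comp_hasDerivAt (1 : ℝ) h2
  have h4 : HasDerivAt (fun _ : ℝ => g x) 0 1 := hasDerivAt_const _ _
  have h5 : (fun r : ℝ => g (radial (r • incl x))) =ᶠ[𝓝 1] fun _ => g x := by
    filter_upwards [lt_mem_nhds (zero_lt_one' ℝ)] with r hr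
    rw [radial_smul hr, radial_incl]
  exact h3.unique (h4.congr_of_eventuallyEq h5)

/-- Every vector is the sum of a radial and a tangential one. -/
theorem exists_tangent_add (x : S2) (z : E3) :
    ∃ (v : TangentSpace (𝓡 2) x), z = (inner ℝ (incl x) z) • incl x + dmap incl x v := by
  obtain ⟨v, hv⟩ := exists_dmap_incl (x := x) (u := z - (inner ℝ (incl x) z) • incl x) (by
    rw [inner_sub_right, inner_smul_right, inner_incl_self]; ring)
  exact ⟨v, by rw [hv]; abel⟩

theorem range_dmap {g : S2 → E3} (hg : ContMDiff (𝓡 2) 𝓘(ℝ, E3) ∞ g) (x : S2) (z : E3) :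
    z ∈ (dmap g x).range ↔ ∃ u, fderiv ℝ (fun z => g (radial z)) (incl x) u = z := by
  constructor
  · rintro ⟨v, rfl⟩
    exact ⟨_, (dmap_apply hg x v).symm⟩
  · rintro ⟨u, rfl⟩
    obtain ⟨v, hv⟩ := exists_tangent_add x u
    refine ⟨v, ?_⟩
    conv_rhs => rw [hv]
    rw [map_add, map_smul, fderiv_comp_radial_self hg, smul_zero, zero_add]
    exact dmap_apply hg x v

/-- The tangential part of `u` is killed by an injective differential, so only the radial part is
left. -/
theorem fderiv_comp_radial_ker {g : S2 → E3} (hg : ContMDiff (𝓡 2) 𝓘(ℝ, E3) ∞ g) {x : S2}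
    (hx : Function.Injective (dmap g x)) {u : E3}
    (hu : fderiv ℝ (fun z => g (radial z)) (incl x) u = 0) : u = (inner ℝ (incl x) u) • incl x := by
  obtain ⟨v, hv⟩ := exists_tangent_add x u
  have h1 : dmap g x v = 0 := by
    have h3 := congrArg (fderiv ℝ (fun z => g (radial z)) (incl x)) hv
    rw [hu, map_add, map_smul, fderiv_comp_radial_self hg, smul_zero, zero_add] at h3
    rw [dmap_apply hg, ← h3]
  have h2 : v = 0 := hx (by rw [h1, map_zero])
  rw [h2, map_zero, add_zero] at hv
  exact hv

theorem deriv_comp_path {g : S2 → E3} (hg : ContMDiff (𝓡 2) 𝓘(ℝ, E3) ∞ g) {δ : ℝ → S2}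
    (hδ : SmoothPath δ) (t : ℝ) : HasDerivAt (fun s => g (δ s))
      (fderiv ℝ (fun z => g (radial z)) (incl (δ t)) (velocity δ t)) t := by
  have h1 := ((contDiffAt_comp_radial hg (incl_ne_zero (δ t))).differentiableAt
    (by simp)).hasFDerivAt
  have h2 := h1.comp_hasDerivAt t (hδ.hasDerivAt t)
  have h3 : ((fun z => g (radial z)) ∘ fun s => incl (δ s)) = fun s => g (δ s) := by
    ext1 s; simp [radial_incl]
  rwa [h3] at h2

/-! ### The differential of the projection and the positive side of a sheet -/

namespace Diagram

theorem contMDiff_proj (D : Diagram) : ContMDiff (𝓡 2) 𝓘(ℝ, E3) ∞ D.proj := by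
  have h1 : ContMDiff (𝓡 2) 𝓘(ℝ, E4) ∞ D.knot := D.isSmoothEmbedding.contMDiff
  have h2 : ContDiff ℝ ∞ (fun z : E4 => (!₂[z 0, z 1, z 2] : E3)) := by
    rw [contDiff_euclidean]
    intro i
    have key : ∀ j, ContDiff ℝ ∞ (fun z : E4 => z j) := fun j =>
      (contDiff_euclidean.1 contDiff_id) j
    fin_cases i
    · exact key 0
    · exact key 1
    · exact key 2
  exact h2.contMDiff.comp h1

theorem continuous_proj (D : Diagram) : Continuous D.proj := D.contMDiff_proj.continuous

theorem continuous_height (D : Diagram) : Continuous D.height := by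
  have h1 : Continuous D.knot := (D.isSmoothEmbedding.contMDiff).continuous
  exact (EuclideanSpace.proj (𝕜 := ℝ) (3 : Fin 4)).continuous.comp h1

/-- The differential of the projection, on space. -/
def diff (D : Diagram) (x : S2) : E3 →L[ℝ] E3 := fderiv ℝ (fun z => D.proj (radial z)) (incl x)

theorem continuous_diff (D : Diagram) : Continuous D.diff := by
  rw [continuous_iff_continuousAt]
  intro x
  have h1 : ContDiffAt ℝ 0 (fderiv ℝ (fun z => D.proj (radial z))) (incl x) :=
    (contDiffAt_comp_radial D.contMDiff_proj (incl_ne_zero x)).fderiv_right (m := 0) (by simp)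
  exact ContinuousAt.comp (f := incl) h1.continuousAt continuous_incl.continuousAt

/-- Radial components of `u₁`, `u₂` change neither determinant: the first contains `incl x` as a
row, and `D.diff x` kills `incl x`. Test vectors in the fixed space `E3` make the condition
comparable at different points. -/
theorem positiveSide_iff (D : Diagram) (x : S2) (n : E3) : D.PositiveSide x n ↔
    ∃ u₁ u₂ : E3, 0 < det3 (incl x) u₁ u₂ ∧ 0 < det3 (D.diff x u₁) (D.diff x u₂) n := by
  constructor
  · rintro ⟨v₁, v₂, h, h'⟩
    rw [dmap_apply D.contMDiff_proj, dmap_apply D.contMDiff_proj] at h'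
    exact ⟨_, _, h, h'⟩
  · rintro ⟨u₁, u₂, h, h'⟩
    obtain ⟨v₁, hv₁⟩ := exists_tangent_add x u₁
    obtain ⟨v₂, hv₂⟩ := exists_tangent_add x u₂
    refine ⟨v₁, v₂, ?_, ?_⟩
    · unfold PosPair
      convert h using 1
      conv_rhs => rw [hv₁, hv₂]
      simp only [det3_expand, PiLp.add_apply, PiLp.smul_apply, smul_eq_mul]
      ring
    · rw [dmap_apply D.contMDiff_proj, dmap_apply D.contMDiff_proj]
      convert h' using 2
      · conv_rhs => rw [hv₁, diff, map_add, map_smul, fderiv_comp_radial_self D.contMDiff_proj,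
          smul_zero, zero_add]
      · conv_rhs => rw [hv₂, diff, map_add, map_smul, fderiv_comp_radial_self D.contMDiff_proj,
          smul_zero, zero_add]

/-- With the same test vectors `u₁`, `u₂`, both determinants depend continuously on the point and
the vector. -/
theorem PositiveSide.eventually {D : Diagram} {x : S2} {n : E3} (h : D.PositiveSide x n) :
    ∀ᶠ p : S2 × E3 in 𝓝 (x, n), D.PositiveSide p.1 p.2 := by
  simp only [positiveSide_iff] at h ⊢
  obtain ⟨u₁, u₂, h1, h2⟩ := h
  have c1 : Continuous (fun p : S2 × E3 => det3 (incl p.1) u₁ u₂) :=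
    continuous_det3 (continuous_incl.comp continuous_fst) continuous_const continuous_const
  have c2 : Continuous (fun p : S2 × E3 => det3 (D.diff p.1 u₁) (D.diff p.1 u₂) p.2) :=
    continuous_det3 ((D.continuous_diff.comp continuous_fst).clm_apply continuous_const)
      ((D.continuous_diff.comp continuous_fst).clm_apply continuous_const) continuous_snd
  filter_upwards [c1.continuousAt.eventually (lt_mem_nhds h1),
    c2.continuousAt.eventually (lt_mem_nhds h2)] with p h3 h4
  exact ⟨u₁, u₂, h3, h4⟩

/-- A vector pointing strictly to one side of the sheet cannot be tangent to it. -/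
theorem PositiveSide.diff_ne {D : Diagram} {x : S2} {n : E3} (h : D.PositiveSide x n)
    (u : E3) : D.diff x u ≠ n := by
  rintro rfl
  obtain ⟨u₁, u₂, h1, h2⟩ := (D.positiveSide_iff x _).1 h
  -- Cramer's rule for `u` in the basis `incl x`, `u₁`, `u₂`; the `incl x` term disappears under
  -- `D.diff x`.
  have h3 : det3 (incl x) u₁ u₂ • u = det3 u u₁ u₂ • incl x + det3 (incl x) u u₂ • u₁
      + det3 (incl x) u₁ u • u₂ := by
    ext i
    simp only [det3_expand, PiLp.add_apply, PiLp.smul_apply, smul_eq_mul]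
    fin_cases i <;> simp <;> ring
  have h4 := congrArg (D.diff x) h3
  have h5 : D.diff x (incl x) = 0 := fderiv_comp_radial_self D.contMDiff_proj x
  simp only [map_add, map_smul, h5, smul_zero, zero_add] at h4
  have h6 : det3 (incl x) u₁ u₂ * det3 (D.diff x u₁) (D.diff x u₂) (D.diff x u) = 0 := by
    rw [← det3_smul₃, h4, det3_add₃, det3_smul₃, det3_smul₃, det3_self₁₃, det3_self₂₃]
    ring
  exact (mul_pos h1 h2).ne' h6

theorem dmap_injective_of_double (D : Diagram) {x y : S2} (h : D.proj x = D.proj y) (hxy : x ≠ y) :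
    Function.Injective (dmap D.proj x) := by
  rcases D.isGeneric.immersion_or_branch x with h1 | h1
  · exact h1
  · exact absurd (D.isGeneric.branch_simple x y h1 h.symm).symm hxy

end Diagram

/-! ### Maps with injective derivative -/

/-- In finite dimension an injective linear map is bounded below by some `K⁻¹`; strict
differentiability makes the error at most half of that near `(a, a)`. -/
theorem HasStrictFDerivAt.exists_antilipschitz {E F : Type*} [NormedAddCommGroup E]
    [NormedSpace ℝ E] [FiniteDimensional ℝ E] [NormedAddCommGroup F] [NormedSpace ℝ F]
    {f : E → F} {f' : E →L[ℝ] F} {a : E} (hf : HasStrictFDerivAt f f' a)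
    (hi : ∀ v, f' v = 0 → v = 0) :
    ∃ c > 0, ∀ᶠ p : E × E in 𝓝 (a, a), c * ‖p.1 - p.2‖ ≤ ‖f p.1 - f p.2‖ := by
  obtain ⟨K, hK, h⟩ := LinearMap.exists_antilipschitzWith (f' : E →ₗ[ℝ] F)
    (LinearMap.ker_eq_bot'.2 hi)
  have hK' : (0 : ℝ) < K := hK
  refine ⟨(K : ℝ)⁻¹ / 2, by positivity, ?_⟩
  filter_upwards [hf.isLittleO.def (c := (K : ℝ)⁻¹ / 2) (by positivity)] with p hp
  have h1 : ‖p.1 - p.2‖ ≤ K * ‖f' (p.1 - p.2)‖ := by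
    have := h.le_mul_dist (p.1 - p.2) 0
    simpa [dist_eq_norm] using this
  have h2 : (K : ℝ)⁻¹ * ‖p.1 - p.2‖ ≤ ‖f' (p.1 - p.2)‖ := by
    rw [inv_mul_le_iff₀ hK']; exact h1
  have h3 := norm_sub_norm_le (f' (p.1 - p.2)) (f' (p.1 - p.2) - (f p.1 - f p.2))
  rw [sub_sub_cancel, norm_sub_rev (f' (p.1 - p.2))] at h3
  linarith

theorem HasStrictFDerivAt.eventually_injective {E F : Type*} [NormedAddCommGroup E]
    [NormedSpace ℝ E] [FiniteDimensional ℝ E] [NormedAddCommGroup F] [NormedSpace ℝ F]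
    {f : E → F} {f' : E →L[ℝ] F} {a : E} (hf : HasStrictFDerivAt f f' a)
    (hi : ∀ v, f' v = 0 → v = 0) :
    ∀ᶠ p : E × E in 𝓝 (a, a), f p.1 = f p.2 → p.1 = p.2 := by
  obtain ⟨c, hc, h⟩ := HasStrictFDerivAt.exists_antilipschitz hf hi
  filter_upwards [h] with p hp he
  rw [he, sub_self, norm_zero] at hp
  have : ‖p.1 - p.2‖ = 0 := by nlinarith [norm_nonneg (p.1 - p.2)]
  exact sub_eq_zero.1 (norm_eq_zero.1 this)

theorem HasStrictFDerivAt.eventually_ne {E F : Type*} [NormedAddCommGroup E]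
    [NormedSpace ℝ E] [FiniteDimensional ℝ E] [NormedAddCommGroup F] [NormedSpace ℝ F]
    {f : E → F} {f' : E →L[ℝ] F} {a : E} (hf : HasStrictFDerivAt f f' a)
    (hi : ∀ v, f' v = 0 → v = 0) : ∀ᶠ p : E in 𝓝 a, f p = f a → p = a := by
  have h : Tendsto (fun p : E => (p, a)) (𝓝 a) (𝓝 (a, a)) :=
    (Continuous.prodMk_left a).tendsto a
  exact h.eventually (HasStrictFDerivAt.eventually_injective hf hi)

/-- A bound which holds near each parameter of a circle holds uniformly. -/
theorem eventually_forall_of_periodic {X : Type*} [TopologicalSpace X] {p : X} {P : X → ℝ → Prop}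
    (h : ∀ s₀ : ℝ, ∀ᶠ z : X × ℝ in 𝓝 (p, s₀), P z.1 z.2)
    (hP : ∀ q s, ∀ k : ℤ, P q s → P q (s + k)) : ∀ᶠ q in 𝓝 p, ∀ s, P q s := by
  filter_upwards [(isCompact_Icc (a := (0 : ℝ)) (b := 1)).eventually_forall_of_forall_eventually
    (fun s _ => h s)] with q hq s
  have := hP q _ ⌊s⌋ (hq (Int.fract s) ⟨Int.fract_nonneg s, (Int.fract_lt_one s).le⟩)
  rwa [Int.fract_add_floor] at this

theorem eventually_ne_of_continuousAt {X Y : Type*} [TopologicalSpace X] [TopologicalSpace Y]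
    [T2Space Y] {f g : X → Y} {x : X} (hf : ContinuousAt f x) (hg : ContinuousAt g x)
    (h : f x ≠ g x) : ∀ᶠ z in 𝓝 x, f z ≠ g z :=
  (hf.prodMk hg).eventually (isOpen_ne_fun continuous_fst continuous_snd |>.mem_nhds h)

/-! ### Local structure of the immersed curves -/

namespace Diagram.ImmersedCurves

variable {D : Diagram} (L : D.ImmersedCurves)

theorem curve_add_int (i : Fin L.card) (t : ℝ) (k : ℤ) : L.curve i (t + k) = L.curve i t := by
  have := (L.periodic i).int_mul k t
  simpa using this

theorem sameParam_symm {m : ℕ} {i j : Fin m} {s t : ℝ} (h : SameParam i s j t) :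
    SameParam j t i s := by
  obtain ⟨h, k, hk⟩ := h
  exact ⟨h.symm, -k, by push_cast; linarith⟩

theorem sameParam_trans {m : ℕ} {i j l : Fin m} {s t u : ℝ} (h : SameParam i s j t)
    (h' : SameParam j t l u) : SameParam i s l u := by
  obtain ⟨h, k, hk⟩ := h
  obtain ⟨h', k', hk'⟩ := h'
  exact ⟨h.trans h', k + k', by push_cast; linarith⟩

theorem sameParam_add_int {m : ℕ} (i : Fin m) (s : ℝ) (k : ℤ) : SameParam i (s + k) i s :=
  ⟨rfl, k, rfl⟩

/-- The parameter `(i, t)` gives a simple point of the curves. -/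
def IsSimple (i : Fin L.card) (t : ℝ) : Prop :=
  ∀ j s, L.curve j s = L.curve i t → SameParam j s i t

theorem mem_support {p : S2} : p ∈ L.support ↔ ∃ i t, L.curve i t = p := by
  simp [support]

theorem isCompact_support : IsCompact L.support := by
  have h : L.support = ⋃ i, L.curve i '' Icc 0 1 := by
    unfold support
    refine iUnion_congr fun i => Subset.antisymm ?_ (image_subset_range _ _)
    rintro _ ⟨t, rfl⟩
    refine ⟨Int.fract t, ⟨Int.fract_nonneg t, (Int.fract_lt_one t).le⟩, ?_⟩
    conv_rhs => rw [← Int.fract_add_floor t, L.curve_add_int]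
  rw [h]
  exact isCompact_iUnion fun i => isCompact_Icc.image (L.smooth i).continuous

theorem isClosed_support : IsClosed L.support := L.isCompact_support.isClosed

/-- A path in space whose radial projection crosses the curves transversely at time `0` has no
other points of the curves close to it. -/
theorem eventually_radial_notMem_support {ξ : ℝ → E3} {η : E3} {p : S2}
    (hξ : HasStrictDerivAt ξ η 0) (h0 : ξ 0 = incl p)
    (ht : ∀ i t, L.curve i t = p → det3 (incl p) (velocity (L.curve i) t) η ≠ 0) :
    ∀ᶠ τ in 𝓝[≠] (0 : ℝ), radial (ξ τ) ∉ L.support := by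
  have hne : ∀ᶠ τ in 𝓝 (0 : ℝ), ξ τ ≠ 0 := by
    apply hξ.hasDerivAt.continuousAt.eventually_ne
    rw [h0]; exact incl_ne_zero p
  suffices h : ∀ i, ∀ᶠ τ in 𝓝 (0 : ℝ), ∀ t, L.curve i t = radial (ξ τ) → τ = 0 by
    rw [eventually_nhdsWithin_iff]
    filter_upwards [eventually_all.2 h] with τ h1 h2 h3
    obtain ⟨i, t, h4⟩ := L.mem_support.1 h3
    exact h2 (h1 i t h4)
  intro i
  apply eventually_forall_of_periodic
  · intro t₀
    have hc : ContinuousAt (fun z : ℝ × ℝ => radial (ξ z.1)) (0, t₀) := by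
      have h1 : ContinuousAt radial (ξ ((0 : ℝ), t₀).1) :=
        continuousAt_radial (by show ξ 0 ≠ 0; rw [h0]; exact incl_ne_zero p)
      have h2 : ContinuousAt ξ ((0 : ℝ), t₀).1 := hξ.hasDerivAt.continuousAt
      exact ContinuousAt.comp (f := fun z : ℝ × ℝ => ξ z.1) h1
        (ContinuousAt.comp (f := Prod.fst) h2 continuousAt_fst)
    by_cases hp : L.curve i t₀ = p
    -- The extra scalar turns an equality of radial projections into a zero of `f`: if `radial (ξ
    -- τ)` is the curve point at `t`, then `f` vanishes at `(τ, t, ‖ξ τ‖)`. Transversality makes the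
    -- derivative injective, so the zero at `(0, t₀, 1)` is isolated.
    · let f : ℝ × ℝ × ℝ → E3 := fun z => ξ z.1 - z.2.2 • incl (L.curve i z.2.1)
      have hf : HasStrictFDerivAt f
          ((ContinuousLinearMap.toSpanSingleton ℝ η).comp (ContinuousLinearMap.fst ℝ ℝ (ℝ × ℝ)) -
            (((1 : ℝ) • ((ContinuousLinearMap.toSpanSingleton ℝ
                (velocity (L.curve i) t₀)).comp
              ((ContinuousLinearMap.fst ℝ ℝ ℝ).comp (ContinuousLinearMap.snd ℝ ℝ (ℝ × ℝ))))) +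
              ((ContinuousLinearMap.snd ℝ ℝ ℝ).comp
                (ContinuousLinearMap.snd ℝ ℝ (ℝ × ℝ))).smulRight (incl (L.curve i t₀))))
          (0, t₀, 1) := by
        have d1 : HasStrictFDerivAt (fun z : ℝ × ℝ × ℝ => z.1)
          (ContinuousLinearMap.fst ℝ ℝ (ℝ × ℝ)) (0, t₀, 1) := hasStrictFDerivAt_fst
        have d2 : HasStrictFDerivAt (fun z : ℝ × ℝ × ℝ => z.2)
          (ContinuousLinearMap.snd ℝ ℝ (ℝ × ℝ)) (0, t₀, 1) := hasStrictFDerivAt_snd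
        have d3 : HasStrictFDerivAt (fun z : ℝ × ℝ × ℝ => z.2.1) _ (0, t₀, 1) :=
          HasStrictFDerivAt.fst d2
        have d4 : HasStrictFDerivAt (fun z : ℝ × ℝ × ℝ => z.2.2) _ (0, t₀, 1) :=
          HasStrictFDerivAt.snd d2
        have e1 := (hξ.hasStrictFDerivAt).comp ((0 : ℝ), t₀, (1 : ℝ)) d1
        have e2 := (((L.smooth i).hasStrictDerivAt t₀).hasStrictFDerivAt).comp
          ((0 : ℝ), t₀, (1 : ℝ)) d3
        exact e1.sub (d4.smul e2)
      have hi := HasStrictFDerivAt.eventually_ne hf (by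
        rintro ⟨α, β, ρ⟩ h
        have h' : (-ρ) • incl p + (-β) • velocity (L.curve i) t₀ + α • η = 0 := by
          rw [← h]
          simp [hp]
          abel
        obtain ⟨h1, h2, h3⟩ := det3_linearIndependent (ht i t₀ hp) h'
        simp at h1 h2
        simp [h1, h2, h3])
      have hT : Tendsto (fun z : ℝ × ℝ => (z.1, z.2, ‖ξ z.1‖)) (𝓝 (0, t₀)) (𝓝 (0, t₀, 1)) := by
        have : ContinuousAt (fun z : ℝ × ℝ => ‖ξ z.1‖) (0, t₀) :=
          (ContinuousAt.comp (f := Prod.fst) (g := ξ) hξ.hasDerivAt.continuousAt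
            continuousAt_fst).norm
        have h1 := (continuousAt_fst (p := ((0 : ℝ), t₀))).prodMk
          ((continuousAt_snd (p := ((0 : ℝ), t₀))).prodMk this)
        have h2 : ‖ξ 0‖ = 1 := by rw [h0, norm_incl]
        simpa [ContinuousAt, h2] using h1
      filter_upwards [hT.eventually hi, (continuousAt_fst (p := ((0 : ℝ), t₀))).eventually hne]
        with z hz hz' he
      have h1 : f (z.1, z.2, ‖ξ z.1‖) = f (0, t₀, 1) := by
        simp only [f, h0, hp, one_smul, sub_self]
        rw [he, smul_incl_radial hz', sub_self]
      exact congrArg Prod.fst (hz h1)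
    · have hc' : ContinuousAt (fun z : ℝ × ℝ => L.curve i z.2) (0, t₀) :=
        ((L.smooth i).continuous.comp continuous_snd).continuousAt
      have hne' : L.curve i ((0 : ℝ), t₀).2 ≠ radial (ξ ((0 : ℝ), t₀).1) := by
        simpa [h0, radial_incl] using hp
      filter_upwards [eventually_ne_of_continuousAt hc' hc hne'] with z hz he
      exact absurd he hz
  · intro τ s k h
    rwa [L.curve_add_int]

/-- Each curve is locally injective. -/
theorem curve_eventually_injective (i : Fin L.card) (t : ℝ) :
    ∀ᶠ z : ℝ × ℝ in 𝓝 (t, t), L.curve i z.1 = L.curve i z.2 → z.1 = z.2 := by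
  have h := HasStrictFDerivAt.eventually_injective
    ((L.smooth i).hasStrictDerivAt t).hasStrictFDerivAt (by
      intro v hv
      simpa [L.immersed i t] using hv)
  filter_upwards [h] with z hz he
  exact hz (by rw [he])

/-- The multiple points of the curves are isolated. -/
theorem eventually_isSimple (p : S2) :
    ∀ᶠ q in 𝓝[≠] p, ∀ i t, L.curve i t = q → L.IsSimple i t := by
  suffices h : ∀ i j, ∀ᶠ q in 𝓝 p, ∀ s t : ℝ, L.curve i s = q → L.curve j t = q →
      q = p ∨ SameParam j t i s by
    rw [eventually_nhdsWithin_iff]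
    filter_upwards [eventually_all.2 fun i => eventually_all.2 (h i)] with q hq hp i t hi j s hj
    exact (hq i j t s hi (hj.trans hi)).resolve_left hp
  intro i j
  apply eventually_forall_of_periodic (P := fun q s => ∀ t : ℝ, L.curve i s = q →
    L.curve j t = q → q = p ∨ SameParam j t i s)
  · intro s₀
    apply eventually_forall_of_periodic (P := fun (z : S2 × ℝ) t => L.curve i z.2 = z.1 →
      L.curve j t = z.1 → z.1 = p ∨ SameParam j t i z.2)
    · intro t₀
      have c1 : Continuous (fun z : (S2 × ℝ) × ℝ => z.1.1) := by fun_prop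
      have c2 : Continuous (fun z : (S2 × ℝ) × ℝ => L.curve i z.1.2) :=
        (L.smooth i).continuous.comp (by fun_prop)
      have c3 : Continuous (fun z : (S2 × ℝ) × ℝ => L.curve j z.2) :=
        (L.smooth j).continuous.comp (by fun_prop)
      by_cases hi : L.curve i s₀ = p
      swap
      · filter_upwards [eventually_ne_of_continuousAt c2.continuousAt c1.continuousAt
          (x := ((p, s₀), t₀)) hi] with z h1 h2
        exact absurd h2 h1
      by_cases hj : L.curve j t₀ = p
      swap
      · filter_upwards [eventually_ne_of_continuousAt c3.continuousAt c1.continuousAt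
          (x := ((p, s₀), t₀)) hj] with z h1 _ h2
        exact absurd h2 h1
      by_cases hs : SameParam i s₀ j t₀
      -- Both parameters describe the same branch up to an integer shift, so local injectivity
      -- forces equality of the shifted parameters.
      · obtain ⟨rfl, k, hk⟩ := hs
        have hT : Tendsto (fun z : (S2 × ℝ) × ℝ => (z.1.2, z.2 + k)) (𝓝 ((p, s₀), t₀))
            (𝓝 (s₀, s₀)) := by
          have : Continuous (fun z : (S2 × ℝ) × ℝ => (z.1.2, z.2 + k)) := by fun_prop
          convert this.tendsto ((p, s₀), t₀) using 2
          rw [hk]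
        filter_upwards [hT.eventually (L.curve_eventually_injective i s₀)] with z hz h1 h2
        have h3 : z.1.2 = z.2 + k := hz (by rw [h1, L.curve_add_int, h2])
        right
        rw [h3]
        exact sameParam_symm (sameParam_add_int i z.2 k)
      -- Two distinct branches through `p`: their velocities are independent, so the difference of
      -- the branches has an isolated zero and they meet only at `p` nearby.
      · let f : ℝ × ℝ → E3 := fun z => incl (L.curve i z.1) - incl (L.curve j z.2)
        have hf : HasStrictFDerivAt f
            ((ContinuousLinearMap.toSpanSingleton ℝ (velocity (L.curve i) s₀)).comp
              (ContinuousLinearMap.fst ℝ ℝ ℝ) -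
            (ContinuousLinearMap.toSpanSingleton ℝ (velocity (L.curve j) t₀)).comp
              (ContinuousLinearMap.snd ℝ ℝ ℝ)) (s₀, t₀) := by
          have d1 : HasStrictFDerivAt (fun z : ℝ × ℝ => z.1) (ContinuousLinearMap.fst ℝ ℝ ℝ)
            (s₀, t₀) := hasStrictFDerivAt_fst
          have d2 : HasStrictFDerivAt (fun z : ℝ × ℝ => z.2) (ContinuousLinearMap.snd ℝ ℝ ℝ)
            (s₀, t₀) := hasStrictFDerivAt_snd
          have e1 := (((L.smooth i).hasStrictDerivAt s₀).hasStrictFDerivAt).comp (s₀, t₀) d1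
          have e2 := (((L.smooth j).hasStrictDerivAt t₀).hasStrictFDerivAt).comp (s₀, t₀) d2
          exact e1.sub e2
        have hli := L.self_transverse i s₀ j t₀ hs (hi.trans hj.symm)
        rw [LinearIndependent.pair_iff] at hli
        have hinj := HasStrictFDerivAt.eventually_ne hf (by
          rintro ⟨α, β⟩ h
          have h' : α • velocity (L.curve i) s₀ + (-β) • velocity (L.curve j) t₀ = 0 := by
            rw [← h]; simp; abel
          obtain ⟨h1, h2⟩ := hli _ _ h'
          simp at h2
          simp [h1, h2])
        have hT : Tendsto (fun z : (S2 × ℝ) × ℝ => (z.1.2, z.2)) (𝓝 ((p, s₀), t₀))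
            (𝓝 (s₀, t₀)) := by
          have : Continuous (fun z : (S2 × ℝ) × ℝ => (z.1.2, z.2)) := by fun_prop
          exact this.tendsto ((p, s₀), t₀)
        filter_upwards [hT.eventually hinj] with z hz h1 h2
        left
        have h3 : z.1.2 = s₀ := congrArg Prod.fst (hz (by simp [f, h1, h2, hi, hj]))
        rw [← h1, h3, hi]
    · intro z t k h h1 h2
      rw [L.curve_add_int] at h2
      rcases h h1 h2 with h3 | h3
      · exact Or.inl h3
      · exact Or.inr (sameParam_trans (sameParam_add_int j t k) h3)
  · intro q s k h t h1 h2
    rw [L.curve_add_int] at h1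
    rcases h t h1 h2 with h3 | h3
    · exact Or.inl h3
    · exact Or.inr (sameParam_trans h3 (sameParam_symm (sameParam_add_int i s k)))

/-- Close to a simple point, the curves are a single embedded arc. -/
theorem eventually_mem_arc {i : Fin L.card} {t : ℝ} (h : L.IsSimple i t) {ε : ℝ} (hε : 0 < ε) :
    ∀ᶠ q in 𝓝 (L.curve i t), q ∈ L.support → ∃ s, |s - t| < ε ∧ L.curve i s = q := by
  suffices h' : ∀ j, ∀ᶠ q in 𝓝 (L.curve i t), ∀ s, L.curve j s = q →
      ∃ s, |s - t| < ε ∧ L.curve i s = q by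
    filter_upwards [eventually_all.2 h'] with q h1 h2
    obtain ⟨j, s, h3⟩ := L.mem_support.1 h2
    exact h1 j s h3
  intro j
  apply eventually_forall_of_periodic (P := fun q s => L.curve j s = q →
      ∃ s, |s - t| < ε ∧ L.curve i s = q)
  · intro s₀
    by_cases hj : L.curve j s₀ = L.curve i t
    · obtain ⟨rfl, k, hk⟩ := h j s₀ hj
      have c : Continuous (fun z : S2 × ℝ => |z.2 - k - t|) := by fun_prop
      have h0 : (fun z : S2 × ℝ => |z.2 - k - t|) (L.curve j t, s₀) < ε := by simpa [hk] using hε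
      filter_upwards [c.continuousAt.eventually (gt_mem_nhds h0)] with z h1 h2
      refine ⟨z.2 - k, h1, ?_⟩
      rw [← h2, ← L.curve_add_int j (z.2 - k) k, sub_add_cancel]
    · have c1 : Continuous (fun z : S2 × ℝ => z.1) := by fun_prop
      have c2 : Continuous (fun z : S2 × ℝ => L.curve j z.2) :=
        (L.smooth j).continuous.comp (by fun_prop)
      filter_upwards [eventually_ne_of_continuousAt c2.continuousAt c1.continuousAt
        (x := (L.curve i t, s₀)) hj] with z h1 h2
      exact absurd h2 h1
  · intro q s k h1 h2
    rw [L.curve_add_int] at h2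
    exact h1 h2

end Diagram.ImmersedCurves

/-! ### Connectedness and locally constant functions -/

theorem IsPreconnected.eq_of_eventually_eq {X β : Type*} [TopologicalSpace X] {s : Set X}
    (hs : IsPreconnected s) {f : X → β} (hf : ∀ x ∈ s, ∀ᶠ y in 𝓝 x, f y = f x) {x y : X}
    (hx : x ∈ s) (hy : y ∈ s) : f x = f y := by
  -- For the discrete topology on `β`, locally constant means continuous.
  let _ : TopologicalSpace β := ⊥
  have _ : DiscreteTopology β := ⟨rfl⟩
  refine hs.constant (f := f) (fun z hz => ContinuousAt.continuousWithinAt ?_) hx hy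
  exact Tendsto.congr' ((hf z hz).mono fun _ h => h.symm) tendsto_const_nhds

/-- Punctured neighbourhoods on the sphere are connected. -/
theorem exists_isPreconnected_punctured {p : S2} {W : Set S2} (hW : W ∈ 𝓝 p) :
    ∃ V ∈ 𝓝[≠] p, V ⊆ W ∧ p ∉ V ∧ IsPreconnected V ∧ IsOpen V ∧ p ∈ closure V := by
  let φ := chartAt (EuclideanSpace ℝ (Fin 2)) p
  have h1 : φ.target ∩ φ.symm ⁻¹' W ∈ 𝓝 (φ p) := by
    apply inter_mem (φ.open_target.mem_nhds (φ.map_source (mem_chart_source _ p)))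
    apply (φ.continuousAt_symm (φ.map_source (mem_chart_source _ p))).preimage_mem_nhds
    rwa [φ.left_inv (mem_chart_source _ p)]
  obtain ⟨r, hr, hball⟩ := Metric.mem_nhds_iff.1 h1
  let B : Set (EuclideanSpace ℝ (Fin 2)) := Metric.ball (φ p) r \ {φ p}
  have hB : IsPreconnected B := by
    have hB' : B = (fun z : ℝ × EuclideanSpace ℝ (Fin 2) => φ p + z.1 • z.2) ''
        (Ioo 0 r ×ˢ Metric.sphere 0 1) := by
      ext y
      constructor
      · rintro ⟨hy1, hy2⟩
        have hne : y - φ p ≠ 0 := sub_ne_zero.2 hy2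
        have hn : ‖y - φ p‖ ≠ 0 := norm_ne_zero_iff.2 hne
        refine ⟨(‖y - φ p‖, ‖y - φ p‖⁻¹ • (y - φ p)), ⟨⟨norm_pos_iff.2 hne, ?_⟩, ?_⟩, ?_⟩
        · simpa [dist_eq_norm] using hy1
        · simp [norm_smul, hn]
        · simp [smul_smul, hn]
      · rintro ⟨⟨t, z⟩, ⟨⟨ht1, ht2⟩, hz⟩, rfl⟩
        have hz' : ‖z‖ = 1 := by simpa using hz
        have hz0 : z ≠ 0 := fun h => by simp [h] at hz'
        refine ⟨?_, ?_⟩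
        · simp [dist_eq_norm, norm_smul, hz', abs_of_pos ht1, ht2]
        · simp [ht1.ne', hz0]
    rw [hB']
    apply IsPreconnected.image
    · apply IsPreconnected.prod isPreconnected_Ioo
      apply isPreconnected_sphere
      rw [← Module.finrank_eq_rank]
      simp
    · fun_prop
  have hBt : B ⊆ φ.target := fun y hy => (hball hy.1).1
  have hBo : IsOpen B := Metric.isOpen_ball.sdiff isClosed_singleton
  have hps := mem_chart_source (EuclideanSpace ℝ (Fin 2)) p
  refine ⟨φ.symm '' B, ?_, ?_, ?_, ?_, ?_, ?_⟩
  · have h2 : φ.source ∩ φ ⁻¹' (Metric.ball (φ p) r) ∈ 𝓝 p :=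
      inter_mem (φ.open_source.mem_nhds hps)
        ((φ.continuousAt hps).preimage_mem_nhds (Metric.ball_mem_nhds _ hr))
    rw [mem_nhdsWithin_iff_exists_mem_nhds_inter]
    refine ⟨_, h2, ?_⟩
    rintro q ⟨⟨hq1, hq2⟩, hq3⟩
    exact ⟨φ q, ⟨hq2, fun h => hq3 (φ.injOn hq1 hps h)⟩, φ.left_inv hq1⟩
  · rintro _ ⟨y, hy, rfl⟩
    exact (hball hy.1).2
  · rintro ⟨y, hy, h⟩
    apply hy.2
    rw [mem_singleton_iff, ← h, φ.right_inv (hBt hy)]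
  · exact hB.image _ (φ.continuousOn_symm.mono hBt)
  · exact φ.symm.isOpen_image_of_subset_source hBo hBt
  · have h3 : φ p ∈ closure B := by
      have : Metric.ball (φ p) r \ {φ p} = Metric.ball (φ p) r ∩ {φ p}ᶜ := rfl
      simp only [B, this]
      rw [mem_closure_iff_nhdsWithin_neBot, inter_comm,
        nhdsWithin_inter_of_mem' (mem_nhdsWithin_of_mem_nhds (Metric.ball_mem_nhds _ hr))]
      infer_instance
    have h4 : ContinuousWithinAt φ.symm B (φ p) :=
      (φ.continuousAt_symm (φ.map_source hps)).continuousWithinAt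
    have := h4.mem_closure_image h3
    rwa [φ.left_inv hps] at this

/-! ### The two sides of a curve, and extension across the curves -/

namespace Diagram.ImmersedCurves

variable {D : Diagram} (L : D.ImmersedCurves)

/-- Close to a simple point, the curves have two sides, and there is a path which crosses from the
one to the other in the normal direction. -/
theorem exists_sides {i : Fin L.card} {t : ℝ} (h : L.IsSimple i t) {W : Set S2}
    (hW : W ∈ 𝓝 (L.curve i t)) :
    ∃ (V₁ V₂ : Set S2) (δ : ℝ → S2), IsPreconnected V₁ ∧ IsPreconnected V₂ ∧
      V₁ ⊆ W \ L.support ∧ V₂ ⊆ W \ L.support ∧ SmoothPath δ ∧ δ 0 = L.curve i t ∧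
      PosPair (δ 0) (velocity (L.curve i) t) (velocity δ 0) ∧
      (∀ᶠ s in 𝓝[<] (0 : ℝ), δ s ∈ V₁) ∧ (∀ᶠ s in 𝓝[>] (0 : ℝ), δ s ∈ V₂) ∧
      ∀ᶠ q in 𝓝 (L.curve i t), q ∉ L.support → q ∈ V₁ ∪ V₂ := by
  set p := L.curve i t with hp
  set x := incl p with hx
  set v := velocity (L.curve i) t with hv
  set n := cross x v with hn
  have hxv : inner ℝ x v = 0 := (L.smooth i).inner_velocity t
  have hxn : inner ℝ x n = 0 := inner_cross_left x v
  have hv0 : v ≠ 0 := L.immersed i t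
  have hdet : 0 < det3 x v n := by
    rw [hn, det3_cross, inner_incl_self, hxv, one_mul]
    have := real_inner_self_pos.2 hv0
    simpa using this
  -- Conical tubular coordinates: position along the curve, displacement along the fixed vector `n`,
  -- and radial scale. Since `x`, `v`, `n` form a basis, `f` is a local homeomorphism at `(t, 0,
  -- 1)`.
  let f : ℝ × ℝ × ℝ → E3 := fun z => z.2.2 • (incl (L.curve i z.1) + z.2.1 • n)
  have hf : HasStrictFDerivAt f
      ((1 : ℝ) • ((ContinuousLinearMap.toSpanSingleton ℝ v).comp
          (ContinuousLinearMap.fst ℝ ℝ (ℝ × ℝ)) +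
        ((ContinuousLinearMap.fst ℝ ℝ ℝ).comp
                (ContinuousLinearMap.snd ℝ ℝ (ℝ × ℝ))).smulRight n) +
      ((ContinuousLinearMap.snd ℝ ℝ ℝ).comp
                (ContinuousLinearMap.snd ℝ ℝ (ℝ × ℝ))).smulRight (x + (0 : ℝ) • n))
      (t, 0, 1) := by
    have d1 : HasStrictFDerivAt (fun z : ℝ × ℝ × ℝ => z.1)
      (ContinuousLinearMap.fst ℝ ℝ (ℝ × ℝ)) (t, 0, 1) := hasStrictFDerivAt_fst
    have d2 : HasStrictFDerivAt (fun z : ℝ × ℝ × ℝ => z.2)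
      (ContinuousLinearMap.snd ℝ ℝ (ℝ × ℝ)) (t, 0, 1) := hasStrictFDerivAt_snd
    have d3 : HasStrictFDerivAt (fun z : ℝ × ℝ × ℝ => z.2.1) _ (t, 0, 1) :=
      HasStrictFDerivAt.fst d2
    have d4 : HasStrictFDerivAt (fun z : ℝ × ℝ × ℝ => z.2.2) _ (t, 0, 1) :=
      HasStrictFDerivAt.snd d2
    have e2 := (((L.smooth i).hasStrictDerivAt t).hasStrictFDerivAt).comp
      (t, (0 : ℝ), (1 : ℝ)) d1
    exact d4.smul (e2.add (d3.smul_const n))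
  generalize hf' : ((1 : ℝ) • ((ContinuousLinearMap.toSpanSingleton ℝ v).comp
          (ContinuousLinearMap.fst ℝ ℝ (ℝ × ℝ)) +
        ((ContinuousLinearMap.fst ℝ ℝ ℝ).comp
                (ContinuousLinearMap.snd ℝ ℝ (ℝ × ℝ))).smulRight n) +
      ((ContinuousLinearMap.snd ℝ ℝ ℝ).comp
                (ContinuousLinearMap.snd ℝ ℝ (ℝ × ℝ))).smulRight (x + (0 : ℝ) • n)) = f' at hf
  have hker : ∀ z, f' z = 0 → z = 0 := by
    rintro ⟨α, β, ρ⟩ h0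
    have h' : ρ • x + α • v + β • n = 0 := by
      rw [← h0, ← hf']
      simp
      abel
    obtain ⟨h1, h2, h3⟩ := det3_linearIndependent hdet.ne' h'
    simp [h1, h2, h3]
  have hsurj : f'.range = ⊤ := by
    rw [LinearMap.range_eq_top]
    have hfr : Module.finrank ℝ (ℝ × ℝ × ℝ) = Module.finrank ℝ E3 := by simp
    exact (LinearMap.injective_iff_surjective_of_finrank_eq_finrank hfr).1
      (LinearMap.ker_eq_bot.1 (LinearMap.ker_eq_bot'.2 hker))
  have hmap := hf.map_nhds_eq_of_surj hsurj
  have hinj := HasStrictFDerivAt.eventually_injective hf hker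
  have hf0 : f (t, 0, 1) = x := by simp [f, hx, hp]
  -- a box on which everything takes place
  obtain ⟨ε, hε, hinjε⟩ : ∃ ε > 0, ∀ a b : ℝ × ℝ × ℝ, dist a (t, 0, 1) < ε →
      dist b (t, 0, 1) < ε → f a = f b → a = b := by
    obtain ⟨ε, hε, hεP⟩ := Metric.eventually_nhds_iff.1 hinj
    exact ⟨ε, hε, fun a b ha hb => hεP (y := (a, b)) (max_lt ha hb)⟩
  let Θ : ℝ × ℝ → S2 := fun z => radial (incl (L.curve i z.1) + z.2 • n)
  have hc1 : Continuous (fun z : ℝ × ℝ => incl (L.curve i z.1) + z.2 • n) := by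
    have := continuous_incl.comp ((L.smooth i).continuous.comp (continuous_fst (X := ℝ) (Y := ℝ)))
    exact this.add (continuous_snd.smul continuous_const)
  have hΘ0 : ∀ s, Θ (s, 0) = L.curve i s := fun s => by simp [Θ, radial_incl]
  have hx0 : incl (L.curve i (t, (0 : ℝ)).1) + (t, (0 : ℝ)).2 • n ≠ 0 := by
    simpa using incl_ne_zero (L.curve i t)
  have hΘc : ContinuousAt Θ (t, 0) :=
    ContinuousAt.comp (f := fun z : ℝ × ℝ => incl (L.curve i z.1) + z.2 • n)
      (continuousAt_radial hx0) hc1.continuousAt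
  have hev : ∀ᶠ z : ℝ × ℝ in 𝓝 (t, 0), incl (L.curve i z.1) + z.2 • n ≠ 0 ∧ Θ z ∈ W ∧
      (Θ z ∈ L.support → ∃ s, |s - t| < ε ∧ L.curve i s = Θ z) ∧
      |‖incl (L.curve i z.1) + z.2 • n‖ - 1| < ε := by
    have hΘp : Θ (t, 0) = p := hΘ0 t
    refine (hc1.continuousAt.eventually_ne hx0).and (Eventually.and ?_ (Eventually.and ?_ ?_))
    · exact hΘc.preimage_mem_nhds (by rw [hΘp]; exact hW)
    · have := L.eventually_mem_arc h hε
      rw [← hp, ← hΘp] at this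
      exact hΘc.eventually this
    · have c : Continuous (fun z : ℝ × ℝ => |‖incl (L.curve i z.1) + z.2 • n‖ - 1|) :=
        (hc1.norm.sub continuous_const).abs
      apply c.continuousAt.eventually (gt_mem_nhds _)
      simpa [norm_incl] using hε
  obtain ⟨η, hη, hηP⟩ := Metric.eventually_nhds_iff.1 hev
  obtain ⟨r, hr, hrη, hrε, hr1⟩ : ∃ r > 0, r ≤ η ∧ r ≤ ε ∧ r ≤ 1 :=
    ⟨min η (min ε 1), by positivity, min_le_left _ _, (min_le_right _ _).trans (min_le_left _ _),
      (min_le_right _ _).trans (min_le_right _ _)⟩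
  have hbox : ∀ s u, |s - t| < r → |u| < r → dist ((s, u) : ℝ × ℝ) (t, 0) < η := by
    intro s u hs hu
    rw [Prod.dist_eq, max_lt_iff, Real.dist_eq, Real.dist_eq, sub_zero]
    exact ⟨hs.trans_le hrη, hu.trans_le hrη⟩
  -- By simplicity, a point of the curves in the box lies on the central arc `u = 0`; injectivity of
  -- `f`, with the norm as scale coordinate, then excludes a second description with `u ≠ 0`.
  have hoff : ∀ s u, |s - t| < r → |u| < r → u ≠ 0 → Θ (s, u) ∉ L.support := by
    intro s u hs hu hu0 hmem
    obtain ⟨h1, -, h2, h3⟩ := hηP (hbox s u hs hu)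
    obtain ⟨s', hs', he⟩ := h2 hmem
    have h4 : f (s, u, 1) = f (s', 0, ‖incl (L.curve i s) + u • n‖) := by
      simp only [f, one_smul, zero_smul, add_zero]
      rw [he, smul_incl_radial h1]
    have h5 := hinjε (s, u, 1) (s', 0, ‖incl (L.curve i s) + u • n‖) (by
      simp only [Prod.dist_eq, Real.dist_eq, sub_zero, sub_self, abs_zero, max_lt_iff]
      exact ⟨hs.trans_le hrε, hu.trans_le hrε, hε⟩) (by
      simp only [Prod.dist_eq, Real.dist_eq, sub_self, abs_zero, max_lt_iff]
      exact ⟨hs', hε, h3⟩) h4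
    simp only [Prod.mk.injEq] at h5
    exact hu0 h5.2.1
  have hpre : ∀ I : Set ℝ, (∀ u ∈ I, |u| < r) → IsPreconnected I →
      IsPreconnected (Θ '' ({s | |s - t| < r} ×ˢ I)) := by
    intro I hI hIc
    apply IsPreconnected.image
    · apply IsPreconnected.prod _ hIc
      have : {s | |s - t| < r} = Metric.ball t r := by ext s; simp [Real.dist_eq]
      rw [this]
      exact (convex_ball t r).isPreconnected
    · rintro ⟨s, u⟩ ⟨hs, hu⟩
      apply ContinuousAt.continuousWithinAt
      exact ContinuousAt.comp (f := fun z : ℝ × ℝ => incl (L.curve i z.1) + z.2 • n)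
        (continuousAt_radial (hηP (hbox s u hs (hI u hu))).1) hc1.continuousAt
  have hI1 : ∀ u ∈ Ioo (-r) 0, |u| < r := fun u hu => abs_lt.2 ⟨hu.1, hu.2.trans hr⟩
  have hI2 : ∀ u ∈ Ioo 0 r, |u| < r := fun u hu => abs_lt.2 ⟨by linarith [hu.1], hu.2⟩
  have hnz : ∀ u : ℝ, x + u • n ≠ 0 := by
    intro u h0
    have : inner ℝ x (x + u • n) = 1 := by
      rw [inner_add_right, inner_smul_right, hxn, inner_incl_self]; ring
    rw [h0, inner_zero_right] at this
    exact zero_ne_one this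
  have hδ : SmoothPath (fun u => radial (x + u • n)) := by
    apply SmoothPath.radial _ hnz
    exact contDiff_const.add (contDiff_id.smul contDiff_const)
  refine ⟨Θ '' ({s | |s - t| < r} ×ˢ Ioo (-r) 0), Θ '' ({s | |s - t| < r} ×ˢ Ioo 0 r),
    fun u => radial (x + u • n), hpre _ hI1 isPreconnected_Ioo, hpre _ hI2 isPreconnected_Ioo,
    ?_, ?_, hδ, ?_, ?_, ?_, ?_, ?_⟩
  · rintro _ ⟨⟨s, u⟩, ⟨hs, hu⟩, rfl⟩
    exact ⟨(hηP (hbox s u hs (hI1 u hu))).2.1, hoff s u hs (hI1 u hu) hu.2.ne⟩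
  · rintro _ ⟨⟨s, u⟩, ⟨hs, hu⟩, rfl⟩
    exact ⟨(hηP (hbox s u hs (hI2 u hu))).2.1, hoff s u hs (hI2 u hu) hu.1.ne'⟩
  · simp [hx, radial_incl]
  -- The normalizing factor is stationary at `u = 0` because `n` is orthogonal to `x`, so radial
  -- projection does not change the velocity there.
  · have h1 : velocity (fun u => radial (x + u • n)) 0 = n := by
      have h2 : HasDerivAt (fun u : ℝ => ‖x + u • n‖⁻¹ • (x + u • n)) n 0 := by
        have d1 : HasDerivAt (fun u : ℝ => x + u • n) n 0 := by
          simpa using ((hasDerivAt_id (0 : ℝ)).smul_const n).const_add x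
        have d2 : HasDerivAt (fun u : ℝ => ‖x + u • n‖ ^ 2) 0 0 := by
          have := d1.norm_sq
          simpa [hxn] using this
        have d3 : HasDerivAt (fun u : ℝ => ‖x + u • n‖⁻¹) 0 0 := by
          have h3 : ∀ u : ℝ, ‖x + u • n‖⁻¹ = (Real.sqrt (‖x + u • n‖ ^ 2))⁻¹ := fun u => by
            rw [Real.sqrt_sq (norm_nonneg _)]
          simp only [h3]
          have d4 := (d2.sqrt (by simp [hx, norm_incl])).inv
            (by simp [hx, norm_incl])
          rw [zero_div, neg_zero, zero_div] at d4
          exact d4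
        have d5 := d3.smul d1
        rw [zero_smul, zero_smul, add_zero, add_zero, hx, norm_incl, inv_one, one_smul] at d5
        exact d5
      have h3 : (fun u : ℝ => incl (radial (x + u • n))) =
          fun u : ℝ => ‖x + u • n‖⁻¹ • (x + u • n) := by
        ext1 u; rw [incl_radial (hnz u)]
      unfold velocity
      rw [h3]
      exact h2.deriv
    unfold PosPair
    rw [h1]
    simpa [hx, radial_incl] using hdet
  · filter_upwards [Ioo_mem_nhdsLT (neg_lt_zero.2 hr)] with u hu
    exact ⟨(t, u), ⟨by simpa using hr, hu⟩, rfl⟩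
  · filter_upwards [Ioo_mem_nhdsGT hr] with u hu
    exact ⟨(t, u), ⟨by simpa using hr, hu⟩, rfl⟩
  -- The coordinate map is open at `(t, 0, 1)`, so the radial image of a small box is a
  -- neighbourhood; the sign of `u` decides the side.
  · have h1 : f '' (Metric.ball (t, 0, 1) r) ∈ 𝓝 x := by
      rw [← hf0, ← hmap]
      exact image_mem_map (Metric.ball_mem_nhds _ hr)
    have h2 : radial '' (f '' (Metric.ball (t, 0, 1) r)) ∈ 𝓝 p := by
      rw [← map_radial_nhds p]
      exact image_mem_map h1
    filter_upwards [h2] with q hq hqC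
    obtain ⟨_, ⟨⟨s, u, ρ⟩, hz, rfl⟩, rfl⟩ := hq
    simp only [Metric.mem_ball, Prod.dist_eq, Real.dist_eq, sub_zero, max_lt_iff] at hz
    obtain ⟨hs, hu, hρ⟩ := hz
    have hρ0 : 0 < ρ := by have := (abs_lt.1 hρ).1; linarith
    have h3 : radial (f (s, u, ρ)) = Θ (s, u) := by
      simp only [f, Θ]; exact radial_smul hρ0 _
    rw [h3] at hqC ⊢
    rcases lt_trichotomy u 0 with h4 | h4 | h4
    · exact Or.inl ⟨(s, u), ⟨hs, (abs_lt.1 hu).1, h4⟩, rfl⟩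
    · exfalso
      apply hqC
      rw [h4, hΘ0]
      exact L.mem_support.2 ⟨i, s, rfl⟩
    · exact Or.inr ⟨(s, u), ⟨hs, h4, (abs_lt.1 hu).2⟩, rfl⟩

/-- A simple point is a limit of the path crossing there. Around an arbitrary `p`, all other nearby
points are simple or off the curves, so `p` is a limit of points already treated. -/
theorem mem_closure_compl_support (p : S2) : p ∈ closure L.supportᶜ := by
  have simple : ∀ i t, L.IsSimple i t → L.curve i t ∈ closure L.supportᶜ := by
    intro i t h
    obtain ⟨V₁, V₂, δ, -, -, -, hV, hδ, h0, -, -, h2, -⟩ := L.exists_sides h univ_mem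
    rw [← h0]
    have h3 : Tendsto δ (𝓝[>] 0) (𝓝 (δ 0)) :=
      hδ.continuous.continuousAt.tendsto.mono_left nhdsWithin_le_nhds
    exact mem_closure_of_tendsto h3 (h2.mono fun s hs => (hV hs).2)
  obtain ⟨V, -, hVW, hpV, -, -, hcl⟩ := exists_isPreconnected_punctured
    (eventually_nhdsWithin_iff.1 (L.eventually_isSimple p))
  have : V ⊆ closure L.supportᶜ := by
    intro q hq
    by_cases hqC : q ∈ L.support
    · obtain ⟨i, t, rfl⟩ := L.mem_support.1 hqC
      exact simple i t (hVW hq (fun h => hpV (h ▸ hq)) i t rfl)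
    · exact subset_closure hqC
  exact closure_minimal this isClosed_closure hcl

theorem eventually_eq_unique {β : Type*} {f : S2 → β} {p : S2} {a b : β}
    (ha : ∀ᶠ q in 𝓝 p, q ∉ L.support → f q = a) (hb : ∀ᶠ q in 𝓝 p, q ∉ L.support → f q = b) :
    a = b := by
  obtain ⟨q, hq, hq'⟩ := mem_closure_iff_nhds.1 (L.mem_closure_compl_support p) _ (ha.and hb)
  exact (hq.1 hq').symm.trans (hq.2 hq')

/-- A locally constant function off the curves which does not change along paths crossing the
curves in simple points extends to a locally constant function. -/
theorem exists_extension {β : Type*} {U : Set S2} (hU : IsOpen U) (f : S2 → β)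
    (hf : ∀ p ∈ U, p ∉ L.support → ∀ᶠ q in 𝓝 p, f q = f p)
    (hcross : ∀ i t (δ : ℝ → S2) (V₁ V₂ : Set S2), L.IsSimple i t → SmoothPath δ →
      δ 0 = L.curve i t → δ 0 ∈ U → PosPair (δ 0) (velocity (L.curve i) t) (velocity δ 0) →
      IsPreconnected V₁ → IsPreconnected V₂ → V₁ ⊆ U \ L.support → V₂ ⊆ U \ L.support →
      (∀ᶠ s in 𝓝[<] (0 : ℝ), δ s ∈ V₁) → (∀ᶠ s in 𝓝[>] (0 : ℝ), δ s ∈ V₂) →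
      ∀ q₁ ∈ V₁, ∀ q₂ ∈ V₂, f q₁ = f q₂) :
    ∃ g : S2 → β, (∀ p ∈ U, ∀ᶠ q in 𝓝 p, g q = g p) ∧ ∀ p ∈ U, p ∉ L.support → g p = f p := by
  -- At a simple point `f` is constant on each of the two sides, and the crossing hypothesis
  -- identifies the two values.
  have hsimple : ∀ p ∈ U, (∀ i t, L.curve i t = p → L.IsSimple i t) →
      ∃ b, ∀ᶠ q in 𝓝 p, q ∉ L.support → f q = b := by
    intro p hp hs
    by_cases hpC : p ∈ L.support
    · obtain ⟨i, t, rfl⟩ := L.mem_support.1 hpC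
      obtain ⟨V₁, V₂, δ, c1, c2, s1, s2, hδ, h0, hpos, e1, e2, hcov⟩ :=
        L.exists_sides (hs i t rfl) (hU.mem_nhds hp)
      obtain ⟨s₁, hs₁⟩ := e1.exists
      have hall := hcross i t δ V₁ V₂ (hs i t rfl) hδ h0 (by rwa [h0]) hpos c1 c2 s1 s2 e1 e2
      refine ⟨f (δ s₁), ?_⟩
      filter_upwards [hcov] with q hq hqC
      rcases hq hqC with h | h
      · exact IsPreconnected.eq_of_eventually_eq c1 (fun z hz => hf z (s1 hz).1 (s1 hz).2) h hs₁
      · exact (hall _ hs₁ _ h).symm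
    · exact ⟨f p, (hf p hp hpC).mono fun q hq _ => hq⟩
  have hloc : ∀ p, ∀ b, (∀ᶠ q in 𝓝 p, q ∉ L.support → f q = b) →
      ∀ᶠ p' in 𝓝 p, ∀ᶠ q in 𝓝 p', q ∉ L.support → f q = b := fun p b h =>
    eventually_eventually_nhds.2 h
  have hall : ∀ p ∈ U, ∃ b, ∀ᶠ q in 𝓝 p, q ∉ L.support → f q = b := by
    intro p hp
    obtain ⟨V, hV, hVW, hpV, hVc, hVo, hcl⟩ := exists_isPreconnected_punctured
      (inter_mem (hU.mem_nhds hp) (eventually_nhdsWithin_iff.1 (L.eventually_isSimple p)))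
    have hb : ∀ q ∈ V, ∃ b, ∀ᶠ q' in 𝓝 q, q' ∉ L.support → f q' = b := fun q hq =>
      hsimple q (hVW hq).1 ((hVW hq).2 fun h => hpV (h ▸ hq))
    obtain ⟨q₀, hq₀⟩ : V.Nonempty := closure_nonempty_iff.1 ⟨p, hcl⟩
    obtain ⟨b₀, hb₀⟩ := hb q₀ hq₀
    -- `k q` records which values `f` can take near `q` off the curves. By density there is at most
    -- one, so `k` is locally constant on the connected punctured neighbourhood `V`; this carries
    -- `b₀` across to the possibly multiple point `p`.
    let k : S2 → β → Prop := fun q b => ∀ᶠ q' in 𝓝 q, q' ∉ L.support → f q' = b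
    have hk : ∀ q ∈ V, ∀ᶠ q' in 𝓝 q, k q' = k q := by
      intro q hq
      obtain ⟨b, hb'⟩ := hb q hq
      filter_upwards [hloc q b hb'] with q' hq'
      ext c
      constructor
      · intro hc
        rwa [L.eventually_eq_unique hc hq']
      · intro hc
        rwa [L.eventually_eq_unique hc hb']
    refine ⟨b₀, ?_⟩
    by_cases hpC : p ∈ L.support
    · filter_upwards [eventually_nhdsWithin_iff.1 hV] with q hq hqC
      have hqV : q ∈ V := hq fun h => hqC (h ▸ hpC)
      have h1 : k q = k q₀ := IsPreconnected.eq_of_eventually_eq hVc hk hqV hq₀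
      have h2 : k q b₀ := by rw [h1]; exact hb₀
      exact h2.self_of_nhds hqC
    · have hfp := (hf p hp hpC).and (L.isClosed_support.isOpen_compl.mem_nhds hpC)
      obtain ⟨q, hq, hqV⟩ := mem_closure_iff_nhds.1 hcl _ hfp
      have h1 : k q = k q₀ := IsPreconnected.eq_of_eventually_eq hVc hk hqV hq₀
      have h2 : k q b₀ := by rw [h1]; exact hb₀
      have h3 : f q = b₀ := h2.self_of_nhds hq.2
      filter_upwards [hf p hp hpC] with q' hq' _
      rw [hq', ← hq.1, h3]
  classical
  -- On `U` the extension is the common nearby value; the value outside `U` is immaterial.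
  refine ⟨fun p => if h : p ∈ U then (hall p h).choose else f p, ?_, ?_⟩
  · intro p hp
    have h1 := (hall p hp).choose_spec
    filter_upwards [hloc p _ h1, hU.mem_nhds hp] with q hq hqU
    simp only [hp, hqU, dif_pos]
    exact L.eventually_eq_unique (hall q hqU).choose_spec hq
  · intro p hp hpC
    simp only [hp, dif_pos]
    exact ((hall p hp).choose_spec.self_of_nhds hpC).symm

end Diagram.ImmersedCurves

/-! ### The index of a point of the sphere with respect to a closed curve -/

theorem hasDerivAt_det3 {a b c : ℝ → E3} {a' b' c' : E3} {t : ℝ} (ha : HasDerivAt a a' t)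
    (hb : HasDerivAt b b' t) (hc : HasDerivAt c c' t) :
    HasDerivAt (fun s => det3 (a s) (b s) (c s))
      (det3 a' (b t) (c t) + det3 (a t) b' (c t) + det3 (a t) (b t) c') t := by
  have key : ∀ {k : ℝ → E3} {k' : E3}, HasDerivAt k k' t → ∀ i,
      HasDerivAt (fun s => k s i) (k' i) t := by
    intro k k' hk i
    exact (EuclideanSpace.proj (𝕜 := ℝ) i).hasFDerivAt.comp_hasDerivAt t hk
  have a0 := key ha 0
  have a1 := key ha 1
  have a2 := key ha 2
  have b0 := key hb 0
  have b1 := key hb 1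
  have b2 := key hb 2
  have c0 := key hc 0
  have c1 := key hc 1
  have c2 := key hc 2
  simp only [det3_expand]
  refine ((((((a0.fun_mul b1).fun_mul c2).fun_sub ((a0.fun_mul b2).fun_mul c1)).fun_sub
    ((a1.fun_mul b0).fun_mul c2)).fun_add ((a1.fun_mul b2).fun_mul c0)).fun_add
    ((a2.fun_mul b0).fun_mul c1)).fun_sub ((a2.fun_mul b1).fun_mul c0) |>.congr_deriv ?_
  ring

/-- The integral over the curve `γ` of the harmonic 1-form on the sphere with a pole at `w`. As a
function of `w`, it is locally constant off the curve and jumps by `2π` across it. -/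
def windingIntegral (γ : ℝ → S2) (w : S2) : ℝ :=
  ∫ t in (0 : ℝ)..1, det3 (incl w) (incl (γ t)) (velocity γ t) / ‖incl w - incl (γ t)‖ ^ 2

theorem norm_incl_sub_sq (w g : S2) : ‖incl w - incl g‖ ^ 2 = 2 * (1 - inner ℝ (incl w) (incl g)) := by
  rw [norm_sub_sq_real, norm_incl, norm_incl]; ring

theorem inner_incl_lt_one {w g : S2} (h : w ≠ g) : inner ℝ (incl w) (incl g) < 1 := by
  have h1 : 0 < ‖incl w - incl g‖ ^ 2 := by
    have : incl w - incl g ≠ 0 := sub_ne_zero.2 fun h' => h (incl_injective h')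
    positivity
  rw [norm_incl_sub_sq] at h1
  linarith

theorem velocity_periodic {γ : ℝ → S2} (hp : Function.Periodic γ 1) :
    Function.Periodic (velocity γ) 1 := by
  intro t
  unfold velocity
  rw [← deriv_comp_add_const]
  have : (fun s => incl (γ (s + 1))) = fun s => incl (γ s) := by ext1 s; rw [hp]
  rw [this]

/-- The derivative of the integrand in the base point is exact along the curve, hence integrates to
zero over a closed curve. The hypothesis keeps the chord off the origin and off the rays through the
curve, where the integrand is singular. -/
theorem windingIntegral_eq_of_segment {γ : ℝ → S2} (hγ : SmoothPath γ) (hp : Function.Periodic γ 1)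
    {w₀ w₁ : S2} (h : ∀ τ ∈ Icc (0 : ℝ) 1, ∀ t, incl w₀ + τ • (incl w₁ - incl w₀) ≠ 0 ∧
      inner ℝ (incl w₀ + τ • (incl w₁ - incl w₀)) (incl (γ t)) <
        ‖incl w₀ + τ • (incl w₁ - incl w₀)‖) :
    windingIntegral γ w₁ = windingIntegral γ w₀ := by
  set u := incl w₁ - incl w₀ with hu
  let w : ℝ → E3 := fun τ => incl w₀ + τ • u
  let g : ℝ → E3 := fun t => incl (γ t)
  let v : ℝ → E3 := velocity γ
  have hw : ∀ τ ∈ Icc (0 : ℝ) 1, w τ ≠ 0 := fun τ hτ => (h τ hτ 0).1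
  have hr : ∀ τ ∈ Icc (0 : ℝ) 1, ‖w τ‖ ≠ 0 := fun τ hτ => norm_ne_zero_iff.2 (hw τ hτ)
  have hq : ∀ τ ∈ Icc (0 : ℝ) 1, ∀ t, ‖w τ‖ - inner ℝ (w τ) (g t) ≠ 0 := fun τ hτ t =>
    (sub_pos.2 (h τ hτ t).2).ne'
  -- `F` extends twice the winding integrand homogeneously of degree zero in `w`, so that a straight
  -- chord can replace an arc on the sphere. `K` is the derivative of `F` in `τ`, and also the
  -- derivative of `H` in `t`.
  let F : ℝ → ℝ → ℝ := fun τ t => det3 (w τ) (g t) (v t) / (‖w τ‖ - inner ℝ (w τ) (g t))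
  let H : ℝ → ℝ → ℝ := fun τ t => det3 (w τ) u (g t) / (‖w τ‖ * (‖w τ‖ - inner ℝ (w τ) (g t)))
  let K : ℝ → ℝ → ℝ := fun τ t =>
    (det3 (w τ) u (v t) * (‖w τ‖ - inner ℝ (w τ) (g t)) + det3 (w τ) u (g t) * inner ℝ (w τ) (v t))
      / (‖w τ‖ * (‖w τ‖ - inner ℝ (w τ) (g t)) ^ 2)
  have dw : ∀ τ, HasDerivAt w u τ := fun τ => by
    simpa [w] using ((hasDerivAt_id τ).smul_const u).const_add (incl w₀)
  have dg : ∀ t, HasDerivAt g (v t) t := hγ.hasDerivAt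
  have cw : Continuous w := continuous_iff_continuousAt.2 fun τ => (dw τ).continuousAt
  have cg : Continuous g := continuous_iff_continuousAt.2 fun τ => (dg τ).continuousAt
  have cv : Continuous v := hγ.contDiff_velocity.continuous
  have dF : ∀ t, ∀ τ ∈ Icc (0 : ℝ) 1, HasDerivAt (fun τ => F τ t) (K τ t) τ := by
    intro t τ hτ
    have d1 : HasDerivAt (fun τ => det3 (w τ) (g t) (v t)) (det3 u (g t) (v t)) τ := by
      refine (hasDerivAt_det3 (dw τ) (hasDerivAt_const τ (g t))
        (hasDerivAt_const τ (v t))).congr_deriv ?_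
      simp [det3_expand]
    have d2 : HasDerivAt (fun τ => ‖w τ‖) (inner ℝ (w τ) u / ‖w τ‖) τ := by
      have h3 : (fun τ => ‖w τ‖) = fun τ => Real.sqrt (‖w τ‖ ^ 2) := by
        ext1 s; rw [Real.sqrt_sq (norm_nonneg _)]
      rw [h3]
      refine ((dw τ).norm_sq.sqrt (pow_ne_zero 2 (hr τ hτ))).congr_deriv ?_
      rw [Real.sqrt_sq (norm_nonneg _)]
      have := hr τ hτ
      field_simp
    have d3 : HasDerivAt (fun τ => inner ℝ (w τ) (g t)) (inner ℝ u (g t)) τ := by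
      simpa using (dw τ).inner ℝ (hasDerivAt_const τ (g t))
    refine (d1.fun_div (d2.fun_sub d3) (hq τ hτ t)).congr_deriv ?_
    -- After clearing denominators the two forms of the derivative differ by these identities,
    -- together with ‖γ‖ = 1 and γ ⊥ γ'.
    have e1 := det3_inner_identity (w τ) (w τ) u (g t) (v t)
    have e2 := det3_inner_identity (g t) (w τ) u (g t) (v t)
    have e3 : inner ℝ (g t) (g t) = (1 : ℝ) := inner_incl_self _
    have e4 : inner ℝ (g t) (v t) = (0 : ℝ) := hγ.inner_velocity t
    rw [e3, e4] at e2
    rw [real_inner_self_eq_norm_sq] at e1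
    rw [real_inner_comm (w τ) (g t), real_inner_comm u (g t)] at e2
    have := hr τ hτ
    have := hq τ hτ t
    simp only [K]
    field_simp
    linear_combination e1 - ‖w τ‖ * e2
  have dH : ∀ τ ∈ Icc (0 : ℝ) 1, ∀ t, HasDerivAt (fun t => H τ t) (K τ t) t := by
    intro τ hτ t
    have d1 : HasDerivAt (fun t => det3 (w τ) u (g t)) (det3 (w τ) u (v t)) t := by
      refine (hasDerivAt_det3 (hasDerivAt_const t (w τ)) (hasDerivAt_const t u)
        (dg t)).congr_deriv ?_
      simp [det3_expand]
    have d2 : HasDerivAt (fun t => inner ℝ (w τ) (g t)) (inner ℝ (w τ) (v t)) t := by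
      simpa using (hasDerivAt_const t (w τ)).inner ℝ (dg t)
    have d3 := (d2.const_sub ‖w τ‖).const_mul ‖w τ‖
    refine (d1.fun_div d3 (mul_ne_zero (hr τ hτ) (hq τ hτ t))).congr_deriv ?_
    have := hr τ hτ
    have := hq τ hτ t
    simp only [K]
    field_simp
    ring
  have cK : ContinuousOn (Function.uncurry K) (Icc 0 1 ×ˢ univ) := by
    have c1 : Continuous (fun z : ℝ × ℝ => w z.1) := cw.comp continuous_fst
    have c2 : Continuous (fun z : ℝ × ℝ => g z.2) := cg.comp continuous_snd
    have c3 : Continuous (fun z : ℝ × ℝ => v z.2) := cv.comp continuous_snd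
    have c4 := c1.norm.sub (c1.inner c2 (𝕜 := ℝ))
    apply ContinuousOn.div
    · exact (((continuous_det3 c1 continuous_const c3).mul c4).add
        ((continuous_det3 c1 continuous_const c2).mul (c1.inner c3))).continuousOn
    · exact (c1.norm.mul (c4.pow 2)).continuousOn
    · rintro ⟨τ, t⟩ ⟨hτ, -⟩
      exact mul_ne_zero (hr τ hτ) (pow_ne_zero 2 (hq τ hτ t))
  have cK1 : ∀ t, ContinuousOn (fun τ => K τ t) (Icc 0 1) := fun t =>
    cK.comp (f := fun τ => (τ, t)) (by fun_prop) (fun τ hτ => ⟨hτ, mem_univ _⟩)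
  have cK2 : ∀ τ ∈ Icc (0 : ℝ) 1, Continuous (fun t => K τ t) := fun τ hτ => by
    rw [← continuousOn_univ]
    exact cK.comp (f := fun t => (τ, t)) (by fun_prop) (fun t _ => ⟨hτ, mem_univ _⟩)
  have hu01 : uIcc (0 : ℝ) 1 = Icc 0 1 := uIcc_of_le zero_le_one
  have I1 : ∀ t, ∫ τ in (0 : ℝ)..1, K τ t = F 1 t - F 0 t := fun t =>
    intervalIntegral.integral_eq_sub_of_hasDerivAt
      (fun τ hτ => dF t τ (hu01 ▸ hτ)) (ContinuousOn.intervalIntegrable (by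
        rw [hu01]; exact cK1 t))
  have I2 : ∀ τ ∈ Icc (0 : ℝ) 1, ∫ t in (0 : ℝ)..1, K τ t = 0 := fun τ hτ => by
    rw [intervalIntegral.integral_eq_sub_of_hasDerivAt (fun t _ => dH τ hτ t)
      ((cK2 τ hτ).intervalIntegrable _ _)]
    have : g 1 = g 0 := by
      have := hp 0
      simp only [g]
      rw [← this, zero_add]
    simp only [H, this, sub_self]
  -- Fubini: integrating `K` first along the closed curve gives zero, while integrating first in `τ`
  -- gives the change of `F`.
  have hswap : ∫ t in (0 : ℝ)..1, ∫ τ in (0 : ℝ)..1, K τ t = 0 := by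
    rw [MeasureTheory.intervalIntegral_intervalIntegral_swap]
    · rw [intervalIntegral.integral_congr (g := fun _ => (0 : ℝ)) (fun τ hτ => I2 τ (hu01 ▸ hτ))]
      simp
    · have h1 : uIoc (0 : ℝ) 1 ⊆ Icc 0 1 := by
        rw [uIoc_of_le zero_le_one]; exact Ioc_subset_Icc_self
      apply MeasureTheory.IntegrableOn.mono_set (t := Icc 0 1 ×ˢ Icc 0 1) _ (prod_mono h1 h1)
      apply ContinuousOn.integrableOn_compact (isCompact_Icc.prod isCompact_Icc)
      exact cK.comp (f := Prod.swap) continuous_swap.continuousOn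
        (fun z hz => ⟨hz.2, mem_univ _⟩)
  have cF : ∀ τ ∈ Icc (0 : ℝ) 1, Continuous (fun t => F τ t) := fun τ hτ =>
    (continuous_det3 continuous_const cg cv).div
      (continuous_const.sub (continuous_const.inner cg)) (fun t => hq τ hτ t)
  have h0 : (0 : ℝ) ∈ Icc (0 : ℝ) 1 := by simp
  have h1 : (1 : ℝ) ∈ Icc (0 : ℝ) 1 := by simp
  have key : ∀ τ ∈ Icc (0 : ℝ) 1, ∀ w' : S2, w τ = incl w' →
      windingIntegral γ w' = (∫ t in (0 : ℝ)..1, F τ t) / 2 := by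
    intro τ _ w' hw'
    rw [windingIntegral, ← intervalIntegral.integral_div]
    congr 1
    ext1 t
    simp only [F, hw', norm_incl, norm_incl_sub_sq]
    rw [div_div, mul_comm 2]
  rw [key 1 h1 w₁ (by simp [w, hu]), key 0 h0 w₀ (by simp [w])]
  have : (∫ t in (0 : ℝ)..1, F 1 t) - ∫ t in (0 : ℝ)..1, F 0 t = 0 := by
    rw [← intervalIntegral.integral_sub ((cF 1 h1).intervalIntegrable _ _)
      ((cF 0 h0).intervalIntegrable _ _)]
    exact (intervalIntegral.integral_congr fun t _ => (I1 t).symm).trans hswap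
  linarith

/-- The winding integral is locally constant off the curve. -/
theorem windingIntegral_eventually_eq {γ : ℝ → S2} (hγ : SmoothPath γ)
    (hp : Function.Periodic γ 1) {p : S2} (h : p ∉ range γ) :
    ∀ᶠ q in 𝓝 p, windingIntegral γ q = windingIntegral γ p := by
  have h1 : ∀ᶠ w in 𝓝 (incl p), ∀ t, w ≠ 0 ∧ inner ℝ w (incl (γ t)) < ‖w‖ := by
    apply eventually_forall_of_periodic
    · intro t
      have c1 : Continuous (fun z : E3 × ℝ => incl (γ z.2)) :=
        continuous_incl.comp (hγ.continuous.comp continuous_snd)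
      refine (continuousAt_fst.eventually_ne (incl_ne_zero p)).and ?_
      have h2 : inner ℝ (incl p) (incl (γ t)) < ‖incl p‖ := by
        rw [norm_incl]; exact inner_incl_lt_one fun h' => h ⟨t, h'.symm⟩
      exact (continuous_fst.inner c1 (𝕜 := ℝ)).continuousAt.eventually_lt
        continuous_fst.norm.continuousAt h2
    · intro w s k hw
      have : γ (s + k) = γ s := by simpa using hp.int_mul k s
      rwa [this]
  obtain ⟨r, hr, hball⟩ := Metric.mem_nhds_iff.1 h1
  have h2 : ∀ᶠ q in 𝓝 p, incl q ∈ Metric.ball (incl p) r :=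
    continuous_incl.continuousAt.preimage_mem_nhds (Metric.ball_mem_nhds _ hr)
  filter_upwards [h2] with q hq
  apply windingIntegral_eq_of_segment hγ hp
  intro τ hτ
  apply hball
  apply (convex_ball (incl p) r).add_smul_sub_mem (Metric.mem_ball_self hr) hq hτ

/-! ### The jump of the winding integral at a simple point -/

theorem abs_det3_le (a b c : E3) : |det3 a b c| ≤ 6 * ‖a‖ * ‖b‖ * ‖c‖ := by
  have h : ∀ (z : E3) i, |z i| ≤ ‖z‖ := fun z i => by
    have := PiLp.norm_apply_le (p := 2) z i
    simpa using this
  have h3 : ∀ i j k, |a i * b j * c k| ≤ ‖a‖ * ‖b‖ * ‖c‖ := fun i j k => by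
    rw [abs_mul, abs_mul]
    gcongr <;> apply h
  rw [det3_expand, abs_le]
  have h1 := fun i j k => (abs_le.1 (h3 i j k)).1
  have h2 := fun i j k => (abs_le.1 (h3 i j k)).2
  constructor
  · linarith [h1 0 1 2, h2 0 2 1, h2 1 0 2, h1 1 2 0, h1 2 0 1, h2 2 1 0]
  · linarith [h2 0 1 2, h1 0 2 1, h1 1 0 2, h2 1 2 0, h2 2 0 1, h1 2 1 0]

/-- The area form of the cone on a smooth curve on the sphere vanishes to second order at the
base point. -/
theorem exists_det3_le_sq {γ : ℝ → S2} (hγ : SmoothPath γ) (t₀ : ℝ) :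
    ∃ C, ∀ t, |t| ≤ 1 / 2 →
      |det3 (incl (γ t₀)) (incl (γ (t₀ + t))) (velocity γ (t₀ + t))| ≤ C * t ^ 2 := by
  have hv := hγ.contDiff_velocity
  have ha : Continuous (deriv (velocity γ)) := hv.continuous_deriv (by simp)
  obtain ⟨M, hM⟩ := (isCompact_Icc (a := t₀ - 1 / 2) (b := t₀ + 1 / 2)).exists_bound_of_continuousOn
    hv.continuous.continuousOn
  obtain ⟨A, hA⟩ := (isCompact_Icc (a := t₀ - 1 / 2) (b := t₀ + 1 / 2)).exists_bound_of_continuousOn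
    ha.continuousOn
  have hmem : ∀ t, |t| ≤ 1 / 2 → t₀ + t ∈ Icc (t₀ - 1 / 2) (t₀ + 1 / 2) := fun t ht => by
    have := abs_le.1 ht
    constructor <;> linarith
  have hA0 : 0 ≤ A := (norm_nonneg _).trans (hA _ (hmem 0 (by norm_num)))
  have hM0 : 0 ≤ M := (norm_nonneg _).trans (hM _ (hmem 0 (by norm_num)))
  have ht₀ : t₀ ∈ Icc (t₀ - 1 / 2) (t₀ + 1 / 2) := by constructor <;> linarith
  have hg : ∀ s, |s| ≤ 1 / 2 → ‖incl (γ (t₀ + s)) - incl (γ t₀)‖ ≤ M * |s| := by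
    intro s hs
    have := Convex.norm_image_sub_le_of_norm_hasDerivWithin_le (f := fun s => incl (γ s))
      (f' := velocity γ) (C := M) (fun x _ => (hγ.hasDerivAt x).hasDerivWithinAt) hM
      (convex_Icc _ _) ht₀ (hmem s hs)
    simpa using this
  refine ⟨6 * M * A, fun t ht => ?_⟩
  let f : ℝ → ℝ := fun s => det3 (incl (γ t₀)) (incl (γ s)) (velocity γ s)
  -- Terms with a repeated row drop out, leaving the chord γ(s) - γ(t₀), of size O(|s - t₀|), as a
  -- row. The derivative is thus linearly small and `f` quadratically small.
  have df : ∀ s, HasDerivAt f (det3 (incl (γ t₀)) (incl (γ s) - incl (γ t₀))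
      (deriv (velocity γ) s)) s := by
    intro s
    refine (hasDerivAt_det3 (hasDerivAt_const s _) (hγ.hasDerivAt s)
      ((hv.differentiable (by simp)) s).hasDerivAt).congr_deriv ?_
    rw [det3_self₂₃, det3_sub₂, det3_self₁₂]
    simp [det3_expand]
  have hball : ∀ s ∈ Metric.closedBall t₀ |t|, |s - t₀| ≤ |t| := fun s hs => by
    simpa [Real.dist_eq] using hs
  have hf' : ∀ s ∈ Metric.closedBall t₀ |t|, ‖det3 (incl (γ t₀)) (incl (γ s) - incl (γ t₀))
      (deriv (velocity γ) s)‖ ≤ 6 * M * A * |t| := by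
    intro s hs
    have h1 := (hball s hs).trans ht
    have h2 := hg _ h1
    rw [add_sub_cancel] at h2
    have h3 := hA s (by have := hmem _ h1; rwa [add_sub_cancel] at this)
    rw [Real.norm_eq_abs]
    refine (abs_det3_le _ _ _).trans ?_
    rw [norm_incl]
    calc 6 * 1 * ‖incl (γ s) - incl (γ t₀)‖ * ‖deriv (velocity γ) s‖
        ≤ 6 * 1 * (M * |t|) * A := by
          gcongr
          exact h2.trans (mul_le_mul_of_nonneg_left (hball s hs) hM0)
      _ = 6 * M * A * |t| := by ring
  have := Convex.norm_image_sub_le_of_norm_hasDerivWithin_le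
    (fun x _ => (df x).hasDerivWithinAt) hf' (convex_closedBall t₀ |t|)
    (Metric.mem_closedBall_self (abs_nonneg t)) (y := t₀ + t)
    (by simp)
  simp only [f, det3_self₁₂, sub_zero, Real.norm_eq_abs, add_sub_cancel_left] at this
  rw [mul_assoc, abs_mul_abs_self] at this
  rw [pow_two]
  exact this

/-- A curve and a path which crosses it transversely at a simple point move away from each other
linearly. -/
theorem exists_le_norm_sub {γ : ℝ → S2} (hγ : SmoothPath γ) {t₀ : ℝ}
    (hs : ∀ s, γ s = γ t₀ → ∃ k : ℤ, s = t₀ + k) {δ : ℝ → E3} {σ : E3}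
    (hδ : HasStrictDerivAt δ σ 0) (h0 : δ 0 = incl (γ t₀))
    (hd : det3 σ (incl (γ t₀)) (velocity γ t₀) ≠ 0) :
    ∃ c > 0, ∀ᶠ ε in 𝓝 (0 : ℝ), ∀ t ∈ Icc (-(1 / 2) : ℝ) (1 / 2),
      c * ‖((ε, t) : ℝ × ℝ)‖ ≤ ‖δ ε - incl (γ (t₀ + t))‖ := by
  -- Compactness glues local constants by taking minima: at `t = 0` the bound comes from
  -- transversality, elsewhere from a positive distance.
  apply isCompact_Icc.induction_on (p := fun s => ∃ c > 0, ∀ᶠ ε in 𝓝 (0 : ℝ), ∀ t ∈ s,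
      c * ‖((ε, t) : ℝ × ℝ)‖ ≤ ‖δ ε - incl (γ (t₀ + t))‖)
  · exact ⟨1, one_pos, by simp⟩
  · rintro s s' hss ⟨c, hc, h⟩
    exact ⟨c, hc, h.mono fun ε hε t ht => hε t (hss ht)⟩
  · rintro s s' ⟨c, hc, h⟩ ⟨c', hc', h'⟩
    refine ⟨min c c', lt_min hc hc', ?_⟩
    filter_upwards [h, h'] with ε h1 h2 t ht
    rcases ht with ht | ht
    · exact (mul_le_mul_of_nonneg_right (min_le_left _ _) (norm_nonneg _)).trans (h1 t ht)
    · exact (mul_le_mul_of_nonneg_right (min_le_right _ _) (norm_nonneg _)).trans (h2 t ht)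
  · intro t ht
    have fin : ∀ {P : ℝ × ℝ → Prop}, (∀ᶠ z in 𝓝 ((0 : ℝ), t), P z) →
        ∃ s ∈ 𝓝[Icc (-(1 / 2) : ℝ) (1 / 2)] t, ∀ᶠ ε in 𝓝 (0 : ℝ), ∀ t' ∈ s, P (ε, t') := by
      intro P hP
      rw [nhds_prod_eq, eventually_prod_iff] at hP
      obtain ⟨pa, ha, pb, hb, hab⟩ := hP
      exact ⟨{t' | pb t'}, mem_nhdsWithin_of_mem_nhds hb, ha.mono fun ε hε t' ht' => hab hε ht'⟩
    by_cases h : t = 0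
    · subst h
      let f : ℝ × ℝ → E3 := fun z => δ z.1 - incl (γ (t₀ + z.2))
      have hf : HasStrictFDerivAt f ((ContinuousLinearMap.toSpanSingleton ℝ σ).comp
          (ContinuousLinearMap.fst ℝ ℝ ℝ) - (ContinuousLinearMap.toSpanSingleton ℝ
            (velocity γ t₀)).comp (ContinuousLinearMap.snd ℝ ℝ ℝ)) (0, 0) := by
        have d1 : HasStrictFDerivAt (fun z : ℝ × ℝ => z.1) (ContinuousLinearMap.fst ℝ ℝ ℝ)
          (0, 0) := hasStrictFDerivAt_fst
        have d2 : HasStrictFDerivAt (fun z : ℝ × ℝ => t₀ + z.2) (ContinuousLinearMap.snd ℝ ℝ ℝ)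
          (0, 0) := hasStrictFDerivAt_snd.const_add t₀
        have e1 := (hδ.hasStrictFDerivAt).comp ((0 : ℝ), (0 : ℝ)) d1
        have d3 : HasStrictDerivAt (fun s => incl (γ s)) (velocity γ t₀)
            (t₀ + ((0 : ℝ), (0 : ℝ)).2) := by simpa using hγ.hasStrictDerivAt t₀
        exact e1.sub (d3.hasStrictFDerivAt.comp ((0 : ℝ), (0 : ℝ)) d2)
      obtain ⟨c, hc, hP⟩ := HasStrictFDerivAt.exists_antilipschitz hf (by
        rintro ⟨α, β⟩ h
        have h' : α • σ + (0 : ℝ) • incl (γ t₀) + (-β) • velocity γ t₀ = 0 := by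
          rw [← h]; simp; abel
        obtain ⟨h1, -, h3⟩ := det3_linearIndependent hd h'
        simp at h3
        simp [h1, h3])
      have hT : Tendsto (fun z : ℝ × ℝ => (z, ((0 : ℝ), (0 : ℝ)))) (𝓝 (0, 0))
          (𝓝 ((0, 0), (0, 0))) := (Continuous.prodMk_left _).tendsto _
      obtain ⟨s, hs1, hs2⟩ := fin (hT.eventually hP)
      refine ⟨s, hs1, c, hc, ?_⟩
      filter_upwards [hs2] with ε hε t' ht'
      have := hε t' ht'
      have e : f (0, 0) = 0 := by simp [f, h0]
      rw [e, sub_zero] at this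
      simpa using this
    -- The only integer in `[-1/2, 1/2]` is zero, so on this fundamental interval the curve meets
    -- its simple point only at `t = 0`.
    · have hne : δ 0 - incl (γ (t₀ + t)) ≠ 0 := by
        rw [h0, sub_ne_zero]
        intro he
        obtain ⟨k, hk⟩ := hs _ (incl_injective he).symm
        have hk' : t = k := by linarith
        have h1 := ht.1
        have h2 := ht.2
        rw [hk'] at h1 h2 h
        have h3 : (-1 : ℝ) < k := by linarith
        have h4 : (k : ℝ) < 1 := by linarith
        have h5 : -1 < k := by exact_mod_cast h3
        have h6 : k < 1 := by exact_mod_cast h4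
        apply h
        have : k = 0 := by omega
        simp [this]
      set m := ‖δ 0 - incl (γ (t₀ + t))‖ with hm
      have hm0 : 0 < m := norm_pos_iff.2 hne
      have c1 : ContinuousAt (fun z : ℝ × ℝ => ‖δ z.1 - incl (γ (t₀ + z.2))‖) (0, t) := by
        have h1 : ContinuousAt (fun z : ℝ × ℝ => δ z.1) (0, t) :=
          ContinuousAt.comp (f := Prod.fst) (g := δ) hδ.hasDerivAt.continuousAt continuousAt_fst
        have h2 : Continuous (fun z : ℝ × ℝ => incl (γ (t₀ + z.2))) :=
          continuous_incl.comp (hγ.continuous.comp (by fun_prop))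
        exact (h1.sub h2.continuousAt).norm
      have e1 := c1.eventually (lt_mem_nhds (half_lt_self hm0))
      -- With the norm of the parameters below one, half the positive distance `m` serves as the
      -- linear constant.
      have e2 : ∀ᶠ z : ℝ × ℝ in 𝓝 (0, t), ‖z‖ < 1 := by
        apply continuous_norm.continuousAt.eventually (gt_mem_nhds _)
        show ‖((0 : ℝ), t)‖ < 1
        rw [Prod.norm_def]
        simp only [norm_zero, Real.norm_eq_abs]
        rw [max_lt_iff]
        exact ⟨one_pos, (abs_le.2 ht).trans_lt (by norm_num)⟩
      obtain ⟨s, hs1, hs2⟩ := fin (e1.and e2)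
      refine ⟨s, hs1, m / 2, by positivity, ?_⟩
      filter_upwards [hs2] with ε hε t' ht'
      obtain ⟨h1, h2⟩ := hε t' ht'
      nlinarith

/-- The integral of the inverse of a quadratic polynomial without zeros. -/
theorem integral_inv_norm_sub_smul_sq {σ v : E3} {d : ℝ} (hd : d ≠ 0)
    (h : d ^ 2 = ‖v‖ ^ 2 * ‖σ‖ ^ 2 - (inner ℝ σ v) ^ 2) :
    d * ∫ s : ℝ, (‖σ - s • v‖ ^ 2)⁻¹ = SignType.sign d * Real.pi := by
  have hv : ‖v‖ ≠ 0 := by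
    intro hv
    have hv' : v = 0 := norm_eq_zero.1 hv
    rw [hv'] at h
    simp at h
    exact hd h
  set b := ‖v‖ ^ 2 with hb
  have hb0 : 0 < b := by positivity
  set m := inner ℝ σ v / b with hm
  set k := b / |d| with hk
  have hd' : 0 < |d| := abs_pos.2 hd
  -- Completing the square, with minimum at `m` and minimum value `d ^ 2 / b`, reduces the integrand
  -- to the standard 1 / (1 + s²).
  have h1 : ∀ s : ℝ, (‖σ - s • v‖ ^ 2)⁻¹ = (b / d ^ 2) * (1 + (k * (s - m)) ^ 2)⁻¹ := by
    intro s
    have h2 : ‖σ - s • v‖ ^ 2 = d ^ 2 / b * (1 + (k * (s - m)) ^ 2) := by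
      rw [norm_sub_sq_real, norm_smul, inner_smul_right, hk, mul_pow (b / |d|), div_pow, sq_abs, mul_pow,
        ← hb, Real.norm_eq_abs, sq_abs, hm]
      field_simp
      rw [h]
      ring
    rw [h2, mul_inv, inv_div]
  simp_rw [h1]
  rw [MeasureTheory.integral_const_mul,
    MeasureTheory.integral_sub_right_eq_self (fun s : ℝ => (1 + (k * s) ^ 2)⁻¹) m,
    MeasureTheory.Measure.integral_comp_mul_left (fun s : ℝ => (1 + s ^ 2)⁻¹) k,
    integral_univ_inv_one_add_sq, hk, inv_div, abs_of_pos (by positivity), smul_eq_mul]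
  rcases lt_or_gt_of_ne hd with h3 | h3
  · rw [sign_neg h3, abs_of_neg h3]; field_simp; simp
  · rw [sign_pos h3, abs_of_pos h3]; field_simp; simp

/-- The one-sided limits of the winding integral at a simple point of a curve. -/
theorem tendsto_windingIntegral {γ : ℝ → S2} (hγ : SmoothPath γ) (hp : Function.Periodic γ 1)
    {t₀ : ℝ} (hs : ∀ s, γ s = γ t₀ → ∃ k : ℤ, s = t₀ + k) {δ : ℝ → S2} {σ : E3}
    (hδ : HasStrictDerivAt (fun s => incl (δ s)) σ 0) (h0 : δ 0 = γ t₀)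
    (hd : det3 σ (incl (γ t₀)) (velocity γ t₀) ≠ 0) :
    Tendsto (fun ε => windingIntegral γ (δ ε)) (𝓝[>] 0)
      (𝓝 ((∫ t in (-(1 / 2) : ℝ)..(1 / 2), det3 (incl (γ t₀)) (incl (γ (t₀ + t)))
          (velocity γ (t₀ + t)) / ‖incl (γ t₀) - incl (γ (t₀ + t))‖ ^ 2) +
        det3 σ (incl (γ t₀)) (velocity γ t₀) *
          ∫ s : ℝ, (‖σ - s • velocity γ t₀‖ ^ 2)⁻¹)) := by
  set x := incl (γ t₀) with hx
  let w : ℝ → E3 := fun ε => incl (δ ε)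
  let g : ℝ → E3 := fun t => incl (γ (t₀ + t))
  let v : ℝ → E3 := fun t => velocity γ (t₀ + t)
  have hw0 : w 0 = x := by simp [w, h0, hx]
  have hg0 : g 0 = x := by simp [g, hx]
  have hv0 : v 0 = velocity γ t₀ := by simp [v]
  have cg : Continuous g := continuous_incl.comp (hγ.continuous.comp (by fun_prop))
  have cv : Continuous v := hγ.contDiff_velocity.continuous.comp (by fun_prop)
  have cw : ContinuousAt w 0 := hδ.hasDerivAt.continuousAt
  obtain ⟨c, hc, hlow⟩ := exists_le_norm_sub hγ hs hδ (by rw [h0]) hd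
  obtain ⟨C, hC⟩ := exists_det3_le_sq hγ t₀
  have hC0 : 0 ≤ C := by
    have := (abs_nonneg _).trans (hC (1 / 2) (by norm_num [abs_of_pos]))
    linarith
  have hmem : ∀ t : ℝ, t ∈ Icc (-(1 / 2) : ℝ) (1 / 2) ↔ |t| ≤ 1 / 2 := fun t => by
    rw [abs_le]; rfl
  have hlow' : ∀ᶠ ε in 𝓝[>] (0 : ℝ), ∀ t ∈ Icc (-(1 / 2) : ℝ) (1 / 2),
      c * ε ≤ ‖w ε - g t‖ ∧ c * |t| ≤ ‖w ε - g t‖ := by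
    filter_upwards [nhdsWithin_le_nhds hlow] with ε hε t ht
    have h1 := hε t ht
    have h2 : ε ≤ ‖((ε, t) : ℝ × ℝ)‖ := (le_abs_self ε).trans (norm_fst_le ((ε, t) : ℝ × ℝ))
    have h3 : |t| ≤ ‖((ε, t) : ℝ × ℝ)‖ := norm_snd_le ((ε, t) : ℝ × ℝ)
    exact ⟨(mul_le_mul_of_nonneg_left h2 hc.le).trans h1,
      (mul_le_mul_of_nonneg_left h3 hc.le).trans h1⟩
  have hpos : ∀ᶠ ε in 𝓝[>] (0 : ℝ), 0 < ε := self_mem_nhdsWithin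
  have hIoc : uIoc (-(1 / 2) : ℝ) (1 / 2) ⊆ Icc (-(1 / 2)) (1 / 2) := by
    rw [uIoc_of_le (by norm_num)]; exact Ioc_subset_Icc_self
  have hIcc : uIcc (-(1 / 2) : ℝ) (1 / 2) = Icc (-(1 / 2)) (1 / 2) := uIcc_of_le (by norm_num)
  have ccont : ∀ᶠ ε in 𝓝[>] (0 : ℝ), ∀ a : E3, ContinuousOn
      (fun t => det3 a (g t) (v t) / ‖w ε - g t‖ ^ 2) (Icc (-(1 / 2)) (1 / 2)) := by
    filter_upwards [hlow', hpos] with ε hε hε0 a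
    apply ContinuousOn.div (continuous_det3 continuous_const cg cv).continuousOn
      ((continuous_const.sub cg).norm.pow 2).continuousOn
    intro t ht
    have := (hε t ht).1
    exact (pow_pos ((mul_pos hc hε0).trans_le this) 2).ne'
  -- the part with a regular integrand
  have hB : Tendsto (fun ε => ∫ t in (-(1 / 2) : ℝ)..(1 / 2),
      det3 x (g t) (v t) / ‖w ε - g t‖ ^ 2) (𝓝[>] 0)
      (𝓝 (∫ t in (-(1 / 2) : ℝ)..(1 / 2), det3 x (g t) (v t) / ‖x - g t‖ ^ 2)) := by
    -- The numerator is at most C t² and the denominator at least c² t², so the quotient is bounded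
    -- by a constant.
    apply intervalIntegral.tendsto_integral_filter_of_dominated_convergence (fun _ => C / c ^ 2)
    · filter_upwards [ccont] with ε hε
      exact ((hε x).mono hIoc).aestronglyMeasurable measurableSet_uIoc
    · filter_upwards [hlow', hpos] with ε hε hε0
      refine Eventually.of_forall fun t ht => ?_
      have ht' := hIoc ht
      obtain ⟨h1, h2⟩ := hε t ht'
      have h3 : 0 < ‖w ε - g t‖ := (mul_pos hc hε0).trans_le h1
      rw [Real.norm_eq_abs, abs_div, abs_of_pos (pow_pos h3 2), div_le_div_iff₀ (pow_pos h3 2)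
        (pow_pos hc 2)]
      have h4 := hC t ((hmem t).1 ht')
      have h5 : (c * |t|) ^ 2 ≤ ‖w ε - g t‖ ^ 2 := by gcongr
      rw [mul_pow, sq_abs] at h5
      calc |det3 x (g t) (v t)| * c ^ 2 ≤ (C * t ^ 2) * c ^ 2 := by gcongr
        _ = C * (c ^ 2 * t ^ 2) := by ring
        _ ≤ C * ‖w ε - g t‖ ^ 2 := by gcongr
    · exact intervalIntegrable_const
    · have hne : ∀ᵐ t : ℝ, t ≠ 0 := by
        simp [MeasureTheory.ae_iff, MeasureTheory.measure_singleton]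
      filter_upwards [hne] with t ht htI
      have h1 : x - g t ≠ 0 := by
        have h2 := (hlow.self_of_nhds t (hIoc htI))
        have h3 : 0 < ‖((0, t) : ℝ × ℝ)‖ := norm_pos_iff.2 (by simp [ht])
        have h4 := (mul_pos hc h3).trans_le h2
        have h5 : incl (δ 0) = x := hw0
        rw [h5] at h4
        exact norm_pos_iff.1 h4
      have h2 : Tendsto (fun ε => ‖w ε - g t‖ ^ 2) (𝓝[>] 0) (𝓝 (‖x - g t‖ ^ 2)) := by
        rw [← hw0]
        exact ((cw.tendsto.mono_left nhdsWithin_le_nhds).sub_const (g t)).norm.pow 2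
      exact tendsto_const_nhds.div h2 (pow_ne_zero 2 (norm_ne_zero_iff.2 h1))
  -- the singular part
  obtain ⟨M, hM⟩ := (isCompact_Icc (a := (-(1 / 2) : ℝ)) (b := 1 / 2)).exists_bound_of_continuousOn
    cv.continuousOn
  have hM0 : 0 ≤ M := (norm_nonneg _).trans (hM 0 (by constructor <;> norm_num))
  have hslope : Tendsto (fun ε => ε⁻¹ • (w ε - x)) (𝓝[>] 0) (𝓝 σ) := by
    have h1 := hδ.hasDerivAt.tendsto_slope_zero_right
    simp only [zero_add] at h1
    convert h1 using 4
    rw [h0]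
  have hA : Tendsto (fun ε => ∫ t in (-(1 / 2) : ℝ)..(1 / 2),
      det3 (w ε - x) (g t) (v t) / ‖w ε - g t‖ ^ 2) (𝓝[>] 0)
      (𝓝 (∫ s : ℝ, det3 σ x (v 0) * (‖σ - s • v 0‖ ^ 2)⁻¹)) := by
    -- Substitute `t = ε * s`: the numerator row `w ε - x` has order ε and the denominator order ε²,
    -- so the factor ε from `dt` leaves a finite limit on an interval growing to the whole line.
    let k : ℝ → ℝ → ℝ := fun ε s => ε * (det3 (w ε - x) (g (ε * s)) (v (ε * s)) /
      ‖w ε - g (ε * s)‖ ^ 2)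
    let I : ℝ → Set ℝ := fun ε => Ioc (-(1 / 2) / ε) (1 / 2 / ε)
    have hIm : ∀ ε > 0, ∀ s ∈ I ε, ε * s ∈ Icc (-(1 / 2) : ℝ) (1 / 2) := by
      intro ε hε s hs
      have h1 := hs.1.le
      have h2 := hs.2
      rw [div_le_iff₀ hε] at h1
      rw [le_div_iff₀ hε] at h2
      constructor <;> linarith
    have heq : (fun ε => ∫ s, (I ε).indicator (k ε) s) =ᶠ[𝓝[>] 0]
        fun ε => ∫ t in (-(1 / 2) : ℝ)..(1 / 2),
          det3 (w ε - x) (g t) (v t) / ‖w ε - g t‖ ^ 2 := by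
      filter_upwards [hpos] with ε hε
      have hle : -(1 / 2) / ε ≤ 1 / 2 / ε := by gcongr; norm_num
      rw [MeasureTheory.integral_indicator measurableSet_Ioc,
        ← intervalIntegral.integral_of_le hle]
      simp only [k]
      rw [intervalIntegral.integral_const_mul, ← smul_eq_mul,
        intervalIntegral.smul_integral_comp_mul_left
          (fun t => det3 (w ε - x) (g t) (v t) / ‖w ε - g t‖ ^ 2),
        mul_div_cancel₀ _ hε.ne', mul_div_cancel₀ _ hε.ne']
    refine Tendsto.congr' heq ?_
    apply MeasureTheory.tendsto_integral_filter_of_dominated_convergence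
      (fun s => (6 * (‖σ‖ + 1) * M * 2 / c ^ 2) * (1 + s ^ 2)⁻¹)
    · filter_upwards [ccont, hpos] with ε hε hε0
      rw [aestronglyMeasurable_indicator_iff measurableSet_Ioc]
      refine ContinuousOn.aestronglyMeasurable ?_ measurableSet_Ioc
      exact continuousOn_const.mul ((hε (w ε - x)).comp (f := fun s => ε * s) (by fun_prop)
        (hIm ε hε0))
    · have hsl : ∀ᶠ ε in 𝓝[>] (0 : ℝ), ‖ε⁻¹ • (w ε - x)‖ < ‖σ‖ + 1 :=
        hslope.norm.eventually (gt_mem_nhds (lt_add_one _))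
      filter_upwards [hlow', hpos, hsl] with ε hε hε0 hσ
      refine Eventually.of_forall fun s => ?_
      by_cases hsI : s ∈ I ε
      swap
      · rw [indicator_of_notMem hsI, norm_zero]; positivity
      rw [indicator_of_mem hsI]
      have ht := hIm ε hε0 s hsI
      obtain ⟨h1, h2⟩ := hε _ ht
      rw [abs_mul, abs_of_pos hε0] at h2
      have h3 : 0 < ‖w ε - g (ε * s)‖ := (mul_pos hc hε0).trans_le h1
      have h4 : ‖w ε - x‖ ≤ (‖σ‖ + 1) * ε := by
        rw [norm_smul, norm_inv, Real.norm_of_nonneg hε0.le, inv_mul_lt_iff₀ hε0] at hσ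
        linarith
      have h5 : |det3 (w ε - x) (g (ε * s)) (v (ε * s))| ≤ 6 * ((‖σ‖ + 1) * ε) * M := by
        refine (abs_det3_le _ _ _).trans ?_
        have : ‖g (ε * s)‖ = 1 := norm_incl _
        rw [this, mul_one]
        have := hM _ ht
        gcongr
      -- Adding the squares of the lower bounds cε and cε|s| gives the integrable majorant; this is
      -- the origin of its factor 2.
      have h6 : c ^ 2 * ε ^ 2 * (1 + s ^ 2) ≤ 2 * ‖w ε - g (ε * s)‖ ^ 2 := by
        have e1 : (c * ε) ^ 2 ≤ ‖w ε - g (ε * s)‖ ^ 2 := by gcongr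
        have e2 : (c * (ε * |s|)) ^ 2 ≤ ‖w ε - g (ε * s)‖ ^ 2 := by gcongr
        rw [mul_pow, mul_pow ε, sq_abs] at e2
        rw [mul_pow] at e1
        linarith
      simp only [k]
      rw [Real.norm_eq_abs, abs_mul, abs_div, abs_of_pos hε0, abs_of_pos (pow_pos h3 2),
        ← div_eq_mul_inv, div_div, ← mul_div_assoc, div_le_div_iff₀ (by positivity) (by positivity)]
      calc ε * |det3 (w ε - x) (g (ε * s)) (v (ε * s))| * (c ^ 2 * (1 + s ^ 2))
          ≤ ε * (6 * ((‖σ‖ + 1) * ε) * M) * (c ^ 2 * (1 + s ^ 2)) := by gcongr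
        _ = 6 * (‖σ‖ + 1) * M * (c ^ 2 * ε ^ 2 * (1 + s ^ 2)) := by ring
        _ ≤ 6 * (‖σ‖ + 1) * M * (2 * ‖w ε - g (ε * s)‖ ^ 2) := by gcongr
        _ = 6 * (‖σ‖ + 1) * M * 2 * ‖w ε - g (ε * s)‖ ^ 2 := by ring
    · exact integrable_inv_one_add_sq.const_mul _
    · refine Eventually.of_forall fun s => ?_
      have hne : σ - s • v 0 ≠ 0 := by
        intro h
        have h' : (1 : ℝ) • σ + (0 : ℝ) • x + (-s) • velocity γ t₀ = 0 := by
          rw [← h, hv0]; simp; abel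
        exact one_ne_zero (det3_linearIndependent hd h').1
      have hmul : Tendsto (fun ε : ℝ => ε * s) (𝓝[>] 0) (𝓝 0) := by
        have : Continuous (fun ε : ℝ => ε * s) := by fun_prop
        simpa using (this.tendsto 0).mono_left nhdsWithin_le_nhds
      have hgs : Tendsto (fun ε => ε⁻¹ • (g (ε * s) - x)) (𝓝[>] 0) (𝓝 (s • v 0)) := by
        have dg : HasDerivAt (fun ε => g (ε * s)) (s • v 0) 0 := by
          have e1 : HasDerivAt (fun ε : ℝ => t₀ + ε * s) s 0 := by
            simpa using ((hasDerivAt_id (0 : ℝ)).mul_const s).const_add t₀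
          have e2 : HasDerivAt (fun s => incl (γ s)) (velocity γ t₀) (t₀ + 0 * s) := by
            simpa using hγ.hasDerivAt t₀
          have := e2.scomp (0 : ℝ) e1
          rw [hv0]
          exact this
        have h1 := dg.tendsto_slope_zero_right
        simp only [zero_add, zero_mul, hg0] at h1
        exact h1
      have hlim1 : Tendsto (fun ε => ‖ε⁻¹ • (w ε - x) - ε⁻¹ • (g (ε * s) - x)‖ ^ 2) (𝓝[>] 0)
          (𝓝 (‖σ - s • v 0‖ ^ 2)) := (hslope.sub hgs).norm.pow 2
      have hlim2 : Tendsto (fun ε => det3 (ε⁻¹ • (w ε - x)) (g (ε * s)) (v (ε * s))) (𝓝[>] 0)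
          (𝓝 (det3 σ x (v 0))) := by
        apply tendsto_det3 hslope
        · rw [← hg0]; exact (cg.tendsto 0).comp hmul
        · exact (cv.tendsto 0).comp hmul
      have hlim := hlim2.mul (hlim1.inv₀ (pow_ne_zero 2 (norm_ne_zero_iff.2 hne)))
      refine hlim.congr' ?_
      have hIev : ∀ᶠ ε in 𝓝[>] (0 : ℝ), s ∈ I ε := by
        have e1 : ∀ᶠ ε in 𝓝[>] (0 : ℝ), -(1 / 2) < ε * s :=
          hmul.eventually (lt_mem_nhds (by norm_num))
        have e2 : ∀ᶠ ε in 𝓝[>] (0 : ℝ), ε * s < 1 / 2 :=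
          hmul.eventually (gt_mem_nhds (by norm_num))
        filter_upwards [e1, e2, hpos] with ε h1 h2 h3
        constructor
        · rw [div_lt_iff₀ h3]; linarith
        · rw [le_div_iff₀ h3]; linarith
      filter_upwards [hIev, hpos] with ε hε hε0
      rw [indicator_of_mem hε, ← smul_sub, sub_sub_sub_cancel_right, norm_smul, det3_smul₁, mul_pow,
        norm_inv, Real.norm_of_nonneg hε0.le, mul_inv]
      simp only [k]
      field_simp
  have hsum := hB.add hA
  rw [MeasureTheory.integral_const_mul, hv0] at hsum
  refine hsum.congr' ?_
  filter_upwards [ccont] with ε hε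
  rw [← intervalIntegral.integral_add
    (ContinuousOn.intervalIntegrable (by rw [hIcc]; exact hε x))
    (ContinuousOn.intervalIntegrable (by rw [hIcc]; exact hε (w ε - x)))]
  -- Periodicity moves the interval of integration so that `t₀` is its midpoint; then `w ε = x + (w
  -- ε - x)` splits the integrand into the two parts treated above.
  have hper : Function.Periodic (fun t => det3 (incl (δ ε)) (incl (γ t)) (velocity γ t) /
      ‖incl (δ ε) - incl (γ t)‖ ^ 2) 1 := by
    intro t
    simp only [hp t, velocity_periodic hp t]
  have h1 := hper.intervalIntegral_add_eq 0 (t₀ + -(1 / 2))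
  rw [zero_add] at h1
  rw [windingIntegral, h1]
  have h2 : t₀ + -(1 / 2) + 1 = t₀ + 1 / 2 := by ring
  rw [h2, ← intervalIntegral.integral_comp_add_left]
  congr 1
  ext1 t
  rw [det3_sub₁, ← add_div]
  congr 1
  ring

/-- The winding integral jumps by `2π` when a simple point of the curve is crossed. -/
theorem windingIntegral_jump {γ : ℝ → S2} (hγ : SmoothPath γ) (hp : Function.Periodic γ 1)
    {t₀ : ℝ} (hs : ∀ s, γ s = γ t₀ → ∃ k : ℤ, s = t₀ + k) {δ : ℝ → S2} (hδ : SmoothPath δ)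
    (h0 : δ 0 = γ t₀) (hpos : PosPair (δ 0) (velocity γ t₀) (velocity δ 0)) {a b : ℝ}
    (ha : ∀ᶠ s in 𝓝[<] (0 : ℝ), windingIntegral γ (δ s) = a)
    (hb : ∀ᶠ s in 𝓝[>] (0 : ℝ), windingIntegral γ (δ s) = b) : b = a + 2 * Real.pi := by
  set σ := velocity δ 0 with hσ
  set x := incl (γ t₀) with hx
  set v := velocity γ t₀ with hv
  have hd : 0 < det3 σ x v := by
    unfold PosPair at hpos
    rwa [h0, det3_rotate] at hpos
  have hsq : det3 σ x v ^ 2 = ‖v‖ ^ 2 * ‖σ‖ ^ 2 - (inner ℝ σ v) ^ 2 := by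
    rw [← det3_rotate x v σ, det3_sq x v σ (inner_incl_self _) (hγ.inner_velocity t₀)
      (by rw [hx, ← h0]; exact hδ.inner_velocity 0), real_inner_self_eq_norm_sq,
      real_inner_self_eq_norm_sq, real_inner_comm]
  have h1 := tendsto_windingIntegral hγ hp hs (hδ.hasStrictDerivAt 0) h0 hd.ne'
  rw [integral_inv_norm_sub_smul_sq hd.ne' hsq, sign_pos hd] at h1
  -- The limit from the left is the limit from the right for the reversed path. Its regular part is
  -- the same, and its singular part changes from π to -π, so the difference is 2π.
  have hδ' : HasStrictDerivAt (fun s => incl (δ (-s))) (-σ) 0 := by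
    have e1 : HasStrictDerivAt (fun s => incl (δ s)) σ (-0) := by
      simpa using hδ.hasStrictDerivAt 0
    have := e1.scomp (0 : ℝ) (hasStrictDerivAt_neg (0 : ℝ))
    simpa [Function.comp_def] using this
  have hdn : det3 (-σ) x v = - det3 σ x v := by
    rw [← neg_one_smul ℝ σ, det3_smul₁]; ring
  have h2 := tendsto_windingIntegral hγ hp hs hδ' (by simpa using h0)
    (by rw [hdn]; exact neg_ne_zero.2 hd.ne')
  rw [integral_inv_norm_sub_smul_sq (by rw [hdn]; exact neg_ne_zero.2 hd.ne')
    (by rw [hdn, neg_sq, hsq, norm_neg, inner_neg_left, neg_sq]), hdn,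
    sign_neg (neg_lt_zero.2 hd)] at h2
  have hb' := tendsto_nhds_unique h1 (tendsto_const_nhds.congr' (hb.mono fun _ h => h.symm))
  have hneg : Tendsto (fun s : ℝ => -s) (𝓝[>] 0) (𝓝[<] 0) := by
    have := tendsto_neg_nhdsGT (a := (0 : ℝ))
    rwa [neg_zero] at this
  have ha' := tendsto_nhds_unique h2
    (tendsto_const_nhds.congr' ((hneg.eventually ha).mono fun _ h => h.symm))
  simp only [SignType.coe_one, SignType.coe_neg] at ha' hb'
  linarith

/-! ### Construction of the Alexander numbering -/

namespace Diagram.ImmersedCurves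

variable {D : Diagram} (L : D.ImmersedCurves)

/-- An Alexander numbering of the complement of the curves: an integer-valued locally constant
function which increases by one when a curve is crossed in its normal direction. -/
theorem exists_index : ∃ n : S2 → ℤ, (∀ p ∉ L.support, ∀ᶠ q in 𝓝 p, n q = n p) ∧
    ∀ i t (δ : ℝ → S2), L.IsSimple i t → SmoothPath δ → δ 0 = L.curve i t →
      PosPair (δ 0) (velocity (L.curve i) t) (velocity δ 0) → ∀ a b,
      (∀ᶠ s in 𝓝[<] (0 : ℝ), δ s ∉ L.support ∧ n (δ s) = a) →
      (∀ᶠ s in 𝓝[>] (0 : ℝ), δ s ∉ L.support ∧ n (δ s) = b) → b = a + 1 := by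
  let N : S2 → ℝ := fun p => (∑ i, windingIntegral (L.curve i) p) / (2 * Real.pi)
  have hN : ∀ p ∉ L.support, ∀ᶠ q in 𝓝 p, N q = N p := by
    intro p hp
    have : ∀ i, ∀ᶠ q in 𝓝 p, windingIntegral (L.curve i) q = windingIntegral (L.curve i) p :=
      fun i => windingIntegral_eventually_eq (L.smooth i) (L.periodic i)
        (fun ⟨t, ht⟩ => hp (L.mem_support.2 ⟨i, t, ht⟩))
    filter_upwards [eventually_all.2 this] with q hq
    simp only [N, hq]
  have hjump : ∀ i t (δ : ℝ → S2), L.IsSimple i t → SmoothPath δ → δ 0 = L.curve i t →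
      PosPair (δ 0) (velocity (L.curve i) t) (velocity δ 0) → ∀ a b,
      (∀ᶠ s in 𝓝[<] (0 : ℝ), N (δ s) = a) → (∀ᶠ s in 𝓝[>] (0 : ℝ), N (δ s) = b) →
      b = a + 1 := by
    intro i t δ hs hδ h0 hpos a b ha hb
    -- No other curve passes through the simple point, so the remaining winding integrals are
    -- constant near it.
    set r := ∑ j ∈ Finset.univ.erase i, windingIntegral (L.curve j) (δ 0) with hr
    have hrest : ∀ᶠ s in 𝓝 (0 : ℝ), ∑ j ∈ Finset.univ.erase i,
        windingIntegral (L.curve j) (δ s) = r := by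
      have h1 : ∀ j, ∀ᶠ s in 𝓝 (0 : ℝ), j ≠ i →
          windingIntegral (L.curve j) (δ s) = windingIntegral (L.curve j) (δ 0) := by
        intro j
        by_cases hj : j = i
        · exact Eventually.of_forall fun s h => absurd hj h
        · have := windingIntegral_eventually_eq (L.smooth j) (L.periodic j) (p := δ 0)
            (fun ⟨t', ht'⟩ => hj (hs j t' (ht'.trans h0)).1)
          exact (hδ.continuous.continuousAt.eventually this).mono fun s h _ => h
      filter_upwards [eventually_all.2 h1] with s h2
      exact Finset.sum_congr rfl fun j hj => h2 j (Finset.ne_of_mem_erase hj)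
    have hsum : ∀ p, N p = (windingIntegral (L.curve i) p + ∑ j ∈ Finset.univ.erase i,
        windingIntegral (L.curve j) p) / (2 * Real.pi) := fun p => by
      simp only [N]
      rw [Finset.add_sum_erase _ (fun j => windingIntegral (L.curve j) p) (Finset.mem_univ i)]
    have hpi : (2 * Real.pi) ≠ 0 := by positivity
    have hval : ∀ s c, (∑ j ∈ Finset.univ.erase i, windingIntegral (L.curve j) (δ s) = r) →
        N (δ s) = c → windingIntegral (L.curve i) (δ s) = c * (2 * Real.pi) - r := by
      intro s c h1 h2
      rw [hsum, h1, div_eq_iff hpi] at h2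
      linarith
    have hs' : ∀ s, L.curve i s = L.curve i t → ∃ k : ℤ, s = t + k := fun s h => (hs i s h).2
    have := windingIntegral_jump (L.smooth i) (L.periodic i) hs' hδ h0 hpos
      (a := a * (2 * Real.pi) - r) (b := b * (2 * Real.pi) - r)
      (by filter_upwards [ha, nhdsWithin_le_nhds hrest] with s h1 h2 using hval s a h2 h1)
      (by filter_upwards [hb, nhdsWithin_le_nhds hrest] with s h1 h2 using hval s b h2 h1)
    have h3 : (b - (a + 1)) * (2 * Real.pi) = 0 := by linarith
    have h4 := (mul_eq_zero.1 h3).resolve_right hpi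
    linarith
  -- Jumps by one are invisible to the fractional part, so it extends over the curves to a locally
  -- constant, hence constant, function on the sphere.
  obtain ⟨g, hg, hgN⟩ := L.exists_extension (U := univ) isOpen_univ (fun p => Int.fract (N p))
    (fun p _ hp => (hN p hp).mono fun q hq => by rw [hq])
    (by
      intro i t δ V₁ V₂ hs hδ h0 _ hpos c1 c2 s1 s2 e1 e2 q₁ hq₁ q₂ hq₂
      have := hjump i t δ hs hδ h0 hpos (N q₁) (N q₂)
        (e1.mono fun s h => IsPreconnected.eq_of_eventually_eq c1
          (fun z hz => hN z (s1 hz).2) h hq₁)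
        (e2.mono fun s h => IsPreconnected.eq_of_eventually_eq c2
          (fun z hz => hN z (s2 hz).2) h hq₂)
      show Int.fract (N q₁) = Int.fract (N q₂)
      rw [this, Int.fract_add_one])
  have hconn : IsPreconnected (univ : Set S2) := by
    have h1 : IsPreconnected (Metric.sphere (0 : E3) 1) := by
      apply isPreconnected_sphere
      rw [← Module.finrank_eq_rank]
      simp
    have := isPreconnected_iff_preconnectedSpace.1 h1
    exact isPreconnected_univ
  have hconst : ∀ p q, g p = g q := fun p q =>
    IsPreconnected.eq_of_eventually_eq hconn (fun z _ => hg z (mem_univ z)) (mem_univ p)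
      (mem_univ q)
  -- Since `N` minus its floor is constant off the curves, the floor has the same jumps as `N`.
  refine ⟨fun p => ⌊N p⌋, fun p hp => (hN p hp).mono fun q hq => congrArg _ hq, ?_⟩
  intro i t δ hs hδ h0 hpos a b ha hb
  have key : ∀ s, δ s ∉ L.support → N (δ s) = ⌊N (δ s)⌋ + g (δ 0) := by
    intro s h
    have h1 := hgN (δ s) (mem_univ _) h
    rw [hconst (δ 0) (δ s), h1, Int.floor_add_fract]
  simp only at ha hb
  have := hjump i t δ hs hδ h0 hpos (a + g (δ 0)) (b + g (δ 0))
    (ha.mono fun s h => by rw [key s h.1, h.2]) (hb.mono fun s h => by rw [key s h.1, h.2])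
  have h2 : (b : ℝ) = a + 1 := by linarith
  exact_mod_cast h2

end Diagram.ImmersedCurves

namespace Diagram

variable {D : Diagram}

/-! ### Sheets -/

theorem isOpen_region {C : Set S2} (hC : IsClosed C) : IsOpen (D.region C) :=
  (isClosed_closure.union hC).isOpen_compl

theorem OnSheet.of_isPreconnected {C T : Set S2} (hT : IsPreconnected T) (h : T ⊆ D.region C)
    {A : D.Sheet C} {p q : S2} (hp : p ∈ T) (hq : q ∈ T) (hA : OnSheet A p) : OnSheet A q := by
  obtain ⟨hpr, rfl⟩ := hA
  refine ⟨h hq, ?_⟩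
  have h1 : IsPreconnected ((Subtype.val : D.region C → S2) ⁻¹' T) := by
    rw [← Topology.IsInducing.subtypeVal.isPreconnected_image, Subtype.image_preimage_coe,
      inter_eq_self_of_subset_right h]
    exact hT
  exact ConnectedComponents.coe_eq_coe'.2
    (h1.subset_connectedComponent (x := ⟨p, hpr⟩) hp (show (⟨q, h hq⟩ : D.region C).1 ∈ T from hq))

theorem OnSheet.eventually {C : Set S2} (hC : IsClosed C) {A : D.Sheet C} {p : S2}
    (hA : OnSheet A p) : ∀ᶠ q in 𝓝 p, OnSheet A q := by
  have _ : LocallyConnectedSpace S2 :=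
    ChartedSpace.locallyConnectedSpace (EuclideanSpace ℝ (Fin 2)) S2
  obtain ⟨V, hV, hVo, hpV, hVc⟩ := locallyConnectedSpace_iff_subsets_isOpen_isConnected.1 ‹_› p
    (D.region C) ((isOpen_region hC).mem_nhds hA.1)
  filter_upwards [hVo.mem_nhds hpV] with q hq
  exact OnSheet.of_isPreconnected hVc.isPreconnected hV hpV hq hA

theorem OnSheet.unique {C : Set S2} {A B : D.Sheet C} {p : S2} (hA : OnSheet A p)
    (hB : OnSheet B p) : A = B := by
  obtain ⟨h, rfl⟩ := hA
  obtain ⟨h', rfl⟩ := hB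
  rfl

/-! ### The projection close to a crossing -/

theorem hasStrictFDerivAt_proj (x : S2) :
    HasStrictFDerivAt (fun z => D.proj (radial z)) (D.diff x) (incl x) :=
  (contDiffAt_comp_radial D.contMDiff_proj (incl_ne_zero x)).hasStrictFDerivAt (by simp)

theorem diff_eq_zero {x : S2} (hx : Function.Injective (dmap D.proj x)) {u : E3}
    (hu : D.diff x u = 0) (h : inner ℝ (incl x) u = 0) : u = 0 := by
  have := fderiv_comp_radial_ker D.contMDiff_proj hx hu
  rwa [h, zero_smul] at this

/-- The squared norm is adjoined to detect the radial direction, the only kernel of `D.diff x`;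
being constant on the sphere, it imposes no condition there. -/
theorem proj_eventually_injective {x : S2} (hx : Function.Injective (dmap D.proj x)) :
    ∀ᶠ z : S2 × S2 in 𝓝 (x, x), D.proj z.1 = D.proj z.2 → z.1 = z.2 := by
  have h1 : HasStrictFDerivAt (fun z : E3 => (D.proj (radial z), ‖z‖ ^ 2))
      ((D.diff x).prod (2 • innerSL ℝ (incl x))) (incl x) :=
    (hasStrictFDerivAt_proj x).prodMk (hasStrictFDerivAt_norm_sq (incl x))
  have h2 := HasStrictFDerivAt.eventually_injective h1 (by
    intro u hu
    rw [ContinuousLinearMap.prod_apply, Prod.mk_eq_zero] at hu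
    refine diff_eq_zero hx hu.1 ?_
    simpa using hu.2)
  have hT : Tendsto (fun z : S2 × S2 => (incl z.1, incl z.2)) (𝓝 (x, x))
      (𝓝 (incl x, incl x)) :=
    ((continuous_incl.comp continuous_fst).prodMk
      (continuous_incl.comp continuous_snd)).tendsto (x, x)
  filter_upwards [hT.eventually h2] with z hz he
  apply incl_injective
  apply hz
  simp only [radial_incl, he, norm_incl]

theorem IsCrossing.ne {x y : S2} (h : D.IsCrossing x y) : x ≠ y := fun he => by
  have := h.2.1
  rw [he] at this
  exact lt_irrefl _ this

theorem IsCrossing.injective_over {x y : S2} (h : D.IsCrossing x y) :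
    Function.Injective (dmap D.proj x) := D.dmap_injective_of_double h.1 h.ne

theorem IsCrossing.injective_under {x y : S2} (h : D.IsCrossing x y) :
    Function.Injective (dmap D.proj y) := D.dmap_injective_of_double h.1.symm h.ne.symm

/-- Double points close to a crossing are crossings. -/
theorem IsCrossing.eventually {x y : S2} (h : D.IsCrossing x y) :
    ∀ᶠ z : S2 × S2 in 𝓝 (x, y), D.proj z.1 = D.proj z.2 → D.IsCrossing z.1 z.2 := by
  have e1 : ∀ᶠ z : S2 × S2 in 𝓝 (x, y), D.height z.2 < D.height z.1 :=
    (D.continuous_height.comp continuous_snd).continuousAt.eventually_lt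
      (D.continuous_height.comp continuous_fst).continuousAt h.2.1
  -- Compactness reduces a third preimage to one near a fixed `p`: local injectivity handles `p`
  -- equal to one of the two points, continuity all other `p`.
  have e2 : ∀ᶠ z : S2 × S2 in 𝓝 (x, y), ∀ p ∈ (univ : Set S2),
      D.proj z.1 = D.proj z.2 → D.proj p = D.proj z.1 → p = z.1 ∨ p = z.2 := by
    apply isCompact_univ.eventually_forall_of_forall_eventually
    intro p _
    by_cases hp : D.proj p = D.proj x
    · rcases h.2.2 p hp with rfl | rfl
      · have hT : Tendsto (fun z : (S2 × S2) × S2 => (z.2, z.1.1)) (𝓝 ((p, y), p))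
          (𝓝 (p, p)) := by
          have : Continuous (fun z : (S2 × S2) × S2 => (z.2, z.1.1)) := by fun_prop
          exact this.tendsto ((p, y), p)
        filter_upwards [hT.eventually (proj_eventually_injective h.injective_over)] with z hz _ he
        exact Or.inl (hz he)
      · have hT : Tendsto (fun z : (S2 × S2) × S2 => (z.2, z.1.2)) (𝓝 ((x, p), p))
          (𝓝 (p, p)) := by
          have : Continuous (fun z : (S2 × S2) × S2 => (z.2, z.1.2)) := by fun_prop
          exact this.tendsto ((x, p), p)
        filter_upwards [hT.eventually (proj_eventually_injective h.injective_under)] with z hz h1 he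
        exact Or.inr (hz (he.trans h1))
    · have c1 : Continuous (fun z : (S2 × S2) × S2 => D.proj z.2) :=
        D.continuous_proj.comp (by fun_prop)
      have c2 : Continuous (fun z : (S2 × S2) × S2 => D.proj z.1.1) :=
        D.continuous_proj.comp (by fun_prop)
      filter_upwards [eventually_ne_of_continuousAt c1.continuousAt c2.continuousAt
        (x := ((x, y), p)) hp] with z hz _ he
      exact absurd he hz
  filter_upwards [e1, e2] with z h1 h2 he
  exact ⟨he, h1, fun p hp => h2 p (mem_univ p) he hp⟩

/-- Close to the lower point of a crossing, the points of the under-arcs lie below points close to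
the upper point. -/
theorem IsCrossing.eventually_closure_lower {x y : S2} (h : D.IsCrossing x y) {W : Set S2}
    (hW : W ∈ 𝓝 x) :
    ∀ᶠ q in 𝓝 y, q ∈ closure D.lower → ∃ z ∈ W, D.proj z = D.proj q := by
  obtain ⟨K, hK, hKW, hKc⟩ := local_compact_nhds hW
  have e1 : ∀ᶠ q in 𝓝 y, ∀ z ∈ (univ : Set S2), D.proj z = D.proj q → D.height q < D.height z →
      z ∈ K := by
    apply isCompact_univ.eventually_forall_of_forall_eventually
    intro z _
    by_cases hz : D.proj z = D.proj y
    · rcases h.2.2 z (hz.trans h.1.symm) with rfl | rfl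
      · filter_upwards [continuousAt_snd.preimage_mem_nhds (x := (y, z)) hK] with p hp _ _
        exact hp
      · have hT : Tendsto (fun p : S2 × S2 => (p.2, p.1)) (𝓝 (z, z)) (𝓝 (z, z)) :=
          continuous_swap.tendsto (z, z)
        filter_upwards [hT.eventually (proj_eventually_injective h.injective_under)] with p hp h1 h2
        rw [hp h1] at h2
        exact absurd h2 (lt_irrefl _)
    · have c1 : Continuous (fun p : S2 × S2 => D.proj p.2) := D.continuous_proj.comp continuous_snd
      have c2 : Continuous (fun p : S2 × S2 => D.proj p.1) := D.continuous_proj.comp continuous_fst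
      filter_upwards [eventually_ne_of_continuousAt c1.continuousAt c2.continuousAt
        (x := (y, z)) hz] with p hp he
      exact absurd he hp
  obtain ⟨V, hV, hVo, hyV⟩ := mem_nhds_iff.1 e1
  -- Points of `lower` near `y` project into the compact set `D.proj '' K`. This is a closed
  -- condition, so it passes to the closure of `lower`.
  have hclosed : IsClosed (D.proj ⁻¹' (D.proj '' K)) :=
    (hKc.image D.continuous_proj).isClosed.preimage D.continuous_proj
  have hsub : V ∩ D.lower ⊆ D.proj ⁻¹' (D.proj '' K) := by
    rintro q ⟨hqV, z, hz, hlt⟩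
    exact ⟨z, hV hqV z (mem_univ z) hz hlt, hz⟩
  filter_upwards [hVo.mem_nhds hyV] with q hqV hq
  obtain ⟨z, hz, he⟩ := closure_minimal hsub hclosed (hVo.inter_closure ⟨hqV, hq⟩)
  exact ⟨z, hKW hz, he⟩

end Diagram

/-! ### Moving a crossing along the double point curve -/

theorem exists_smul_of_det3_eq_zero {x : S2} {u w : E3} (hu : inner ℝ (incl x) u = 0)
    (hw : inner ℝ (incl x) w = 0) (hu0 : u ≠ 0) (h : det3 (incl x) u w = 0) :
    ∃ r : ℝ, w = r • u := by
  have h1 := det3_sq (incl x) u w (inner_incl_self x) hu hw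
  rw [h] at h1
  have huu : inner ℝ u u ≠ (0 : ℝ) := (real_inner_self_pos.2 hu0).ne'
  -- The orthogonal projection coefficient; the squared length of the remainder is the vanishing
  -- Gram determinant divided by ⟨u, u⟩.
  refine ⟨inner ℝ u w / inner ℝ u u, ?_⟩
  rw [← sub_eq_zero, ← inner_self_eq_zero (𝕜 := ℝ)]
  rw [inner_sub_left, inner_sub_right, inner_sub_right, inner_smul_left, inner_smul_left,
    inner_smul_right, inner_smul_right, real_inner_comm u w]
  simp only [conj_trivial]
  field_simp
  linear_combination -h1

namespace Diagram

variable {D : Diagram}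

set_option maxHeartbeats 2000000 in
/-- A crossing can be moved along the double point curve off the immersed curves. -/
theorem exists_crossing_notMem (L : D.ImmersedCurves) {x : S2} {δ : ℝ → S2} (hδ : SmoothPath δ)
    (hcr : D.IsCrossing x (δ 0)) (hpos : D.PositiveSide x (deriv (fun s => D.proj (δ s)) 0))
    {A A' B : D.Sheet ∅} (hB : OnSheet B x) (hp : Passes δ A A') :
    ∃ (x' : S2) (δ' : ℝ → S2), SmoothPath δ' ∧ D.IsCrossing x' (δ' 0) ∧ x' ∉ L.support ∧
      δ' 0 ∉ L.support ∧ D.PositiveSide x' (deriv (fun s => D.proj (δ' s)) 0) ∧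
      OnSheet B x' ∧ Passes δ' A A' := by
  set y := δ 0 with hy
  set σ := velocity δ 0 with hσ
  set pr : E3 → E3 := fun z => D.proj (radial z) with hpr
  have hder : deriv (fun s => D.proj (δ s)) 0 = D.diff y σ :=
    (deriv_comp_path D.contMDiff_proj hδ 0).deriv
  rw [hder] at hpos
  have hyσ : inner ℝ (incl y) σ = 0 := hδ.inner_velocity 0
  have hσ0 : σ ≠ 0 := fun h => hpos.diff_ne 0 (by rw [h, map_zero, map_zero])
  set β := cross (incl y) σ with hβ
  have hyβ : inner ℝ (incl y) β = 0 := inner_cross_left _ _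
  have hdet : det3 (incl y) σ β ≠ 0 := by
    rw [hβ, det3_cross, inner_incl_self, hyσ, one_mul]
    have := (real_inner_self_pos.2 hσ0).ne'
    simpa using this
  -- the local diffeomorphism
  let b : ℝ × ℝ → E3 := fun z => incl (δ z.1) + z.2 • β
  have cb : Continuous b :=
    (continuous_incl.comp (hδ.continuous.comp continuous_fst)).add
      (continuous_snd.smul continuous_const)
  have hb0 : b (0, 0) = incl y := by simp [b, hy]
  -- The first component vanishes at double points, the second fixes the scale on the ray through
  -- the upper point, and the third is the displacement along `β`, which will parametrize the double
  -- point curve.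
  let f : E3 × ℝ × ℝ → E3 × ℝ × ℝ := fun z =>
    (pr z.1 - pr (b z.2), inner ℝ (incl x) z.1, z.2.2)
  let b' : ℝ × ℝ →L[ℝ] E3 := (ContinuousLinearMap.toSpanSingleton ℝ σ).comp
      (ContinuousLinearMap.fst ℝ ℝ ℝ) + (ContinuousLinearMap.snd ℝ ℝ ℝ).smulRight β
  have hb' : HasStrictFDerivAt b b' (0, 0) := by
    have d1 : HasStrictFDerivAt (fun z : ℝ × ℝ => z.1) (ContinuousLinearMap.fst ℝ ℝ ℝ)
      (0, 0) := hasStrictFDerivAt_fst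
    have d2 : HasStrictFDerivAt (fun z : ℝ × ℝ => z.2) (ContinuousLinearMap.snd ℝ ℝ ℝ)
      (0, 0) := hasStrictFDerivAt_snd
    exact ((hδ.hasStrictDerivAt 0).hasStrictFDerivAt.comp ((0 : ℝ), (0 : ℝ)) d1).add
      (d2.smul_const β)
  let f₀ : E3 × ℝ × ℝ →L[ℝ] E3 × ℝ × ℝ :=
    ((D.diff x).comp (ContinuousLinearMap.fst ℝ E3 (ℝ × ℝ)) -
      (D.diff y).comp (b'.comp (ContinuousLinearMap.snd ℝ E3 (ℝ × ℝ)))).prod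
      (((innerSL ℝ (incl x)).comp (ContinuousLinearMap.fst ℝ E3 (ℝ × ℝ))).prod
        ((ContinuousLinearMap.snd ℝ ℝ ℝ).comp (ContinuousLinearMap.snd ℝ E3 (ℝ × ℝ))))
  have hf₀ : HasStrictFDerivAt f f₀ (incl x, 0, 0) := by
    have d1 : HasStrictFDerivAt (fun z : E3 × ℝ × ℝ => z.1)
      (ContinuousLinearMap.fst ℝ E3 (ℝ × ℝ)) (incl x, 0, 0) := hasStrictFDerivAt_fst
    have d2 : HasStrictFDerivAt (fun z : E3 × ℝ × ℝ => z.2)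
      (ContinuousLinearMap.snd ℝ E3 (ℝ × ℝ)) (incl x, 0, 0) := hasStrictFDerivAt_snd
    have e1 : HasStrictFDerivAt (fun z : E3 × ℝ × ℝ => pr z.1) _ (incl x, 0, 0) :=
      (hasStrictFDerivAt_proj (D := D) x).comp (incl x, (0 : ℝ), (0 : ℝ)) d1
    have e2 : HasStrictFDerivAt (fun z : E3 × ℝ × ℝ => b z.2) _ (incl x, 0, 0) :=
      hb'.comp (incl x, (0 : ℝ), (0 : ℝ)) d2
    have e3 : HasStrictFDerivAt pr (D.diff y) (b (incl x, (0 : ℝ), (0 : ℝ)).2) := by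
      show HasStrictFDerivAt pr (D.diff y) (b (0, 0))
      rw [hb0]; exact hasStrictFDerivAt_proj y
    have e4 : HasStrictFDerivAt (fun z : E3 × ℝ × ℝ => pr (b z.2)) _ (incl x, 0, 0) :=
      e3.comp (incl x, (0 : ℝ), (0 : ℝ)) e2
    have e5 : HasStrictFDerivAt (fun z : E3 × ℝ × ℝ => inner ℝ (incl x) z.1) _ (incl x, 0, 0) :=
      (innerSL ℝ (incl x)).hasStrictFDerivAt.comp (incl x, (0 : ℝ), (0 : ℝ)) d1
    exact (e1.sub e4).prodMk (e5.prodMk (HasStrictFDerivAt.snd d2))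
  have hb'a : ∀ μ τ, b' (μ, τ) = μ • σ + τ • β := fun μ τ => by simp [b']
  have hf₀a : ∀ α μ τ, f₀ (α, μ, τ) =
      (D.diff x α - D.diff y (μ • σ + τ • β), inner ℝ (incl x) α, τ) := fun α μ τ => by
    rw [← hb'a]; simp [f₀]
  have hker : ∀ z, f₀ z = 0 → z = 0 := by
    rintro ⟨α, μ, τ⟩ h
    rw [hf₀a] at h
    simp only [Prod.mk_eq_zero] at h
    obtain ⟨h1, h2, rfl⟩ := h
    rw [zero_smul, add_zero, map_smul, sub_eq_zero] at h1
    -- A nonzero `μ` would make the velocity of the projected path tangent to the over-sheet,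
    -- against `hpos`.
    have hμ : μ = 0 := by
      by_contra hμ
      apply hpos.diff_ne (μ⁻¹ • α)
      rw [map_smul, h1, smul_smul, inv_mul_cancel₀ hμ, one_smul]
    rw [hμ, zero_smul] at h1
    rw [diff_eq_zero hcr.injective_over h1 h2, hμ]
    rfl
  let Ψ : (E3 × ℝ × ℝ) ≃L[ℝ] (E3 × ℝ × ℝ) :=
    (LinearEquiv.ofInjectiveEndo (f₀ : (E3 × ℝ × ℝ) →ₗ[ℝ] (E3 × ℝ × ℝ))
      (LinearMap.ker_eq_bot.1 (LinearMap.ker_eq_bot'.2 hker))).toContinuousLinearEquiv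
  have hΨ : (Ψ : (E3 × ℝ × ℝ) →L[ℝ] (E3 × ℝ × ℝ)) = f₀ := by
    exact ContinuousLinearMap.ext fun z => rfl
  have hf : HasStrictFDerivAt f (Ψ : (E3 × ℝ × ℝ) →L[ℝ] (E3 × ℝ × ℝ)) (incl x, 0, 0) := by
    rw [hΨ]; exact hf₀
  have hfx : f (incl x, 0, 0) = (0, 1, 0) := by
    simp only [f, hb0, hpr, radial_incl, inner_incl_self, hcr.1, sub_self]
  -- the double point curve
  let G : E3 × ℝ × ℝ → E3 × ℝ × ℝ := hf.localInverse f Ψ (incl x, 0, 0)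
  have hG : HasStrictFDerivAt G (Ψ.symm : (E3 × ℝ × ℝ) →L[ℝ] (E3 × ℝ × ℝ)) (0, 1, 0) := by
    rw [← hfx]; exact hf.to_localInverse
  have hG0 : G (0, 1, 0) = (incl x, 0, 0) := by
    rw [← hfx]; exact hf.localInverse_apply_image
  have hlin : HasStrictDerivAt (fun τ : ℝ => ((0 : E3), (1 : ℝ), τ)) (0, 0, 1) 0 :=
    (hasStrictDerivAt_const (0 : ℝ) (0 : E3)).prodMk
      ((hasStrictDerivAt_const (0 : ℝ) (1 : ℝ)).prodMk (hasStrictDerivAt_id (0 : ℝ)))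
  have hfG : ∀ᶠ τ in 𝓝 (0 : ℝ), f (G (0, 1, τ)) = (0, 1, τ) := by
    have h1 := hf.eventually_right_inverse
    rw [hfx] at h1
    exact hlin.hasDerivAt.continuousAt.eventually h1
  set κ := Ψ.symm (0, 0, 1) with hκ
  have hcurve : HasStrictDerivAt (fun τ : ℝ => G (0, 1, τ)) κ 0 :=
    HasStrictFDerivAt.comp_hasStrictDerivAt (f := fun τ : ℝ => ((0 : E3), (1 : ℝ), τ)) (0 : ℝ) hG hlin
  have hκ' : f₀ κ = (0, 0, 1) := by
    rw [← hΨ]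
    exact Ψ.apply_symm_apply _
  obtain ⟨α₀, μ₀, τ₀⟩ := κ
  rw [hf₀a] at hκ'
  simp only [Prod.mk.injEq] at hκ'
  obtain ⟨hκ1, hκ2, rfl⟩ := hκ'
  rw [one_smul, sub_eq_zero] at hκ1
  let a : ℝ → E3 := fun τ => (G (0, 1, τ)).1
  let S : ℝ → ℝ := fun τ => (G (0, 1, τ)).2.1
  have ha : HasStrictDerivAt a α₀ 0 :=
    (ContinuousLinearMap.fst ℝ E3 (ℝ × ℝ)).hasStrictFDerivAt.comp_hasStrictDerivAt (0 : ℝ) hcurve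
  have hS : HasStrictDerivAt S μ₀ 0 :=
    ((ContinuousLinearMap.fst ℝ ℝ ℝ).comp
      (ContinuousLinearMap.snd ℝ E3 (ℝ × ℝ))).hasStrictFDerivAt.comp_hasStrictDerivAt (0 : ℝ) hcurve
  have ha0 : a 0 = incl x := by simp only [a, hG0]
  have hS0 : S 0 = 0 := by simp only [S, hG0]
  have hG3 : ∀ᶠ τ in 𝓝 (0 : ℝ), G (0, 1, τ) = (a τ, S τ, τ) ∧ pr (a τ) = pr (b (S τ, τ)) := by
    filter_upwards [hfG] with τ h
    simp only [f, Prod.mk.injEq] at h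
    obtain ⟨h1, h2, h3⟩ := h
    have h4 : (G (0, 1, τ)).2 = (S τ, τ) := Prod.ext rfl h3
    refine ⟨Prod.ext rfl h4, ?_⟩
    rw [h4] at h1
    exact sub_eq_zero.1 h1
  have hbS : HasStrictDerivAt (fun τ => b (S τ, τ)) (μ₀ • σ + β) 0 := by
    have h1 : HasStrictFDerivAt b b' (S 0, (0 : ℝ)) := by rw [hS0]; exact hb'
    have := HasStrictFDerivAt.comp_hasStrictDerivAt (f := fun τ : ℝ => (S τ, id τ)) (0 : ℝ) h1
      (hS.prodMk (hasStrictDerivAt_id (0 : ℝ)))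
    rw [hb'a, one_smul] at this
    exact this
  have hbS0 : b (S 0, 0) = incl y := by rw [hS0, hb0]
  -- The double point curve has a nonzero tangent in space: its lift to the under-sheet has
  -- `β`-component one, and the projection is immersive there.
  have hnz : D.diff x α₀ ≠ 0 := by
    rw [hκ1]
    intro h
    have h1 := diff_eq_zero hcr.injective_under h (by
      rw [inner_add_right, inner_smul_right, hyσ, hyβ]; ring)
    have h2 : (0 : ℝ) • incl y + μ₀ • σ + (1 : ℝ) • β = 0 := by rw [← h1]; simp
    exact one_ne_zero (det3_linearIndependent hdet h2).2.2
  -- transversality to the immersed curves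
  have htr : ∀ (p q : S2) (η ζ : E3), q ≠ p → D.proj q = D.proj p → inner ℝ (incl p) η = 0 →
      D.diff p η = D.diff q ζ → D.diff p η ≠ 0 → ∀ i t, L.curve i t = p →
      det3 (incl p) (velocity (L.curve i) t) η ≠ 0 := by
    rintro p q η ζ hqp hpq hη he hne i t rfl hdet0
    -- If a curve of `L` were tangent to the double point curve, its projected velocity would lie in
    -- the tangent plane of the other sheet as well, which `L.double_transverse` forbids.
    obtain ⟨r, hr⟩ := exists_smul_of_det3_eq_zero ((L.smooth i).inner_velocity t) hη
      (L.immersed i t) hdet0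
    apply L.double_transverse i t q hqp hpq
    rw [(deriv_comp_path D.contMDiff_proj (L.smooth i) t).deriv, range_dmap D.contMDiff_proj]
    have hr0 : r ≠ 0 := by
      rintro rfl
      apply hne
      rw [hr, zero_smul, map_zero]
    refine ⟨r⁻¹ • ζ, ?_⟩
    change D.diff q (r⁻¹ • ζ) = D.diff (L.curve i t) (velocity (L.curve i) t)
    rw [map_smul, ← he, hr, map_smul, smul_smul, inv_mul_cancel₀ hr0, one_smul]
  have hoff1 : ∀ᶠ τ in 𝓝[≠] (0 : ℝ), radial (a τ) ∉ L.support :=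
    L.eventually_radial_notMem_support ha ha0
      (htr x y α₀ _ hcr.ne.symm hcr.1.symm hκ2 hκ1 hnz)
  have hoff2 : ∀ᶠ τ in 𝓝[≠] (0 : ℝ), radial (b (S τ, τ)) ∉ L.support :=
    L.eventually_radial_notMem_support hbS hbS0
      (htr y x _ α₀ hcr.ne hcr.1 (by
        rw [inner_add_right, inner_smul_right, hyσ, hyβ]; ring) hκ1.symm (by rw [← hκ1]; exact hnz))
  -- the moved points
  have cS : ContinuousAt S 0 := hS.hasDerivAt.continuousAt
  have cx : ContinuousAt (fun τ => radial (a τ)) 0 :=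
    ContinuousAt.comp (g := radial) (f := a) (by rw [ha0]; exact continuousAt_radial (incl_ne_zero x))
      ha.hasDerivAt.continuousAt
  have cbS : ContinuousAt (fun τ => b (S τ, τ)) 0 := hbS.hasDerivAt.continuousAt
  have cy : ContinuousAt (fun τ => radial (b (S τ, τ))) 0 :=
    ContinuousAt.comp (g := radial) (f := fun τ => b (S τ, τ))
      (by rw [hbS0]; exact continuousAt_radial (incl_ne_zero y)) cbS
  have hx0 : radial (a 0) = x := by rw [ha0, radial_incl]
  have hy0 : radial (b (S 0, 0)) = y := by rw [hbS0, radial_incl]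
  have hcross : ∀ᶠ τ in 𝓝 (0 : ℝ), D.IsCrossing (radial (a τ)) (radial (b (S τ, τ))) := by
    have h1 := hcr.eventually
    rw [← hx0, ← hy0] at h1
    filter_upwards [(cx.prodMk cy).eventually h1, hG3] with τ h2 h3
    exact h2 h3.2
  have hBτ : ∀ᶠ τ in 𝓝 (0 : ℝ), OnSheet B (radial (a τ)) := by
    have h1 := hB.eventually isClosed_empty
    rw [← hx0] at h1
    exact cx.eventually h1
  -- the moved paths
  have hsmall : ∀ᶠ τ in 𝓝 (0 : ℝ), ∀ s, b (s, τ) ≠ 0 := by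
    have c1 : Continuous (fun τ : ℝ => ‖τ • β‖) := by fun_prop
    have h1 : ‖(0 : ℝ) • β‖ < 1 := by simp
    filter_upwards [c1.continuousAt.eventually (gt_mem_nhds h1)] with τ hτ s h
    have h2 : incl (δ s) = -(τ • β) := eq_neg_of_add_eq_zero_left h
    have h3 := norm_incl (δ s)
    rw [h2, norm_neg] at h3
    exact hτ.ne h3
  let path : ℝ → ℝ → S2 := fun τ s => radial (b (s + S τ, τ))
  have hpath : ∀ᶠ τ in 𝓝 (0 : ℝ), SmoothPath (path τ) ∧
      deriv (fun s => D.proj (path τ s)) 0 =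
        fderiv ℝ pr (b (S τ, τ)) (velocity δ (S τ)) := by
    filter_upwards [hsmall] with τ hτ
    have e1 : ContDiff ℝ ∞ (fun s => incl (δ (s + S τ)) + τ • β) :=
      (hδ.contDiff.comp (contDiff_id.add contDiff_const)).add contDiff_const
    refine ⟨SmoothPath.radial (f := fun s => b (s + S τ, τ)) e1 fun s => hτ _, ?_⟩
    have e2 : HasDerivAt (fun s => b (s + S τ, τ)) (velocity δ (S τ)) 0 := by
      have h1 : HasDerivAt (fun s => incl (δ s)) (velocity δ (S τ)) (0 + S τ) := by
        rw [zero_add]; exact hδ.hasDerivAt _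
      exact (h1.comp_add_const (0 : ℝ) (S τ)).add_const (τ • β)
    have e3 : HasFDerivAt pr (fderiv ℝ pr (b (S τ, τ))) (b (0 + S τ, τ)) := by
      rw [zero_add]
      exact ((contDiffAt_comp_radial D.contMDiff_proj (hτ (S τ))).differentiableAt
        (by simp)).hasFDerivAt
    exact (e3.comp_hasDerivAt (0 : ℝ) e2).deriv
  have hposτ : ∀ᶠ τ in 𝓝 (0 : ℝ),
      D.PositiveSide (radial (a τ)) (fderiv ℝ pr (b (S τ, τ)) (velocity δ (S τ))) := by
    have c1 : ContinuousAt (fderiv ℝ pr) (b (S 0, 0)) := by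
      rw [hbS0]
      exact ((contDiffAt_comp_radial D.contMDiff_proj (incl_ne_zero y)).fderiv_right
        (m := 0) (by simp)).continuousAt
    have c2 : ContinuousAt (fun τ => fderiv ℝ pr (b (S τ, τ))) 0 :=
      ContinuousAt.comp (f := fun τ => b (S τ, τ)) c1 cbS
    have c3 : ContinuousAt (fun τ => velocity δ (S τ)) 0 :=
      ContinuousAt.comp (f := S) hδ.contDiff_velocity.continuous.continuousAt cS
    have c4 := c2.clm_apply c3
    have h1 := hpos.eventually
    have h2 : D.diff y σ = fderiv ℝ pr (b (S 0, 0)) (velocity δ (S 0)) := by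
      rw [hbS0, hS0]; rfl
    rw [h2, ← hx0] at h1
    exact (cx.prodMk c4).eventually h1
  -- away from the crossing, the moved paths stay off the under-arcs
  have hlow : ∀ᶠ z : ℝ × ℝ in 𝓝 (0, 0), radial (b z) ∈ closure D.lower → z.1 = S z.2 := by
    have hinj := HasStrictFDerivAt.eventually_injective hf₀ hker
    rw [nhds_prod_eq, eventually_prod_iff] at hinj
    obtain ⟨P, hP, Q, hQ, hPQ⟩ := hinj
    rw [nhds_prod_eq, eventually_prod_iff] at hP
    obtain ⟨P₁, hP₁, P₂, hP₂, hPP⟩ := hP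
    have hnorm : ∀ᶠ z in 𝓝 x, 0 < inner ℝ (incl x) (incl z) ∧
        P₁ ((inner ℝ (incl x) (incl z))⁻¹ • incl z) := by
      have c1 : Continuous (fun z : S2 => inner ℝ (incl x) (incl z)) :=
        continuous_const.inner continuous_incl
      have h1 : 0 < inner ℝ (incl x) (incl x) := by rw [inner_incl_self]; exact one_pos
      refine (c1.continuousAt.eventually (lt_mem_nhds h1)).and ?_
      have c2 : ContinuousAt (fun z : S2 => (inner ℝ (incl x) (incl z))⁻¹ • incl z) x :=
        (c1.continuousAt.inv₀ h1.ne').smul continuous_incl.continuousAt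
      apply c2.eventually
      simp only [inner_incl_self, inv_one, one_smul]
      exact hP₁
    have h1 := hcr.eventually_closure_lower hnorm
    have c1 : ContinuousAt (fun z => radial (b z)) (0, 0) :=
      ContinuousAt.comp (g := radial) (f := b) (by rw [hb0]; exact continuousAt_radial (incl_ne_zero y))
        cb.continuousAt
    have hyb : radial (b (0, 0)) = y := by rw [hb0, radial_incl]
    rw [← hyb] at h1
    have hQ' : ∀ᶠ τ in 𝓝 (0 : ℝ), Q (G (0, 1, τ)) := by
      have := hcurve.hasDerivAt.continuousAt.tendsto
      rw [hG0] at this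
      exact this.eventually hQ
    have c2 : Tendsto (fun z : ℝ × ℝ => z.2) (𝓝 (0, 0)) (𝓝 0) := continuous_snd.tendsto _
    have hz0 : ∀ᶠ z : ℝ × ℝ in 𝓝 (0, 0), b z ≠ 0 := by
      apply cb.continuousAt.eventually_ne
      rw [hb0]; exact incl_ne_zero y
    filter_upwards [c1.eventually h1, c2.eventually hQ', hP₂, c2.eventually hG3, c2.eventually hfG]
      with z h2 h3 h4 h5 h6 hz
    obtain ⟨p, ⟨hp1, hp2⟩, hp3⟩ := h2 hz
    -- Rescaling the upper point to the plane ⟨x, ·⟩ = 1 gives it the same `f`-value as the point of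
    -- the double curve with this `τ`, and `f` is locally injective.
    set r := (inner ℝ (incl x) (incl p))⁻¹ with hr
    have hrpos : 0 < r := inv_pos.2 hp1
    have h7 : f (r • incl p, z) = (0, 1, z.2) := by
      simp only [f, hpr, radial_smul hrpos, radial_incl, inner_smul_right]
      rw [hp3, sub_self, hr, inv_mul_cancel₀ hp1.ne']
    have h8 := hPQ (hPP hp2 h4) h3 (h7.trans h6.symm)
    simp only at h8
    rw [h5.1] at h8
    exact congrArg (fun w : E3 × ℝ × ℝ => w.2.1) h8
  obtain ⟨ρ, hρ, hρP⟩ := Metric.eventually_nhds_iff.1 hlow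
  -- The endpoints are fixed before `τ`, so for small `τ` their displaced copies still lie on `A`
  -- and `A'`; between them the moved path meets the under-arcs only at `S τ`.
  obtain ⟨s₁, hs₁A, hs₁⟩ := (hp.1.and (Ioo_mem_nhdsLT (neg_lt_zero.2 hρ))).exists
  obtain ⟨s₂, hs₂A, hs₂⟩ := (hp.2.and (Ioo_mem_nhdsGT hρ)).exists
  have hend : ∀ (s : ℝ) (A : D.Sheet ∅), OnSheet A (δ s) →
      ∀ᶠ τ in 𝓝 (0 : ℝ), OnSheet A (radial (b (s, τ))) := by
    intro s A hA
    have h1 := hA.eventually isClosed_empty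
    have h2 : b (s, 0) = incl (δ s) := by simp [b]
    have h3 : radial (b (s, 0)) = δ s := by rw [h2, radial_incl]
    have c1 : ContinuousAt (fun τ => radial (b (s, τ))) 0 :=
      ContinuousAt.comp (g := radial) (f := fun τ => b (s, τ))
        (by rw [h2]; exact continuousAt_radial (incl_ne_zero _)) (by fun_prop)
    rw [← h3] at h1
    exact c1.eventually h1
  have hτρ : ∀ᶠ τ in 𝓝 (0 : ℝ), |τ| < ρ ∧ S τ ∈ Ioo s₁ s₂ := by
    refine (continuous_abs.continuousAt.eventually (gt_mem_nhds (by simpa using hρ))).and ?_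
    apply cS.preimage_mem_nhds
    rw [hS0]
    exact Ioo_mem_nhds hs₁.2 hs₂.1
  have hfin : ∀ᶠ τ in 𝓝[≠] (0 : ℝ), radial (a τ) ∉ L.support ∧ path τ 0 ∉ L.support ∧
      SmoothPath (path τ) ∧ D.IsCrossing (radial (a τ)) (path τ 0) ∧
      D.PositiveSide (radial (a τ)) (deriv (fun s => D.proj (path τ s)) 0) ∧
      OnSheet B (radial (a τ)) ∧ Passes (path τ) A A' := by
    filter_upwards [hoff1, hoff2, nhdsWithin_le_nhds hcross, nhdsWithin_le_nhds hBτ,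
      nhdsWithin_le_nhds hpath, nhdsWithin_le_nhds hposτ, nhdsWithin_le_nhds (hend s₁ A hs₁A),
      nhdsWithin_le_nhds (hend s₂ A' hs₂A), nhdsWithin_le_nhds hτρ, nhdsWithin_le_nhds hsmall]
      with τ h1 h2 h3 h4 h5 h6 h7 h8 h9 h10
    have hp0 : path τ 0 = radial (b (S τ, τ)) := by simp [path]
    have cτ : Continuous (fun s => radial (b (s, τ))) := by
      rw [continuous_iff_continuousAt]
      intro s
      exact ContinuousAt.comp (g := radial) (f := fun s => b (s, τ)) (continuousAt_radial (h10 s))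
        (by fun_prop)
    have hreg : ∀ s, |s| < ρ → s ≠ S τ → radial (b (s, τ)) ∈ D.region ∅ := by
      intro s hs hne
      have hz : dist ((s, τ) : ℝ × ℝ) (0, 0) < ρ := by
        rw [Prod.dist_eq, max_lt_iff]
        simpa using ⟨hs, h9.1⟩
      simp only [region, union_empty]
      exact fun h => hne (hρP hz h)
    refine ⟨h1, by rwa [hp0], h5.1, by rwa [hp0], by rw [h5.2]; exact h6, h4, ?_, ?_⟩
    · have hpre : IsPreconnected ((fun s => radial (b (s, τ))) '' Ico s₁ (S τ)) :=
        isPreconnected_Ico.image _ cτ.continuousOn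
      have hsub : (fun s => radial (b (s, τ))) '' Ico s₁ (S τ) ⊆ D.region ∅ := by
        rintro _ ⟨s, hs, rfl⟩
        exact hreg s (abs_lt.2 ⟨hs₁.1.trans_le hs.1, by linarith [hs.2, h9.2.2, hs₂.2]⟩) hs.2.ne
      have hlt : s₁ - S τ < 0 := by linarith [h9.2.1]
      filter_upwards [Ioo_mem_nhdsLT hlt] with s hs
      exact OnSheet.of_isPreconnected hpre hsub ⟨s₁, ⟨le_refl _, h9.2.1⟩, rfl⟩
        ⟨s + S τ, ⟨by linarith [hs.1], by linarith [hs.2]⟩, rfl⟩ h7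
    · have hpre : IsPreconnected ((fun s => radial (b (s, τ))) '' Ioc (S τ) s₂) :=
        isPreconnected_Ioc.image _ cτ.continuousOn
      have hsub : (fun s => radial (b (s, τ))) '' Ioc (S τ) s₂ ⊆ D.region ∅ := by
        rintro _ ⟨s, hs, rfl⟩
        exact hreg s (abs_lt.2 ⟨by linarith [hs.1, h9.2.1, hs₁.1], hs.2.trans_lt hs₂.2⟩) hs.1.ne'
      have hlt : 0 < s₂ - S τ := by linarith [h9.2.2]
      filter_upwards [Ioo_mem_nhdsGT hlt] with s hs
      exact OnSheet.of_isPreconnected hpre hsub ⟨s₂, ⟨h9.2.2, le_refl _⟩, rfl⟩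
        ⟨s + S τ, ⟨by linarith [hs.1], by linarith [hs.2]⟩, rfl⟩ h8
  obtain ⟨τ, h1, h2, h3, h4, h5, h6, h7⟩ := hfin.exists
  exact ⟨radial (a τ), path τ, h3, h4, h1, h2, h5, h6, h7⟩

end Diagram

/-! ### The kink map -/

section Kink

variable {R : Type*} [Rack R]

theorem op_kink_self (a : R) : op (kink a) a = a := (op_eq_self_iff_eq_kink a _).2 rfl

/-- Indeed (a * ι(b)) * b = (a * b) * (ι(b) * b) = (a * b) * b, and `b` cancels on the right. -/
theorem op_kink (a b : R) : op a (kink b) = op a b := Rack.self_invAct_act_eq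

/-- By self-distributivity ι(a) * b has the property characterizing ι(a * b). -/
theorem kink_op (a b : R) : kink (op a b) = op (kink a) b := by
  symm
  rw [← op_eq_self_iff_eq_kink, ← op_op, op_kink_self]

/-- The kink map is a permutation of the rack. -/
def kinkEquiv (R : Type*) [Rack R] : Equiv.Perm R where
  toFun := kink
  invFun a := op a a
  left_inv a := by
    change op (kink a) (kink a) = a
    rw [op_kink, op_kink_self]
  right_inv a := by
    change kink (op a a) = a
    rw [kink_op, op_kink_self]

theorem kinkEquiv_zpow_op (n : ℤ) (a b : R) :
    (kinkEquiv R ^ n) (op a b) = op ((kinkEquiv R ^ n) a) b := by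
  have h : Commute (kinkEquiv R) (Equiv.ofBijective _ (op_bijective b)) := by
    ext a
    exact kink_op a b
  exact DFunLike.congr_fun (h.zpow_left n) a

theorem op_kinkEquiv_zpow (n : ℤ) (a b : R) : op a ((kinkEquiv R ^ n) b) = op a b := by
  have h : ∀ b, op a (kinkEquiv R b) = op a b := fun b => op_kink a b
  induction n generalizing b with
  | zero => simp
  | succ n ih => rw [zpow_add_one, Equiv.Perm.mul_apply, ih, h]
  | pred n ih =>
    rw [zpow_sub_one, Equiv.Perm.mul_apply, ih, ← h]
    exact congrArg (op a) ((kinkEquiv R).apply_symm_apply b)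

end Kink

namespace Diagram

variable {D : Diagram}

/-! ### Refining the sheets -/

theorem region_subset (C : Set S2) : D.region C ⊆ D.region ∅ :=
  compl_subset_compl.2 (union_subset_union_right _ (empty_subset C))

theorem mem_region {C : Set S2} {p : S2} : p ∈ D.region C ↔ p ∈ D.region ∅ ∧ p ∉ C := by
  simp [region]

/-- The sheet of the diagram which contains a given sheet of the diagram cut along `C`. -/
def ambientSheet {C : Set S2} : D.Sheet C → D.Sheet ∅ :=
  Continuous.connectedComponentsMap (continuous_inclusion (region_subset C))

theorem OnSheet.ambient {C : Set S2} {A : D.Sheet C} {p : S2} (h : OnSheet A p) :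
    OnSheet (ambientSheet A) p := by
  obtain ⟨h, rfl⟩ := h
  exact ⟨region_subset C h, rfl⟩

theorem exists_onSheet {C : Set S2} (A : D.Sheet C) : ∃ p, OnSheet A p := by
  obtain ⟨p, rfl⟩ := ConnectedComponents.surjective_coe A
  exact ⟨p, p.2, rfl⟩

/-- The sheet through a point. -/
def sheetOf {C : Set S2} {p : S2} (h : p ∈ D.region C) : D.Sheet C :=
  ConnectedComponents.mk (⟨p, h⟩ : D.region C)

theorem onSheet_sheetOf {C : Set S2} {p : S2} (h : p ∈ D.region C) : OnSheet (sheetOf h) p :=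
  ⟨h, rfl⟩

theorem OnSheet.eq_sheetOf {C : Set S2} {A : D.Sheet C} {p : S2} (h : OnSheet A p)
    (h' : p ∈ D.region C) : A = sheetOf h' := h.unique (onSheet_sheetOf h')

/-- A locally constant function is constant on each sheet. -/
theorem OnSheet.eq_of_eventually_eq {β : Type*} {C : Set S2} {f : S2 → β}
    (hf : ∀ p ∈ D.region C, ∀ᶠ q in 𝓝 p, f q = f p) {A : D.Sheet C} {p q : S2}
    (hp : OnSheet A p) (hq : OnSheet A q) : f p = f q := by
  obtain ⟨hp, rfl⟩ := hp
  obtain ⟨hq, h⟩ := hq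
  have h1 := ConnectedComponents.coe_eq_coe'.1 h
  have h2 : IsPreconnected (Subtype.val '' connectedComponent (⟨p, hp⟩ : D.region C)) :=
    isPreconnected_connectedComponent.image _ continuous_subtype_val.continuousOn
  refine IsPreconnected.eq_of_eventually_eq h2 ?_ ⟨_, mem_connectedComponent, rfl⟩ ⟨_, h1, rfl⟩
  rintro _ ⟨z, -, rfl⟩
  exact hf z z.2

theorem exists_onSheet_notMem (L : D.ImmersedCurves) (A : D.Sheet ∅) :
    ∃ p, OnSheet A p ∧ p ∉ L.support := by
  obtain ⟨p, hp⟩ := exists_onSheet A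
  obtain ⟨q, hq, hqC⟩ := mem_closure_iff_nhds.1 (L.mem_closure_compl_support p) _
    (hp.eventually isClosed_empty)
  exact ⟨q, hq, hqC⟩

/-- A path which passes between two sheets at a point off `C` passes between two sheets of the
diagram cut along `C`. -/
theorem Passes.exists_refinement {C : Set S2} (hC : IsClosed C) {δ : ℝ → S2} (hδ : Continuous δ)
    {A A' : D.Sheet ∅} (h : Passes δ A A') (h0 : δ 0 ∉ C) :
    ∃ A₁ A₁' : D.Sheet C, Passes δ A₁ A₁' := by
  have hC' : ∀ᶠ s in 𝓝 (0 : ℝ), δ s ∉ C :=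
    hδ.continuousAt.preimage_mem_nhds (hC.isOpen_compl.mem_nhds h0)
  have key : ∀ I : Set ℝ, I.Nonempty → IsPreconnected I → (∀ s ∈ I, δ s ∈ D.region C) →
      ∃ A₁ : D.Sheet C, ∀ s ∈ I, OnSheet A₁ (δ s) := by
    rintro I ⟨s₀, hs₀⟩ hI hreg
    refine ⟨sheetOf (hreg s₀ hs₀), fun s hs => ?_⟩
    refine OnSheet.of_isPreconnected (hI.image δ hδ.continuousOn) ?_ (mem_image_of_mem δ hs₀)
      (mem_image_of_mem δ hs) (onSheet_sheetOf _)
    rintro _ ⟨s, hs, rfl⟩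
    exact hreg s hs
  obtain ⟨l, hl, hl'⟩ := mem_nhdsLT_iff_exists_Ioo_subset.1
    (h.1.and (nhdsWithin_le_nhds hC'))
  obtain ⟨u, hu, hu'⟩ := mem_nhdsGT_iff_exists_Ioo_subset.1
    (h.2.and (nhdsWithin_le_nhds hC'))
  obtain ⟨A₁, h1⟩ := key (Ioo l 0) (nonempty_Ioo.2 hl) isPreconnected_Ioo
    fun s hs => mem_region.2 ⟨(hl' hs).1.1, (hl' hs).2⟩
  obtain ⟨A₁', h2⟩ := key (Ioo 0 u) (nonempty_Ioo.2 hu) isPreconnected_Ioo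
    fun s hs => mem_region.2 ⟨(hu' hs).1.1, (hu' hs).2⟩
  exact ⟨A₁, A₁', mem_of_superset (Ioo_mem_nhdsLT hl) h1, mem_of_superset (Ioo_mem_nhdsGT hu) h2⟩

/-! ### Twisting colorings by an index function -/

section Twist

variable {R : Type*} [Rack R] (L : D.ImmersedCurves) (n : S2 → ℤ)

/-- The coloring of the sheets of `(D, L)` given by applying powers of the kink map to a coloring
of the sheets of `D`. -/
def twist (c : D.Sheet ∅ → R) (A : D.Sheet L.support) : R :=
  (kinkEquiv R ^ n (exists_onSheet A).choose) (c (ambientSheet A))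

variable {L n}

theorem twist_eq (hn : ∀ p ∉ L.support, ∀ᶠ q in 𝓝 p, n q = n p) (c : D.Sheet ∅ → R)
    {A : D.Sheet L.support} {p : S2} (hp : OnSheet A p) :
    twist L n c A = (kinkEquiv R ^ n p) (c (ambientSheet A)) := by
  have : n (exists_onSheet A).choose = n p := OnSheet.eq_of_eventually_eq
    (fun q hq => hn q (mem_region.1 hq).2) (exists_onSheet A).choose_spec hp
  rw [twist, this]

/-- Just before and just after time `0` the index has its value at `δ 0`. Hence the two under-sheets
at a crossing off the curves are twisted by the same power of ι. -/
theorem exists_index_eq (hn : ∀ p ∉ L.support, ∀ᶠ q in 𝓝 p, n q = n p) {δ : ℝ → S2}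
    (hδ : Continuous δ) (h0 : δ 0 ∉ L.support) {A A' : D.Sheet L.support} (h : Passes δ A A') :
    (∃ p, OnSheet A p ∧ n p = n (δ 0)) ∧ ∃ p, OnSheet A' p ∧ n p = n (δ 0) := by
  have h1 : ∀ᶠ s in 𝓝 (0 : ℝ), n (δ s) = n (δ 0) := hδ.continuousAt.eventually (hn _ h0)
  obtain ⟨s, hs, hs'⟩ := (h.1.and (nhdsWithin_le_nhds h1)).exists
  obtain ⟨u, hu, hu'⟩ := (h.2.and (nhdsWithin_le_nhds h1)).exists
  exact ⟨⟨_, hs, hs'⟩, ⟨_, hu, hu'⟩⟩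

theorem Passes.ambient {C : Set S2} {δ : ℝ → S2} {A A' : D.Sheet C} (h : Passes δ A A') :
    Passes δ (ambientSheet A) (ambientSheet A') :=
  ⟨h.1.mono fun _ h => h.ambient, h.2.mono fun _ h => h.ambient⟩

/-- The common power of ι on the under-sheets commutes with the right translation, and the power on
the over-sheet does not affect it. -/
theorem doubleRelation_twist (hn : ∀ p ∉ L.support, ∀ᶠ q in 𝓝 p, n q = n p)
    {c : D.Sheet ∅ → R} (hc : D.DoubleRelation c) : D.DoubleRelation (twist L n c) := by
  intro x δ A A' B hδ hcr _ hδC hpos hB hp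
  obtain ⟨⟨p, hp1, hp2⟩, ⟨p', hp1', hp2'⟩⟩ := exists_index_eq hn hδ.continuous hδC hp
  rw [twist_eq hn c hp1, twist_eq hn c hp1', twist_eq hn c hB, hp2, hp2',
    hc x δ _ _ _ hδ hcr (notMem_empty _) (notMem_empty _) hpos hB.ambient hp.ambient,
    op_kinkEquiv_zpow, kinkEquiv_zpow_op]

theorem curveRelation_twist (hn : ∀ p ∉ L.support, ∀ᶠ q in 𝓝 p, n q = n p)
    (hjump : ∀ i t (δ : ℝ → S2), L.IsSimple i t → SmoothPath δ → δ 0 = L.curve i t →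
      PosPair (δ 0) (velocity (L.curve i) t) (velocity δ 0) → ∀ a b,
      (∀ᶠ s in 𝓝[<] (0 : ℝ), δ s ∉ L.support ∧ n (δ s) = a) →
      (∀ᶠ s in 𝓝[>] (0 : ℝ), δ s ∉ L.support ∧ n (δ s) = b) → b = a + 1)
    (c : D.Sheet ∅ → R) : L.CurveRelation (twist L n c) := by
  intro i t δ A A' hδ h0 hs hlow hpos hp
  obtain ⟨p, hpA⟩ := exists_onSheet A
  obtain ⟨p', hpA'⟩ := exists_onSheet A'
  have hconst : ∀ {A : D.Sheet L.support} {p q : S2}, OnSheet A p → OnSheet A q → n q = n p :=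
    fun h h' => OnSheet.eq_of_eventually_eq (fun q hq => hn q (mem_region.1 hq).2) h' h
  have h1 : n p' = n p + 1 := hjump i t δ hs hδ h0 hpos _ _
    (hp.1.mono fun s h => ⟨(mem_region.1 h.1).2, hconst hpA h⟩)
    (hp.2.mono fun s h => ⟨(mem_region.1 h.1).2, hconst hpA' h⟩)
  -- Off the under-arcs both sides of the curve belong to one sheet of `D`, so only the index
  -- differs.
  have h0r : δ 0 ∈ D.region ∅ := by simpa [region] using hlow
  have h2 : ∀ᶠ s in 𝓝 (0 : ℝ), OnSheet (sheetOf h0r) (δ s) :=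
    hδ.continuous.continuousAt.eventually ((onSheet_sheetOf h0r).eventually isClosed_empty)
  obtain ⟨s, hs1, hs2⟩ := (hp.ambient.1.and (nhdsWithin_le_nhds h2)).exists
  obtain ⟨u, hu1, hu2⟩ := (hp.ambient.2.and (nhdsWithin_le_nhds h2)).exists
  rw [twist_eq hn c hpA, twist_eq hn c hpA', hs1.unique hs2, hu1.unique hu2, h1, add_comm,
    zpow_one_add]
  rfl

/-- Every sheet of `D` contains a point off the curves, and powers of ι are injective. -/
theorem twist_injective (hn : ∀ p ∉ L.support, ∀ᶠ q in 𝓝 p, n q = n p) :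
    Function.Injective (twist (R := R) L n) := by
  intro c₁ c₂ h
  ext1 A
  obtain ⟨p, hp, hpC⟩ := exists_onSheet_notMem L A
  have hr : p ∈ D.region L.support := mem_region.2 ⟨hp.1, hpC⟩
  have h1 := congrFun h (sheetOf hr)
  rw [twist_eq hn _ (onSheet_sheetOf hr), twist_eq hn _ (onSheet_sheetOf hr),
    (onSheet_sheetOf hr).ambient.unique hp] at h1
  exact (kinkEquiv R ^ n p).injective h1

theorem exists_twist_eq (hn : ∀ p ∉ L.support, ∀ᶠ q in 𝓝 p, n q = n p)
    (hjump : ∀ i t (δ : ℝ → S2), L.IsSimple i t → SmoothPath δ → δ 0 = L.curve i t →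
      PosPair (δ 0) (velocity (L.curve i) t) (velocity δ 0) → ∀ a b,
      (∀ᶠ s in 𝓝[<] (0 : ℝ), δ s ∉ L.support ∧ n (δ s) = a) →
      (∀ᶠ s in 𝓝[>] (0 : ℝ), δ s ∉ L.support ∧ n (δ s) = b) → b = a + 1)
    {c' : D.Sheet L.support → R} (hc₁ : D.DoubleRelation c') (hc₂ : L.CurveRelation c') :
    ∃ c : D.Sheet ∅ → R, D.DoubleRelation c ∧ twist L n c = c' := by
  classical
  -- The untwisted coloring as a function of points; `none` serves as value off the region without
  -- requiring an element of `R`.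
  let f : S2 → Option R := fun p =>
    if h : p ∈ D.region L.support then some ((kinkEquiv R ^ (-n p)) (c' (sheetOf h))) else none
  have hfA : ∀ {A : D.Sheet L.support} {p : S2}, OnSheet A p →
      f p = some ((kinkEquiv R ^ (-n p)) (c' A)) := by
    intro A p h
    simp only [f, h.1, dif_pos, h.eq_sheetOf h.1]
  have hdiff : D.region ∅ \ L.support = D.region L.support := by
    ext p; exact mem_region.symm
  have hconst : ∀ {A : D.Sheet L.support} {p q : S2}, OnSheet A p → OnSheet A q → n q = n p :=
    fun h h' => OnSheet.eq_of_eventually_eq (fun q hq => hn q (mem_region.1 hq).2) h' h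
  obtain ⟨g, hg, hgf⟩ := L.exists_extension (isOpen_region (D := D) isClosed_empty) f
    (by
      intro p hp hpC
      have hpr : p ∈ D.region L.support := mem_region.2 ⟨hp, hpC⟩
      have h1 := onSheet_sheetOf hpr
      filter_upwards [h1.eventually L.isClosed_support, hn p hpC] with q h2 h3
      rw [hfA h1, hfA h2, h3])
    (by
      -- Crossing the curve raises `n` by one and applies ι to `c'`, so ι^(-n) `c'` is unchanged.
      intro i t δ V₁ V₂ hs hδ h0 hU hpos c1 c2 s1 s2 e1 e2 q₁ hq₁ q₂ hq₂
      rw [hdiff] at s1 s2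
      have o1 := onSheet_sheetOf (s1 hq₁)
      have o2 := onSheet_sheetOf (s2 hq₂)
      have p1 : ∀ᶠ s in 𝓝[<] (0 : ℝ), OnSheet (sheetOf (s1 hq₁)) (δ s) :=
        e1.mono fun s h => OnSheet.of_isPreconnected c1 s1 hq₁ h o1
      have p2 : ∀ᶠ s in 𝓝[>] (0 : ℝ), OnSheet (sheetOf (s2 hq₂)) (δ s) :=
        e2.mono fun s h => OnSheet.of_isPreconnected c2 s2 hq₂ h o2
      have h1 : n q₂ = n q₁ + 1 := hjump i t δ hs hδ h0 hpos _ _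
        (p1.mono fun s h => ⟨(mem_region.1 h.1).2, hconst o1 h⟩)
        (p2.mono fun s h => ⟨(mem_region.1 h.1).2, hconst o2 h⟩)
      have h2 : c' (sheetOf (s2 hq₂)) = kinkEquiv R (c' (sheetOf (s1 hq₁))) :=
        hc₂ i t δ _ _ hδ h0 hs (by simpa [region] using hU) hpos ⟨p1, p2⟩
      rw [hfA o1, hfA o2, h1, h2, ← Equiv.Perm.mul_apply, ← zpow_add_one]
      congr 3
      ring)
  have hc : ∀ A : D.Sheet ∅, ∃ r, ∀ p, OnSheet A p → g p = some r := by
    intro A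
    obtain ⟨q, hq, hqC⟩ := exists_onSheet_notMem L A
    have hqr : q ∈ D.region L.support := mem_region.2 ⟨hq.1, hqC⟩
    refine ⟨(kinkEquiv R ^ (-n q)) (c' (sheetOf hqr)), fun p hp => ?_⟩
    rw [OnSheet.eq_of_eventually_eq hg hp hq, hgf q hq.1 hqC, hfA (onSheet_sheetOf hqr)]
  choose c hc using hc
  have key : ∀ {A : D.Sheet L.support} {p : S2}, OnSheet A p →
      c (ambientSheet A) = (kinkEquiv R ^ (-n p)) (c' A) := by
    intro A p h
    have h1 := hc _ p h.ambient
    rw [hgf p h.ambient.1 (mem_region.1 h.1).2, hfA h] at h1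
    exact (Option.some_injective _ h1).symm
  refine ⟨c, ?_, ?_⟩
  · intro x δ A A' B hδ hcr _ _ hpos hB hp
    -- The crossing may lie on `L`, where `c'` satisfies no relation; the moved crossing has the
    -- same sheets of `D`, and there the relation for `c'` can be untwisted.
    obtain ⟨x', δ', hδ', hcr', hx', hδ0', hpos', hB', hp'⟩ :=
      exists_crossing_notMem L hδ hcr hpos hB hp
    obtain ⟨A₁, A₁', hp₁⟩ := hp'.exists_refinement L.isClosed_support hδ'.continuous hδ0'
    have hxr : x' ∈ D.region L.support := mem_region.2 ⟨hB'.1, hx'⟩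
    have hB₁ := onSheet_sheetOf hxr
    have h1 := hc₁ x' δ' A₁ A₁' _ hδ' hcr' hx' hδ0' hpos' hB₁ hp₁
    obtain ⟨⟨p, hp1, hp2⟩, ⟨p', hp1', hp2'⟩⟩ :=
      exists_index_eq hn hδ'.continuous hδ0' hp₁
    obtain ⟨s, hs1, hs2⟩ := (hp'.1.and hp₁.ambient.1).exists
    obtain ⟨u, hu1, hu2⟩ := (hp'.2.and hp₁.ambient.2).exists
    rw [hs1.unique hs2, hu1.unique hu2, hB'.unique hB₁.ambient, key hp1, key hp1', key hB₁, hp2,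
      hp2', h1, op_kinkEquiv_zpow, kinkEquiv_zpow_op]
  · ext1 A
    obtain ⟨p, hp⟩ := exists_onSheet A
    rw [twist_eq hn c hp, key hp, ← Equiv.Perm.mul_apply, ← zpow_add, add_neg_cancel, zpow_zero]
    rfl

end Twist

end Diagram

end SurfaceKnot

end

/-! ### The bijection given by twisting -/

theorem theorem4p3 {R : Type*} [Rack R] (D : SurfaceKnot.Diagram)
    (L : D.ImmersedCurves) :
    Nonempty (SurfaceKnot.Diagram.ColoringWith R L ≃ D.Coloring R) := by
  obtain ⟨n, hn, hjump⟩ := L.exists_index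
  let Φ : D.Coloring R → SurfaceKnot.Diagram.ColoringWith R L := fun c =>
    ⟨SurfaceKnot.Diagram.twist L n c.1, SurfaceKnot.Diagram.doubleRelation_twist hn c.2,
      SurfaceKnot.Diagram.curveRelation_twist hn hjump c.1⟩
  refine ⟨(Equiv.ofBijective Φ ⟨fun c₁ c₂ h => ?_, fun c' => ?_⟩).symm⟩
  · exact Subtype.ext (SurfaceKnot.Diagram.twist_injective hn (congrArg Subtype.val h))
  · obtain ⟨c, hc, h⟩ := SurfaceKnot.Diagram.exists_twist_eq hn hjump c'.2.1 c'.2.2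
    exact ⟨⟨c, hc⟩, Subtype.ext h⟩
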